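/- **Setting.** A *full Markov triple* on a probability space $(E,\mathcal F,\mu)$ with $L^2(\mu)$ separable consists of the following data (all random variables are taken up to $\mu$-a.e. equality). There are a vector space $\mathcal A$ of real random variables, stable under products and under $C^\infty$ maps $\Psi:\mathbb R^k\to\mathbb R$, and a subspace $\mathcal A_0\subseteq\mathcal A$ of bounded functions, which is an ideal of $\mathcal A$, dense in $L^p(\mu)$ for all $1\le p<\infty$, and stable under $C^\infty$ maps $\Psi$ with $\Psi(0)=0$. There are a linear operator $L:\mathcal A\to\mathcal A$ and the bilinear map $\Gamma(F,G)=\frac12\big(L(FG)-FLG-GLF\big)$ on $\mathcal A\times\mathcal A$, with $L(\mathcal A_0)\subseteq\mathcal A_0$ and $\Gamma(\mathcal A_0\times\mathcal A_0)\subseteq\mathcal A_0$, such that: * $\Gamma(F,F)\ge 0$, with equality if and only if $F$ is constant; * for every $F\in\mathcal A_0$ there is $c_F<\infty$ with $|\int\Gamma(F,G)\,d\mu|\le c_F\|G\|_2$ for all $G\in\mathcal A_0$; * $\int G\,LF\,d\mu=-\int\Gamma(F,G)\,d\mu$ whenever $F,G\in\mathcal A$ and at least one of them is in $\mathcal A_0$;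 * $\Gamma(\Psi(F_1,\dots,F_k),G)=\sum_j\partial_j\Psi(F_1,\dots,F_k)\,\Gamma(F_j,G)$ and $L\Psi(F_1,\dots,F_k)=\sum_i\partial_i\Psi(F_1,\dots,F_k)\,LF_i+\sum_{i,j}\partial_{ij}\Psi(F_1,\dots,F_k)\,\Gamma(F_i,F_j)$ for $C^\infty$ functions $\Psi$ and $F_i,G\in\mathcal A$. Let $\mathcal D(\mathcal E)\subseteq L^2(\mu)$ be the completion of $\mathcal A_0$ for the norm $(\|F\|_2^2+\int\Gamma(F,F)\,d\mu)^{1/2}$, and let $\mathcal E$ be the continuous extension of $(F,G)\mapsto\int\Gamma(F,G)\,d\mu$ to $\mathcal D(\mathcal E)\times\mathcal D(\mathcal E)$. Let $\mathcal D(L)$ be the set of $F\in\mathcal D(\mathcal E)$ with $|\mathcal E(F,G)|\le c_F\|G\|_2$ for all $G\in\mathcal D(\mathcal E)$, and for $F\in\mathcal D(L)$ let $LF\in L^2(\mu)$ be given by $\int G\,LF\,d\mu=-\mathcal E(F,G)$ for all $G\in\mathcal D(\mathcal E)$. It is also part of the definition that $1\in\mathcal D(L)$ with $L1=0$, and that every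 $F\in\mathcal D(L)$ with $LF=0$ is constant. The operator $L$ is called a *Markov diffusion generator*. Let $F\in\mathcal D(L)$, $F\neq0$, $LF=-\lambda F$ with $\lambda>0$. Consider the numbers $\eta>1$ such that $-\eta\lambda$ is an eigenvalue of $L$ (on $\mathcal D(L)$) and $F^2\in\bigoplus_{\kappa\le\eta\lambda}\ker(L+\kappa\,\mathrm{Id})$, the closed orthogonal sum in $L^2(\mu)$ over the eigenvalues $-\kappa$ with $\kappa\le\eta\lambda$. $F$ is called *chaotic* if such $\eta$ exist, and the smallest such $\eta$ is its *chaos grade*. Let $m,b_0,b_1,b_2\in\mathbb R$ and $b(x)=b_2x^2+b_1x+b_0$. The *Pearson distribution* with mean $m$ and diffusion coefficient $b$ is the law $\nu$ associated to $dX_t=-\theta(X_t-m)\,dt+\sqrt{2\theta b(X_t)}\,dB_t$, that is, a probability measure with finite mean $m$ and with a density $p$ which is positive on an open interval $(l,u)$, $-\infty\le l<u\le\infty$, zero outside it, and satisfies $b(x)=-\frac1{p(x)}\int_{-\infty}^x(y-m)p(y)\,dy$ for $x\in(l,u)$ (it does not depend on $\theta>0$). For a class $\mathscr H$ of Borel functions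 on $\mathbb R$, put $d_{\mathscr H}(X,Y)=\sup_{h\in\mathscr H}|\mathbb E\,h(X)-\mathbb E\,h(Y)|$. The class is *separating* if two laws on $\mathbb R$ coincide whenever every $h\in\mathscr H$ is integrable with the same integral under both. $d_{\mathscr H}$ is *admissible* for a set of random variables if $h(X)$ is integrable for every $X$ in the set and every $h\in\mathscr H$. Finally put $$Q(x)=x^2+\frac{2(b_1+m)}{2b_2-1}x+\frac1{b_2-1}\Big(b_0+\frac{m(b_1+m)}{2b_2-1}\Big),\qquad U(x)=(1-b_2)Q^2(x)-\tfrac1{12}(Q'(x))^3(x-m).$$ **Theorem 3.6.** Let $\nu$ be a Pearson distribution with mean $m$ and diffusion coefficient $b$ which has a finite fourth moment, and let $Z$ be a random variable with law $\nu$. (a) Let $\mathscr H$ be a separating class of absolutely continuous functions with $\sup_{h\in\mathscr H}\|h'\|_\infty<\infty$. There is a constant $c_{\mathscr H}>0$, depending only on $\mathscr H$ and $\nu$, such that the following holds. For $k\in\mathbb N$ let $F_k$ be a chaotic eigenfunction with chaos grade $\eta_k$ of a Markov diffusion generator $L_k$ of a full Markov triple over $(E_k,\mu_k)$, let $G_k=F_k+m$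 and $\xi_k=\eta_k-2(1-b_2)$, and assume that $d_{\mathscr H}$ is admissible for $\{G_k:k\in\mathbb N\}\cup\{Z\}$. Then for every $k$ the variables $U(G_k)$ and $Q^2(G_k)$ are integrable, and, if $\eta_k\le2(1-b_2)$, $$d_{\mathscr H}(G_k,Z)\le c_{\mathscr H}\sqrt{\Big(1-b_2-\frac{\eta_k}4\Big)\int_{E_k}U(G_k)\,d\mu_k},$$ whereas, if $\eta_k>2(1-b_2)$, $$d_{\mathscr H}(G_k,Z)\le c_{\mathscr H}\sqrt{\Big(1-b_2-\frac{\eta_k}4\Big)\int_{E_k}U(G_k)\,d\mu_k+\frac{\xi_k(1-b_2)}2\int_{E_k}Q^2(G_k)\,d\mu_k};$$ in both cases the quantity under the root is non-negative. (b) Let $F_k,\eta_k,L_k,G_k$ be as in (a) (no class $\mathscr H$ is involved here). If (i) $\int_{E_k}U(G_k)\,d\mu_k\to0$ and (ii) for every subsequence $(\eta_{k_r})$ such that $\eta_{k_r}>2(1-b_2)$ for all $r$ one has $\sup_r\int_{E_{k_r}}Q^2(G_{k_r})\,d\mu_{k_r}<\infty$ and $\eta_{k_r}\to2(1-b_2)$,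 then $G_k$ converges in distribution to $Z$. -/

import Mathlib

open MeasureTheory ProbabilityTheory Filter Topology
open scoped ENNReal

noncomputable section

/-- The class of `x ↦ Ψ (F₁ x, …, F_k x)`, for (classes of) random variables `F₁, …, F_k`. -/
def smoothComp {E : Type*} [MeasurableSpace E] {μ : Measure E} {k : ℕ}
    (Ψ : (Fin k → ℝ) → ℝ) (hΨ : ContDiff ℝ (⊤ : ℕ∞) Ψ) (F : Fin k → (E →ₘ[μ] ℝ)) : E →ₘ[μ] ℝ :=
  AEEqFun.mk (fun x => Ψ (fun i => F i x))
    (hΨ.continuous.comp_aestronglyMeasurable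
      (aemeasurable_pi_lambda _ fun i => (F i).aemeasurable).aestronglyMeasurable)

/-- First partial derivative `∂ⱼ Ψ` on `ℝᵏ`. -/
def partialDeriv {k : ℕ} (j : Fin k) (Ψ : (Fin k → ℝ) → ℝ) : (Fin k → ℝ) → ℝ :=
  fun y => fderiv ℝ Ψ y (Pi.single j 1)

/-- The algebraic data of a Markov triple `(E, μ, Γ)`: the algebras `A₀ ⊆ A` of random variables,
the carré du champ `Γ` and the generator `L`. Random variables are taken up to `μ`-a.e. equality;
no integrability is asked of the elements of `A`. -/
structure DiffusionTriple {E : Type*} [MeasurableSpace E] (μ : Measure E) where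
  /-- the large algebra -/
  A : Submodule ℝ (E →ₘ[μ] ℝ)
  mul_mem : ∀ {F G : E →ₘ[μ] ℝ}, F ∈ A → G ∈ A → F * G ∈ A
  smooth_mem : ∀ {k : ℕ} (Ψ : (Fin k → ℝ) → ℝ) (hΨ : ContDiff ℝ (⊤ : ℕ∞) Ψ) (F : Fin k → (E →ₘ[μ] ℝ)),
    (∀ i, F i ∈ A) → smoothComp Ψ hΨ F ∈ A
  /-- the small algebra of bounded functions -/
  A₀ : Submodule ℝ (E →ₘ[μ] ℝ)
  A₀_le : A₀ ≤ A
  bounded : ∀ F ∈ A₀, ∃ C : ℝ, ∀ᵐ x ∂μ, |F x| ≤ C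
  ideal : ∀ {F G : E →ₘ[μ] ℝ}, F ∈ A₀ → G ∈ A → F * G ∈ A₀
  smooth_mem₀ : ∀ {k : ℕ} (Ψ : (Fin k → ℝ) → ℝ) (hΨ : ContDiff ℝ (⊤ : ℕ∞) Ψ)
    (F : Fin k → (E →ₘ[μ] ℝ)), Ψ 0 = 0 → (∀ i, F i ∈ A₀) → smoothComp Ψ hΨ F ∈ A₀
  dense : ∀ p : ℝ≥0∞, 1 ≤ p → p ≠ ∞ → ∀ f : E → ℝ, MemLp f p μ → ∀ ε : ℝ≥0∞, 0 < ε →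
    ∃ G ∈ A₀, eLpNorm (fun x => f x - G x) p μ < ε
  /-- the carré du champ -/
  Γ : A →ₗ[ℝ] A →ₗ[ℝ] A
  /-- the generator -/
  L : A →ₗ[ℝ] A
  two_mul_Γ : ∀ F G : A, (2 : ℝ) • (Γ F G : E →ₘ[μ] ℝ) =
    (L ⟨F * G, mul_mem F.2 G.2⟩ : E →ₘ[μ] ℝ) - (F : E →ₘ[μ] ℝ) * L G - (G : E →ₘ[μ] ℝ) * L F
  Γ_mem₀ : ∀ F G : A, (F : E →ₘ[μ] ℝ) ∈ A₀ → (G : E →ₘ[μ] ℝ) ∈ A₀ →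
    (Γ F G : E →ₘ[μ] ℝ) ∈ A₀
  L_mem₀ : ∀ F : A, (F : E →ₘ[μ] ℝ) ∈ A₀ → (L F : E →ₘ[μ] ℝ) ∈ A₀
  Γ_nonneg : ∀ F : A, ∀ᵐ x ∂μ, 0 ≤ (Γ F F : E →ₘ[μ] ℝ) x
  Γ_eq_zero_iff : ∀ F : A, (Γ F F : E →ₘ[μ] ℝ) = 0 ↔ ∃ c : ℝ, ∀ᵐ x ∂μ, (F : E →ₘ[μ] ℝ) x = c
  Γ_bound : ∀ F : A, (F : E →ₘ[μ] ℝ) ∈ A₀ → ∃ c : ℝ, ∀ G : A, (G : E →ₘ[μ] ℝ) ∈ A₀ →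
    |∫ x, (Γ F G : E →ₘ[μ] ℝ) x ∂μ| ≤ c * √(∫ x, (G : E →ₘ[μ] ℝ) x ^ 2 ∂μ)
  integral_by_parts : ∀ F G : A, ((F : E →ₘ[μ] ℝ) ∈ A₀ ∨ (G : E →ₘ[μ] ℝ) ∈ A₀) →
    ∫ x, (G : E →ₘ[μ] ℝ) x * (L F : E →ₘ[μ] ℝ) x ∂μ = -∫ x, (Γ F G : E →ₘ[μ] ℝ) x ∂μ
  Γ_diffusion : ∀ {k : ℕ} (Ψ : (Fin k → ℝ) → ℝ) (hΨ : ContDiff ℝ (⊤ : ℕ∞) Ψ) (F : Fin k → A) (G : A),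
    ∀ᵐ x ∂μ, (Γ ⟨smoothComp Ψ hΨ fun i => (F i : E →ₘ[μ] ℝ),
        smooth_mem Ψ hΨ _ fun i => (F i).2⟩ G : E →ₘ[μ] ℝ) x =
      ∑ j, partialDeriv j Ψ (fun i => (F i : E →ₘ[μ] ℝ) x) * (Γ (F j) G : E →ₘ[μ] ℝ) x
  L_diffusion : ∀ {k : ℕ} (Ψ : (Fin k → ℝ) → ℝ) (hΨ : ContDiff ℝ (⊤ : ℕ∞) Ψ) (F : Fin k → A),
    ∀ᵐ x ∂μ, (L ⟨smoothComp Ψ hΨ fun i => (F i : E →ₘ[μ] ℝ),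
        smooth_mem Ψ hΨ _ fun i => (F i).2⟩ : E →ₘ[μ] ℝ) x =
      ∑ i, partialDeriv i Ψ (fun l => (F l : E →ₘ[μ] ℝ) x) * (L (F i) : E →ₘ[μ] ℝ) x +
      ∑ i, ∑ j, partialDeriv i (partialDeriv j Ψ) (fun l => (F l : E →ₘ[μ] ℝ) x) *
        (Γ (F i) (F j) : E →ₘ[μ] ℝ) x

namespace DiffusionTriple

variable {E : Type*} [MeasurableSpace E] {μ : Measure E} (T : DiffusionTriple μ)

/-- The Dirichlet form `ℰ(F, G) = ∫ Γ(F, G) dμ` (used on `A₀`). -/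
def energy₀ (F G : T.A) : ℝ := ∫ x, (T.Γ F G : E →ₘ[μ] ℝ) x ∂μ

/-- `u` is a sequence in `A₀` which is Cauchy for the energy and converges to `F` in `L²`. -/
def IsApproxSeq (F : Lp ℝ 2 μ) (u : ℕ → T.A) : Prop :=
  (∀ n, (u n : E →ₘ[μ] ℝ) ∈ T.A₀) ∧
  Tendsto (fun n => eLpNorm (fun x => F x - (u n : E →ₘ[μ] ℝ) x) 2 μ) atTop (𝓝 0) ∧
  Tendsto (fun p : ℕ × ℕ => T.energy₀ (u p.1 - u p.2) (u p.1 - u p.2)) atTop (𝓝 0)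

/-- The domain `𝒟(ℰ)`: the completion of `A₀` in the energy norm, realized inside `L²(μ)`. -/
def energyDomain : Set (Lp ℝ 2 μ) := {F | ∃ u, T.IsApproxSeq F u}

open Classical in
/-- The extension of the Dirichlet form to `𝒟(ℰ) × 𝒟(ℰ)` by continuity
(the limit does not depend on the approximating sequences). -/
def energy (F G : Lp ℝ 2 μ) : ℝ :=
  if h : F ∈ T.energyDomain ∧ G ∈ T.energyDomain then
    limUnder atTop (fun n => T.energy₀ (h.1.choose n) (h.2.choose n))
  else 0

/-- The domain `𝒟(L)` of the generator in `L²(μ)`. -/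
def genDomain : Set (Lp ℝ 2 μ) :=
  {F | F ∈ T.energyDomain ∧ ∃ c : ℝ, ∀ G ∈ T.energyDomain, |T.energy F G| ≤ c * ‖G‖}

/-- `F ∈ 𝒟(L)` and `L F = H`, where `L` is extended to `𝒟(L)` by integration by parts. -/
def IsGen (F H : Lp ℝ 2 μ) : Prop :=
  F ∈ T.genDomain ∧ ∀ G ∈ T.energyDomain, ∫ x, G x * H x ∂μ = -T.energy F G

/-- The kernel `ker (L + κ Id)`, a set of elements of `𝒟(L)`. -/
def eigenspace (κ : ℝ) : Set (Lp ℝ 2 μ) := {F | T.IsGen F (-(κ • F))}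

/-- `-κ` belongs to the set `Λ` of eigenvalues of `L`. -/
def IsEigenvalueNeg (κ : ℝ) : Prop := ∃ F ∈ T.eigenspace κ, F ≠ 0

/-- The Hilbert (closed, orthogonal) direct sum of the eigenspaces `ker (L + κ Id)`
over the eigenvalues `-κ` with `κ ≤ r`. -/
def eigenSum (r : ℝ) : Submodule ℝ (Lp ℝ 2 μ) :=
  (Submodule.span ℝ (⋃ κ ∈ {κ : ℝ | T.IsEigenvalueNeg κ ∧ κ ≤ r}, T.eigenspace κ)).topologicalClosure

/-- The condition on `η` in the definition of a chaotic eigenfunction `F` for the eigenvalue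
`-lam`: `-η lam` is an eigenvalue and `F²` lies in the sum of the eigenspaces up to `η lam`. -/
def IsChaosBound (F : Lp ℝ 2 μ) (lam η : ℝ) : Prop :=
  1 < η ∧ T.IsEigenvalueNeg (η * lam) ∧
    ∃ S ∈ T.eigenSum (η * lam), ∀ᵐ x ∂μ, S x = F x ^ 2

/-- `F` is a chaotic eigenfunction of `L`, with respect to a nonzero eigenvalue `-lam`,
and its chaos grade (the smallest admissible `η`) is `η`. -/
def IsChaoticEigenfunction (F : Lp ℝ 2 μ) (η : ℝ) : Prop :=
  ∃ lam : ℝ, 0 < lam ∧ F ≠ 0 ∧ F ∈ T.eigenspace lam ∧ IsLeast {η' | T.IsChaosBound F lam η'} η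

end DiffusionTriple

/-- A full Markov triple on a probability space: in addition to the algebraic data, `L²(μ)` is
separable, `L 1 = 0` and `L` is ergodic on its `L²`-domain. -/
structure FullMarkovTriple {E : Type*} [MeasurableSpace E] (μ : Measure E)
    [IsProbabilityMeasure μ] extends DiffusionTriple μ where
  separable : TopologicalSpace.SeparableSpace (Lp ℝ 2 μ)
  L_one : toDiffusionTriple.IsGen (Lp.const 2 μ (1 : ℝ)) 0
  ergodic : ∀ F : Lp ℝ 2 μ, toDiffusionTriple.IsGen F 0 → ∃ c : ℝ, ∀ᵐ x ∂μ, F x = c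

/-- `ν` is the Pearson distribution associated to
`dX = -θ (X - m) dt + √(2 θ b(X)) dB`, `b(x) = b₂ x² + b₁ x + b₀`: it has a density `p`, positive
exactly on an open interval `(l, u)`, mean `m`, and the squared diffusion coefficient attached to
`p`, which is `-2 θ (∫_{-∞}^x (y - m) p(y) dy) / p(x)`, equals `2 θ b(x)` on `(l, u)`.
The law does not depend on `θ > 0`. -/
def IsPearsonLaw (m b₀ b₁ b₂ : ℝ) (ν : Measure ℝ) : Prop :=
  IsProbabilityMeasure ν ∧ Integrable (fun x : ℝ => x) ν ∧ ∫ x, x ∂ν = m ∧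
  ∃ (l u : EReal) (p : ℝ → ℝ), l < u ∧ Measurable p ∧
    (∀ x : ℝ, l < x → x < u → 0 < p x) ∧
    (∀ x : ℝ, ¬(l < x ∧ x < u) → p x = 0) ∧
    ν = volume.withDensity (fun x => ENNReal.ofReal (p x)) ∧
    ∀ x : ℝ, l < x → x < u →
      b₂ * x ^ 2 + b₁ * x + b₀ = -(∫ y in Set.Iic x, (y - m) * p y) / p x

/-- A class of Borel functions which determines laws on `ℝ`. -/
def IsSeparating (H : Set (ℝ → ℝ)) : Prop :=
  (∀ h ∈ H, Measurable h) ∧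
  ∀ P Q : Measure ℝ, IsProbabilityMeasure P → IsProbabilityMeasure Q →
    (∀ h ∈ H, Integrable h P ∧ Integrable h Q ∧ ∫ x, h x ∂P = ∫ x, h x ∂Q) → P = Q

/-- The distance `d_H(X, Y) = sup_{h ∈ H} |E h(X) - E h(Y)|`, with values in `[0, ∞]`. -/
def probDist (H : Set (ℝ → ℝ)) {Ω Ω' : Type*} [MeasurableSpace Ω] [MeasurableSpace Ω']
    (X : Ω → ℝ) (P : Measure Ω) (Y : Ω' → ℝ) (P' : Measure Ω') : ℝ≥0∞ :=
  ⨆ h ∈ H, ENNReal.ofReal |∫ ω, h (X ω) ∂P - ∫ ω, h (Y ω) ∂P'|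

open Polynomial in
/-- The polynomial `Q`. -/
def pearsonQ (m b₀ b₁ b₂ : ℝ) : ℝ[X] :=
  X ^ 2 + C (2 * (b₁ + m) / (2 * b₂ - 1)) * X +
    C (1 / (b₂ - 1) * (b₀ + m * (b₁ + m) / (2 * b₂ - 1)))

open Polynomial in
/-- The polynomial `U = (1 - b₂) Q² - (Q')³ (x - m) / 12`. -/
def pearsonU (m b₀ b₁ b₂ : ℝ) : ℝ[X] :=
  C (1 - b₂) * pearsonQ m b₀ b₁ b₂ ^ 2 -
    C (1 / 12) * derivative (pearsonQ m b₀ b₁ b₂) ^ 3 * (X - C m)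

end

/-! Put `τ = Γ(F,F)/λ`. Integration by parts gives `∫ F f(F) = ∫ f'(F) τ`, so `τ` is a Stein kernel
of `F`, whereas the Pearson law `ν` satisfies the same identity with the kernel `b`. Two estimates
are needed: an upper bound for `‖τ - b(G)‖` in `L²(μ)`, with `G = F + m`, and a bound of `|E h(G) -
E h(Z)|` by `‖τ - b(G)‖` in `L¹(μ)`, uniform over Lipschitz `h` with a fixed constant.

The first estimate is spectral. The polynomial `Q` is chosen so that `2λ(τ - b(G)) = (L + 2(1-b₂)λ)
Q(G)`. Chaoticity puts `Q(G)` in the sum of the eigenspaces up to `ηλ`, where `⟪L Q, (L + ηλ) Q⟫ ≤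
0`. Expanding the square leaves `‖Q‖²` and `⟪LQ, Q⟫`, and the latter is a multiple of `∫ Q'³ F` by
the Stein identity for cubic polynomials; this produces `U`. Since `F` need not lie in the algebra,
`Γ(F,F)` is built as an `L¹` limit along approximating sequences and identified with an element of
`L²` given by the spectral calculus (`exists_limit_Γ`, `integral_mul_limit_Γ`,
`IsChaoticEigenfunction.exists_isSteinKernel`, `IsSteinKernel.integral_sub_sq_le`).

The second estimate is Stein's method. On the interval of `ν` the equation `b f' - (x-m) f = h - E
h(Z)` has an explicit solution. The finite fourth moment forces `b₂ < 1/2`, and with this `f` is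
Lipschitz with a constant proportional to that of `h` (`exists_bound`, resting on the association
inequality and on the comparison `tail₂_le_mul`). The law of `G` may charge the complement of the
interval: there `f` is frozen at its endpoint value, and the resulting error, proportional to the
distance to the interval, is absorbed by a further test function (`exists_stein_solution`,
`exists_excess_bound`, `exists_stein_discrepancy_bound`). -/

set_option linter.unusedSectionVars false


/-! ### Closability of a form given by an operator, and limits along approximating sequences. -/

/-- A symmetric non-negative form `B` on a space `V` which is mapped to a Hilbert space `H` by `J`,
given by an operator: `B u v = -⟪J u, Λ v⟫`. -/
structure GeneratedForm (V H : Type*) [AddCommGroup V] [Module ℝ V] [NormedAddCommGroup H]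
    [InnerProductSpace ℝ H] where
  /-- the form -/
  B : LinearMap.BilinForm ℝ V
  /-- the map to the Hilbert space -/
  J : V →ₗ[ℝ] H
  /-- the generator -/
  Λ : V → H
  symm : ∀ u v, B u v = B v u
  nonneg : ∀ u, 0 ≤ B u u
  repr : ∀ u v, B u v = -inner ℝ (J u) (Λ v)

namespace GeneratedForm

variable {V H : Type*} [AddCommGroup V] [Module ℝ V] [NormedAddCommGroup H]
  [InnerProductSpace ℝ H] (S : GeneratedForm V H)

/-- The seminorm of the form. -/
noncomputable def q (u : V) : ℝ := √(S.B u u)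

lemma q_nonneg (u : V) : 0 ≤ S.q u := Real.sqrt_nonneg _

lemma q_sq (u : V) : S.q u ^ 2 = S.B u u := Real.sq_sqrt (S.nonneg u)

lemma abs_le_q_mul_q (u v : V) : |S.B u v| ≤ S.q u * S.q v := by
  rw [q, q, ← Real.sqrt_mul (S.nonneg u)]
  exact Real.abs_le_sqrt (S.B.apply_sq_le_of_symm S.nonneg ⟨fun x y => S.symm x y⟩ u v)

lemma q_add_le (u v : V) : S.q (u + v) ≤ S.q u + S.q v := by
  refine Real.sqrt_le_iff.2 ⟨add_nonneg (S.q_nonneg u) (S.q_nonneg v), ?_⟩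
  have h1 := S.q_sq u
  have h2 := S.q_sq v
  have h3 := S.abs_le_q_mul_q u v
  have h4 := S.symm u v
  have h5 := abs_le.1 h3
  simp only [map_add, LinearMap.add_apply]
  nlinarith

/-- `u` approximates `F` for the norm of the form. -/
def IsApprox (F : H) (u : ℕ → V) : Prop :=
  Tendsto (fun n => S.J (u n)) atTop (𝓝 F) ∧
    Tendsto (fun p : ℕ × ℕ => S.B (u p.1 - u p.2) (u p.1 - u p.2)) atTop (𝓝 0)

variable {S}

lemma IsApprox.const (v : V) : S.IsApprox (S.J v) fun _ => v := by
  simp [IsApprox]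

lemma IsApprox.comp {F : H} {u : ℕ → V} (h : S.IsApprox F u) {φ : ℕ → ℕ} (hφ : StrictMono φ) :
    S.IsApprox F (u ∘ φ) := by
  refine ⟨h.1.comp hφ.tendsto_atTop, ?_⟩
  have := hφ.tendsto_atTop.prodMap hφ.tendsto_atTop
  rw [prod_atTop_atTop_eq] at this
  exact h.2.comp this

lemma IsApprox.q_sub_le {F : H} {u : ℕ → V} (h : S.IsApprox F u) {ε : ℝ} (hε : 0 < ε) :
    ∃ N, ∀ n ≥ N, ∀ m ≥ N, S.q (u n - u m) ≤ ε := by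
  have := h.2.eventually (gt_mem_nhds (by positivity : 0 < ε ^ 2))
  rw [eventually_atTop_prod_self'] at this
  obtain ⟨N, hN⟩ := this
  exact ⟨N, fun n hn m hm => Real.sqrt_le_iff.2 ⟨hε.le, (hN n hn m hm).le⟩⟩

lemma IsApprox.q_le {F : H} {u : ℕ → V} (h : S.IsApprox F u) :
    ∃ C, 0 < C ∧ ∀ᶠ n in atTop, S.q (u n) ≤ C := by
  obtain ⟨N, hN⟩ := h.q_sub_le one_pos
  refine ⟨1 + S.q (u N), by linarith [S.q_nonneg (u N)], eventually_atTop.2 ⟨N, fun n hn => ?_⟩⟩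
  have := S.q_add_le (u n - u N) (u N)
  rw [sub_add_cancel] at this
  linarith [hN n hn N le_rfl]

/-- Writing the form through `Λ ψ` leaves only `J (u n)` to converge, so convergence in `H`
suffices. -/
lemma IsApprox.tendsto_left {F : H} {u : ℕ → V} (h : S.IsApprox F u) (ψ : V) :
    Tendsto (fun n => S.B (u n) ψ) atTop (𝓝 (-inner ℝ F (S.Λ ψ))) := by
  simp_rw [S.repr]
  exact (h.1.inner tendsto_const_nhds).neg

/-- Cauchy-Schwarz and the Cauchy property in energy make the convergence of `tendsto_left` uniform
in `ψ` on the scale of `q ψ`. This permits test vectors that vary with `n`, as long as their energy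
stays bounded. -/
lemma IsApprox.uniform {F : H} {u : ℕ → V} (h : S.IsApprox F u) {ε : ℝ} (hε : 0 < ε) :
    ∃ N, ∀ n ≥ N, ∀ ψ, |-inner ℝ F (S.Λ ψ) - S.B (u n) ψ| ≤ ε * S.q ψ := by
  obtain ⟨N, hN⟩ := h.q_sub_le hε
  refine ⟨N, fun n hn ψ => le_of_tendsto ((h.tendsto_left ψ).sub_const _).abs ?_⟩
  filter_upwards [eventually_ge_atTop N] with m hm
  rw [← LinearMap.sub_apply, ← map_sub]
  exact (S.abs_le_q_mul_q _ _).trans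
    (mul_le_mul_of_nonneg_right (hN m hm n hn) (S.q_nonneg _))

lemma IsApprox.cauchySeq {F G : H} {u v : ℕ → V} (hu : S.IsApprox F u) (hv : S.IsApprox G v) :
    CauchySeq fun n => S.B (u n) (v n) := by
  obtain ⟨C, hC, hCu⟩ := hu.q_le
  obtain ⟨D, hD, hDv⟩ := hv.q_le
  obtain ⟨N₀, h₀⟩ := eventually_atTop.1 (hCu.and hDv)
  refine Metric.cauchySeq_iff.2 fun ε hε => ?_
  obtain ⟨N, hN⟩ := hu.q_sub_le (by positivity : 0 < ε / (4 * D))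
  obtain ⟨M, hM⟩ := hv.q_sub_le (by positivity : 0 < ε / (4 * C))
  refine ⟨N₀ + N + M, fun n hn m hm => ?_⟩
  have e : S.B (u n) (v n) - S.B (u m) (v m) =
      S.B (u n - u m) (v n) + S.B (u m) (v n - v m) := by
    simp only [map_sub, LinearMap.sub_apply]; ring
  rw [Real.dist_eq, e]
  have h1 := (S.abs_le_q_mul_q (u n - u m) (v n)).trans
    (mul_le_mul (hN n (by omega) m (by omega)) (h₀ n (by omega)).2 (S.q_nonneg _) (by positivity))
  have h2 := (S.abs_le_q_mul_q (u m) (v n - v m)).trans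
    (mul_le_mul (h₀ m (by omega)).1 (hM n (by omega) m (by omega)) (S.q_nonneg _) (by positivity))
  have h3 : ε / (4 * D) * D = ε / 4 := by field_simp
  have h4 : C * (ε / (4 * C)) = ε / 4 := by field_simp
  have := abs_add_le (S.B (u n - u m) (v n)) (S.B (u m) (v n - v m))
  linarith

/-- This is closability: both sequences represent the functional `ψ ↦ -⟪F, Λ ψ⟫` up to `ε / 2 * q
ψ`. Testing at `ψ = u n - u' n` gives `q ψ ^ 2 ≤ ε * q ψ`. -/
lemma IsApprox.q_sub_tendsto {F : H} {u u' : ℕ → V} (hu : S.IsApprox F u)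
    (hu' : S.IsApprox F u') {ε : ℝ} (hε : 0 < ε) : ∀ᶠ n in atTop, S.q (u n - u' n) ≤ ε := by
  obtain ⟨N, hN⟩ := hu.uniform (half_pos hε)
  obtain ⟨M, hM⟩ := hu'.uniform (half_pos hε)
  filter_upwards [eventually_ge_atTop (N + M)] with n hn
  have h1 := hN n (by omega) (u n - u' n)
  have h2 := hM n (by omega) (u n - u' n)
  have h3 : S.q (u n - u' n) ^ 2 = S.B (u n) (u n - u' n) - S.B (u' n) (u n - u' n) := by
    rw [q_sq, ← LinearMap.sub_apply, ← map_sub S.B]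
  have h4 := abs_le.1 h1
  have h5 := abs_le.1 h2
  by_contra hlt
  push Not at hlt
  nlinarith [S.q_nonneg (u n - u' n)]

lemma IsApprox.tendsto_unique {F G : H} {u u' v v' : ℕ → V} (hu : S.IsApprox F u)
    (hu' : S.IsApprox F u') (hv : S.IsApprox G v) (hv' : S.IsApprox G v') {ℓ : ℝ}
    (h : Tendsto (fun n => S.B (u' n) (v' n)) atTop (𝓝 ℓ)) :
    Tendsto (fun n => S.B (u n) (v n)) atTop (𝓝 ℓ) := by
  obtain ⟨C, hC, hCu⟩ := hu'.q_le
  obtain ⟨D, hD, hDv⟩ := hv.q_le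
  have : Tendsto (fun n => S.B (u n) (v n) - S.B (u' n) (v' n)) atTop (𝓝 0) := by
    refine Metric.tendsto_nhds.2 fun ε hε => ?_
    filter_upwards [hCu, hDv, hu.q_sub_tendsto hu' (by positivity : 0 < ε / (4 * D)),
      hv.q_sub_tendsto hv' (by positivity : 0 < ε / (4 * C))] with n h1 h2 h3 h4
    have e : S.B (u n) (v n) - S.B (u' n) (v' n) =
        S.B (u n - u' n) (v n) + S.B (u' n) (v n - v' n) := by
      simp only [map_sub, LinearMap.sub_apply]; ring
    rw [Real.dist_eq, sub_zero, e]
    have h5 := (S.abs_le_q_mul_q (u n - u' n) (v n)).trans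
      (mul_le_mul h3 h2 (S.q_nonneg _) (by positivity))
    have h6 := (S.abs_le_q_mul_q (u' n) (v n - v' n)).trans
      (mul_le_mul h1 h4 (S.q_nonneg _) (by positivity))
    have h7 : ε / (4 * D) * D = ε / 4 := by field_simp
    have h8 : C * (ε / (4 * C)) = ε / 4 := by field_simp
    have := abs_add_le (S.B (u n - u' n) (v n)) (S.B (u' n) (v n - v' n))
    linarith
  simpa using this.add h

end GeneratedForm

/-! ### The Dirichlet form of the triple and its eigenspaces in L². -/

namespace DiffusionTriple

variable {E : Type*} [MeasurableSpace E] {μ : Measure E} [IsProbabilityMeasure μ]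
  (T : DiffusionTriple μ)

lemma memLp_of_mem {F : E →ₘ[μ] ℝ} (hF : F ∈ T.A₀) (p : ℝ≥0∞) : MemLp F p μ := by
  obtain ⟨C, hC⟩ := T.bounded F hF
  exact MemLp.of_bound F.aestronglyMeasurable C hC

/-- The small algebra, as a subspace of the large one. -/
def small : Submodule ℝ T.A := T.A₀.comap T.A.subtype

/-- The inclusion of the small algebra in `L²`. -/
def toL2 : T.small →ₗ[ℝ] Lp ℝ 2 μ where
  toFun u := ⟨u.1.1, Lp.mem_Lp_iff_memLp.2 (T.memLp_of_mem u.2 2)⟩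
  map_add' _ _ := rfl
  map_smul' _ _ := rfl

/-- The generator on the small algebra. -/
def genSmall (u : T.small) : T.small := ⟨T.L u, T.L_mem₀ u u.2⟩

lemma Γ_symm (F G : T.A) : T.Γ F G = T.Γ G F := by
  have h1 := T.two_mul_Γ F G
  have h2 := T.two_mul_Γ G F
  have h3 : (⟨F * G, T.mul_mem F.2 G.2⟩ : T.A) = ⟨G * F, T.mul_mem G.2 F.2⟩ :=
    Subtype.ext (mul_comm _ _)
  rw [h3, sub_right_comm, ← h2] at h1
  exact Subtype.ext (smul_right_injective _ (two_ne_zero (α := ℝ)) h1)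

lemma integrable_Γ (u v : T.small) : Integrable (T.Γ u v : E →ₘ[μ] ℝ) μ :=
  memLp_one_iff_integrable.1 (T.memLp_of_mem (T.Γ_mem₀ u v u.2 v.2) 1)

lemma Γ_add_ae (F G H : T.A) : ∀ᵐ x ∂μ, (T.Γ (F + G) H : E →ₘ[μ] ℝ) x =
    (T.Γ F H : E →ₘ[μ] ℝ) x + (T.Γ G H : E →ₘ[μ] ℝ) x := by
  rw [map_add, LinearMap.add_apply, Submodule.coe_add]
  exact AEEqFun.coeFn_add _ _

lemma Γ_smul_ae (c : ℝ) (F H : T.A) : ∀ᵐ x ∂μ, (T.Γ (c • F) H : E →ₘ[μ] ℝ) x =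
    c * (T.Γ F H : E →ₘ[μ] ℝ) x := by
  rw [map_smul, LinearMap.smul_apply, Submodule.coe_smul]
  exact AEEqFun.coeFn_smul _ _

lemma energy₀_add_left (u v w : T.small) :
    T.energy₀ ((u + v : T.small) : T.A) w = T.energy₀ u w + T.energy₀ v w := by
  rw [energy₀, energy₀, energy₀, ← integral_add (T.integrable_Γ u w) (T.integrable_Γ v w)]
  exact integral_congr_ae (T.Γ_add_ae u v w)

lemma energy₀_smul_left (c : ℝ) (u w : T.small) :
    T.energy₀ ((c • u : T.small) : T.A) w = c * T.energy₀ u w := by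
  rw [energy₀, energy₀, ← integral_const_mul]
  exact integral_congr_ae (T.Γ_smul_ae c u w)

lemma energy₀_symm (F G : T.A) : T.energy₀ F G = T.energy₀ G F := by
  rw [energy₀, Γ_symm, energy₀]

lemma inner_eq (F G : Lp ℝ 2 μ) : inner ℝ F G = ∫ x, F x * G x ∂μ := by
  rw [L2.inner_def]
  refine integral_congr_ae (.of_forall fun x => ?_)
  simp [mul_comm]

/-- The Dirichlet form on the small algebra. -/
noncomputable def form : GeneratedForm T.small (Lp ℝ 2 μ) where
  B := LinearMap.mk₂ ℝ (fun u v => T.energy₀ u v) T.energy₀_add_left T.energy₀_smul_left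
    (fun u v w => by
      simp only [T.energy₀_symm u]; exact T.energy₀_add_left v w u)
    (fun c u v => by simp only [T.energy₀_symm u]; exact T.energy₀_smul_left c v u)
  J := T.toL2
  Λ u := T.toL2 (T.genSmall u)
  symm u v := T.energy₀_symm u v
  nonneg u := integral_nonneg_of_ae (T.Γ_nonneg u)
  repr u v := by
    rw [LinearMap.mk₂_apply, energy₀_symm, energy₀, ← neg_eq_iff_eq_neg,
      ← T.integral_by_parts v u (Or.inl v.2), inner_eq]
    rfl

lemma form_B (u v : T.small) : T.form.B u v = ∫ x, (T.Γ u v : E →ₘ[μ] ℝ) x ∂μ := rfl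

lemma isApproxSeq_coe_iff {F : Lp ℝ 2 μ} {u : ℕ → T.small} :
    T.IsApproxSeq F (fun n => u n) ↔ T.form.IsApprox F u := by
  rw [IsApproxSeq, GeneratedForm.IsApprox, Lp.tendsto_Lp_iff_tendsto_eLpNorm']
  constructor
  · rintro ⟨-, h2, h3⟩
    refine ⟨h2.congr fun n => ?_, h3⟩
    rw [eLpNorm_sub_comm]; rfl
  · rintro ⟨h2, h3⟩
    refine ⟨fun n => (u n).2, h2.congr fun n => ?_, h3⟩
    rw [eLpNorm_sub_comm]; rfl

lemma mem_energyDomain_iff {F : Lp ℝ 2 μ} : F ∈ T.energyDomain ↔ ∃ u, T.form.IsApprox F u := by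
  constructor
  · rintro ⟨u, hu⟩
    exact ⟨fun n => ⟨u n, hu.1 n⟩, T.isApproxSeq_coe_iff.1 hu⟩
  · rintro ⟨u, hu⟩
    exact ⟨_, T.isApproxSeq_coe_iff.2 hu⟩

-- `energy` is a limit along sequences picked by choice; by closability it may be computed along any
-- approximating sequences.
variable {T} in
lemma tendsto_energy {F G : Lp ℝ 2 μ} {u v : ℕ → T.small} (hu : T.form.IsApprox F u)
    (hv : T.form.IsApprox G v) :
    Tendsto (fun n => T.form.B (u n) (v n)) atTop (𝓝 (T.energy F G)) := by
  have h : F ∈ T.energyDomain ∧ G ∈ T.energyDomain :=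
    ⟨T.mem_energyDomain_iff.2 ⟨u, hu⟩, T.mem_energyDomain_iff.2 ⟨v, hv⟩⟩
  obtain ⟨ℓ, hℓ⟩ := cauchySeq_tendsto_of_complete (hu.cauchySeq hv)
  have hu' : T.form.IsApprox F fun n => ⟨h.1.choose n, h.1.choose_spec.1 n⟩ :=
    T.isApproxSeq_coe_iff.1 h.1.choose_spec
  have hv' : T.form.IsApprox G fun n => ⟨h.2.choose n, h.2.choose_spec.1 n⟩ :=
    T.isApproxSeq_coe_iff.1 h.2.choose_spec
  have h1 := hu'.tendsto_unique hu hv' hv hℓ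
  have h2 : T.energy F G = ℓ := by
    rw [energy, dif_pos h]
    exact Tendsto.limUnder_eq h1
  rwa [h2]

variable {T}

lemma eigenspace_energy {κ : ℝ} {F G : Lp ℝ 2 μ} (hF : F ∈ T.eigenspace κ)
    (hG : G ∈ T.energyDomain) : T.energy F G = κ * inner ℝ F G := by
  have h := hF.2 G hG
  rw [← neg_eq_iff_eq_neg, ← inner_eq, inner_neg_right, inner_smul_right, neg_neg] at h
  rw [← h, real_inner_comm]

lemma exists_isApprox_of_mem_eigenspace {κ : ℝ} {F : Lp ℝ 2 μ} (hF : F ∈ T.eigenspace κ) :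
    ∃ u, T.form.IsApprox F u := T.mem_energyDomain_iff.1 hF.1.1

/-- The eigenvalue equation with `L` moved onto a test function of the small algebra; no energy of
`F` appears any more, so the identity is stable under `L²` limits. -/
lemma eigenspace_weak {κ : ℝ} {F : Lp ℝ 2 μ} (hF : F ∈ T.eigenspace κ) (ψ : T.small) :
    inner ℝ F (T.form.Λ ψ) = -(κ * inner ℝ F (T.form.J ψ)) := by
  obtain ⟨u, hu⟩ := exists_isApprox_of_mem_eigenspace hF
  have hψ := GeneratedForm.IsApprox.const (S := T.form) ψ
  have h1 := tendsto_nhds_unique (tendsto_energy hu hψ) (hu.tendsto_left ψ)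
  rw [eigenspace_energy hF (T.mem_energyDomain_iff.2 ⟨_, hψ⟩)] at h1
  linarith

lemma eigenspace_orthogonal {κ κ' : ℝ} (h : κ ≠ κ') {F G : Lp ℝ 2 μ} (hF : F ∈ T.eigenspace κ)
    (hG : G ∈ T.eigenspace κ') : inner ℝ F G = 0 := by
  obtain ⟨u, hu⟩ := exists_isApprox_of_mem_eigenspace hF
  obtain ⟨v, hv⟩ := exists_isApprox_of_mem_eigenspace hG
  have h1 := tendsto_energy hu hv
  have h2 := tendsto_energy hv hu
  simp_rw [T.form.symm (v _)] at h2
  have h3 := tendsto_nhds_unique h1 h2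
  rw [eigenspace_energy hF hG.1.1, eigenspace_energy hG hF.1.1, real_inner_comm] at h3
  rw [real_inner_comm]
  by_contra h0
  exact h (mul_right_cancel₀ h0 h3)

lemma IsEigenvalueNeg.nonneg {κ : ℝ} (h : T.IsEigenvalueNeg κ) : 0 ≤ κ := by
  obtain ⟨F, hF, h0⟩ := h
  obtain ⟨u, hu⟩ := exists_isApprox_of_mem_eigenspace hF
  have h1 := ge_of_tendsto' (tendsto_energy hu hu) fun n => T.form.nonneg (u n)
  rw [eigenspace_energy hF hF.1.1, real_inner_self_eq_norm_sq] at h1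
  exact nonneg_of_mul_nonneg_left h1 (by positivity)

/-! ### The generator on spectral subspaces -/

/-- `N` is the image of `P` under `L`, tested against the small algebra. -/
def IsWeakGen (T : DiffusionTriple μ) (P N : Lp ℝ 2 μ) : Prop :=
  ∀ ψ : T.small, inner ℝ N (T.form.J ψ) = inner ℝ P (T.form.Λ ψ)

/-- `eigenspace κ` is only a set. Its linear span is used instead of a proof that it is a subspace,
since both the weak equation and orthogonality pass to spans. -/
lemma span_eigenspace_weak {κ : ℝ} {F : Lp ℝ 2 μ} (hF : F ∈ Submodule.span ℝ (T.eigenspace κ)) :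
    T.IsWeakGen F (-(κ • F)) := by
  induction hF using Submodule.span_induction with
  | mem x hx => intro ψ; rw [eigenspace_weak hx, inner_neg_left, real_inner_smul_left]
  | zero => intro ψ; simp
  | add x y _ _ hx hy =>
    intro ψ
    rw [inner_add_left, ← hx ψ, ← hy ψ, ← inner_add_left, smul_add, neg_add]
  | smul a x _ hx =>
    intro ψ
    rw [real_inner_smul_left, ← hx ψ, ← real_inner_smul_left, smul_neg, smul_comm]

lemma span_eigenspace_orthogonal {κ κ' : ℝ} (h : κ ≠ κ') {F G : Lp ℝ 2 μ}
    (hF : F ∈ Submodule.span ℝ (T.eigenspace κ)) (hG : G ∈ Submodule.span ℝ (T.eigenspace κ')) :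
    inner ℝ F G = 0 := by
  have h1 : Submodule.span ℝ (T.eigenspace κ) ⟂ Submodule.span ℝ (T.eigenspace κ') := by
    rw [Submodule.isOrtho_span]
    intro u hu v hv
    exact eigenspace_orthogonal h hu hv
  exact Submodule.isOrtho_iff_inner_eq.1 h1 F hF G hG

variable (T) in
/-- The graph of the generator on the sums of eigenvectors for the eigenvalues `-κ ≥ -r`. -/
def eigenGraph (r : ℝ) : Submodule ℝ (Lp ℝ 2 μ × Lp ℝ 2 μ) :=
  Submodule.span ℝ {p | ∃ κ, (T.IsEigenvalueNeg κ ∧ κ ≤ r) ∧ p.1 ∈ T.eigenspace κ ∧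
    p.2 = -(κ • p.1)}

/-- Summands with the same eigenvalue are merged, so that the remaining ones are pairwise
orthogonal. -/
lemma exists_sum_of_mem_eigenGraph {r : ℝ} {p : Lp ℝ 2 μ × Lp ℝ 2 μ} (hp : p ∈ T.eigenGraph r) :
    ∃ s : Finset ℝ, ∃ v : ℝ → Lp ℝ 2 μ, (∀ κ ∈ s, T.IsEigenvalueNeg κ ∧ κ ≤ r) ∧
      (∀ κ, v κ ∈ Submodule.span ℝ (T.eigenspace κ)) ∧ p.1 = ∑ κ ∈ s, v κ ∧
      p.2 = ∑ κ ∈ s, -(κ • v κ) := by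
  classical
  induction hp using Submodule.span_induction with
  | mem x hx =>
    obtain ⟨κ, hκ, hx, hx2⟩ := hx
    refine ⟨{κ}, fun κ' => if κ' = κ then x.1 else 0, by simpa using hκ, fun κ' => ?_, by simp,
      by simpa using hx2⟩
    beta_reduce
    split_ifs with h
    · exact h ▸ Submodule.subset_span hx
    · exact zero_mem _
  | zero => exact ⟨∅, 0, by simp, fun _ => zero_mem _, by simp, by simp⟩
  | add x y _ _ hx hy =>
    obtain ⟨s, v, h1, h2, h5, h6⟩ := hx
    obtain ⟨t, w, h3, h4, h7, h8⟩ := hy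
    refine ⟨s ∪ t, fun κ => (if κ ∈ s then v κ else 0) + if κ ∈ t then w κ else 0, ?_, ?_, ?_, ?_⟩
    · intro κ hκ
      exact (Finset.mem_union.1 hκ).elim (h1 κ) (h3 κ)
    · intro κ
      refine add_mem ?_ ?_ <;> split_ifs <;> first | exact h2 κ | exact h4 κ | exact zero_mem _
    · rw [Finset.sum_add_distrib, Finset.sum_ite_mem, Finset.sum_ite_mem,
        Finset.union_inter_cancel_left, Finset.union_inter_cancel_right, Prod.fst_add, h5, h7]
    · simp only [smul_add, neg_add]
      rw [Finset.sum_add_distrib, Prod.snd_add, h6, h8]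
      congr 1
      · rw [← Finset.sum_subset Finset.subset_union_left fun κ _ h => by simp [h]]
        exact Finset.sum_congr rfl fun κ h => by simp [h]
      · rw [← Finset.sum_subset Finset.subset_union_right fun κ _ h => by simp [h]]
        exact Finset.sum_congr rfl fun κ h => by simp [h]
  | smul a x _ hx =>
    obtain ⟨s, v, h1, h2, h3, h4⟩ := hx
    refine ⟨s, fun κ => a • v κ, h1, fun κ => Submodule.smul_mem _ _ (h2 κ), ?_, ?_⟩
    · rw [Prod.smul_fst, h3, Finset.smul_sum]
    · rw [Prod.smul_snd, h4, Finset.smul_sum]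
      exact Finset.sum_congr rfl fun κ _ => by rw [smul_neg, smul_comm]

lemma exists_mem_eigenGraph {r : ℝ} {P : Lp ℝ 2 μ}
    (hP : P ∈ Submodule.span ℝ (⋃ κ ∈ {κ : ℝ | T.IsEigenvalueNeg κ ∧ κ ≤ r}, T.eigenspace κ)) :
    ∃ N, (P, N) ∈ T.eigenGraph r := by
  induction hP using Submodule.span_induction with
  | mem x hx =>
    simp only [Set.mem_iUnion] at hx
    obtain ⟨κ, hκ, hx⟩ := hx
    exact ⟨-(κ • x), Submodule.subset_span ⟨κ, hκ, hx, rfl⟩⟩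
  | zero => exact ⟨0, zero_mem _⟩
  | add x y _ _ hx hy =>
    obtain ⟨N, hN⟩ := hx
    obtain ⟨M, hM⟩ := hy
    exact ⟨N + M, add_mem hN hM⟩
  | smul a x _ hx =>
    obtain ⟨N, hN⟩ := hx
    exact ⟨a • N, Submodule.smul_mem _ a hN⟩

/-- Orthogonality removes the mixed terms, and the term of `κ` is `-κ (r - κ) ‖v κ‖²` with `0 ≤ κ ≤
r`. -/
lemma inner_weakGen_sum_le {r : ℝ} {s : Finset ℝ} {v : ℝ → Lp ℝ 2 μ}
    (hs : ∀ κ ∈ s, T.IsEigenvalueNeg κ ∧ κ ≤ r)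
    (hv : ∀ κ, v κ ∈ Submodule.span ℝ (T.eigenspace κ)) :
    inner ℝ (∑ κ ∈ s, -(κ • v κ)) (∑ κ ∈ s, -(κ • v κ) + r • ∑ κ ∈ s, v κ) ≤ 0 := by
  rw [Finset.smul_sum, ← Finset.sum_add_distrib, sum_inner]
  refine Finset.sum_nonpos fun κ hκ => ?_
  rw [inner_sum, Finset.sum_eq_single_of_mem κ hκ fun κ' _ hne => ?_]
  · have h1 := (hs κ hκ).1.nonneg
    have h2 := (hs κ hκ).2
    rw [← neg_smul, ← add_smul, real_inner_smul_left, real_inner_smul_right,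
      real_inner_self_eq_norm_sq]
    have : 0 ≤ (r - κ) * ‖v κ‖ ^ 2 := mul_nonneg (by linarith) (by positivity)
    nlinarith
  · rw [← neg_smul, ← neg_smul, ← add_smul, real_inner_smul_left, real_inner_smul_right,
      span_eigenspace_orthogonal hne.symm (hv κ) (hv κ')]
    simp

/-- On the spectral subspace of the eigenvalues `-κ ≥ -r`, the generator is defined, and
`⟪L S, (L + r) S⟫ ≤ 0`. -/
lemma exists_weakGen_of_mem_eigenSum {r : ℝ} (hr : 0 ≤ r) {S : Lp ℝ 2 μ} (hS : S ∈ T.eigenSum r) :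
    ∃ N : Lp ℝ 2 μ, T.IsWeakGen S N ∧ inner ℝ N (N + r • S) ≤ 0 := by
  have hS' : S ∈ closure (Submodule.span ℝ
      (⋃ κ ∈ {κ : ℝ | T.IsEigenvalueNeg κ ∧ κ ≤ r}, T.eigenspace κ) : Set (Lp ℝ 2 μ)) := hS
  obtain ⟨P, hP, hlim⟩ := mem_closure_iff_seq_limit.1 hS'
  have key : ∀ p ∈ T.eigenGraph r, T.IsWeakGen p.1 p.2 ∧ inner ℝ p.2 (p.2 + r • p.1) ≤ 0 := by
    intro p hp
    obtain ⟨s, v, h1, h2, h3, h4⟩ := exists_sum_of_mem_eigenGraph hp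
    rw [h3, h4]
    refine ⟨fun ψ => ?_, inner_weakGen_sum_le h1 h2⟩
    rw [sum_inner, sum_inner]
    exact Finset.sum_congr rfl fun κ _ => span_eigenspace_weak (h2 κ) ψ
  -- The quadratic inequality and Cauchy-Schwarz bound the generator by `r` on the finite sums. As
  -- the graph is a subspace, this applies to differences, so the images `N n` converge along with
  -- `P n`.
  have bound : ∀ p ∈ T.eigenGraph r, ‖p.2‖ ≤ r * ‖p.1‖ := by
    intro p hp
    have h1 := (key p hp).2
    rw [inner_add_right, real_inner_self_eq_norm_sq, real_inner_smul_right] at h1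
    have h2 := neg_le_of_abs_le (abs_real_inner_le_norm p.2 p.1)
    have h3 : ‖p.2‖ * ‖p.2‖ ≤ ‖p.2‖ * (r * ‖p.1‖) := by
      nlinarith [mul_le_mul_of_nonneg_left h2 hr]
    rcases (norm_nonneg p.2).eq_or_lt with h0 | h0
    · rw [← h0]; positivity
    · exact le_of_mul_le_mul_left h3 h0
  choose N hN using fun n => exists_mem_eigenGraph (hP n)
  have hcau : CauchySeq N := by
    refine Metric.cauchySeq_iff.2 fun ε hε => ?_
    obtain ⟨M, hM⟩ := Metric.cauchySeq_iff.1 hlim.cauchySeq (ε / (r + 1)) (by positivity)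
    refine ⟨M, fun m hm n hn => ?_⟩
    have h1 := bound _ (sub_mem (hN m) (hN n))
    have h2 := hM m hm n hn
    rw [dist_eq_norm] at h2 ⊢
    rw [lt_div_iff₀ (by positivity)] at h2
    simp only [Prod.snd_sub, Prod.fst_sub] at h1
    nlinarith [norm_nonneg (P m - P n)]
  obtain ⟨N₀, hN₀⟩ := cauchySeq_tendsto_of_complete hcau
  refine ⟨N₀, fun ψ => ?_, ?_⟩
  · refine tendsto_nhds_unique (hN₀.inner tendsto_const_nhds) ?_
    simp_rw [(key _ (hN _)).1 ψ]
    exact hlim.inner tendsto_const_nhds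
  · exact le_of_tendsto' (hN₀.inner (hN₀.add (hlim.const_smul r))) fun n => (key _ (hN n)).2

end DiffusionTriple

namespace DiffusionTriple

variable {E : Type*} [MeasurableSpace E] {μ : Measure E} [IsProbabilityMeasure μ]
  {T : DiffusionTriple μ}

/-! ### Pointwise calculus for the carré du champ -/

lemma coeFn_smoothComp {k : ℕ} (Ψ : (Fin k → ℝ) → ℝ) (hΨ : ContDiff ℝ (⊤ : ℕ∞) Ψ)
    (F : Fin k → (E →ₘ[μ] ℝ)) : ∀ᵐ x ∂μ, smoothComp Ψ hΨ F x = Ψ fun i => F i x :=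
  AEEqFun.coeFn_mk _ _

lemma contDiff_comp_eval {f : ℝ → ℝ} (hf : ContDiff ℝ (⊤ : ℕ∞) f) :
    ContDiff ℝ (⊤ : ℕ∞) fun y : Fin 1 → ℝ => f (y 0) := by fun_prop

lemma partialDeriv_comp_eval {f : ℝ → ℝ} (hf : ContDiff ℝ (⊤ : ℕ∞) f) (y : Fin 1 → ℝ) :
    partialDeriv 0 (fun y : Fin 1 → ℝ => f (y 0)) y = deriv f (y 0) := by
  have h1 : HasDerivAt f (deriv f (y 0)) (y 0) := (hf.differentiable (by simp) _).hasDerivAt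
  have h2 : HasFDerivAt (fun y : Fin 1 → ℝ => y 0)
    (ContinuousLinearMap.proj (R := ℝ) (φ := fun _ : Fin 1 => ℝ) 0) y :=
    (ContinuousLinearMap.proj (R := ℝ) (φ := fun _ : Fin 1 => ℝ) 0).hasFDerivAt
  have h3 := h1.comp_hasFDerivAt y h2
  rw [partialDeriv, HasFDerivAt.fderiv (f := fun y : Fin 1 → ℝ => f (y 0)) h3]
  simp

variable (T) in
/-- The function `f (F)`, for `F` in the large algebra. -/
noncomputable def comp (f : ℝ → ℝ) (hf : ContDiff ℝ (⊤ : ℕ∞) f) (F : T.A) : T.A :=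
  ⟨smoothComp _ (contDiff_comp_eval hf) fun _ => F, T.smooth_mem _ _ _ fun _ => F.2⟩

lemma coeFn_comp {f : ℝ → ℝ} (hf : ContDiff ℝ (⊤ : ℕ∞) f) (F : T.A) :
    ∀ᵐ x ∂μ, (T.comp f hf F : E →ₘ[μ] ℝ) x = f ((F : E →ₘ[μ] ℝ) x) :=
  coeFn_smoothComp (μ := μ) (fun y : Fin 1 → ℝ => f (y 0)) (contDiff_comp_eval hf)
    fun _ => (F : E →ₘ[μ] ℝ)

lemma Γ_comp {f : ℝ → ℝ} (hf : ContDiff ℝ (⊤ : ℕ∞) f) (F G : T.A) :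
    ∀ᵐ x ∂μ, (T.Γ (T.comp f hf F) G : E →ₘ[μ] ℝ) x =
      deriv f ((F : E →ₘ[μ] ℝ) x) * (T.Γ F G : E →ₘ[μ] ℝ) x := by
  filter_upwards [T.Γ_diffusion _ (contDiff_comp_eval hf) (fun _ => F) G] with x hx
  rw [Fin.sum_univ_one, partialDeriv_comp_eval hf] at hx
  exact hx

variable (T) in
/-- The function `f (u)`, for `u` in the small algebra and `f 0 = 0`. -/
noncomputable def compSmall (f : ℝ → ℝ) (hf : ContDiff ℝ (⊤ : ℕ∞) f) (h0 : f 0 = 0)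
    (u : T.small) : T.small :=
  ⟨T.comp f hf u, T.smooth_mem₀ _ (contDiff_comp_eval hf) _ h0 fun _ => u.2⟩

lemma Γ_comp_self {f : ℝ → ℝ} (hf : ContDiff ℝ (⊤ : ℕ∞) f) (F : T.A) :
    ∀ᵐ x ∂μ, (T.Γ (T.comp f hf F) (T.comp f hf F) : E →ₘ[μ] ℝ) x =
      deriv f ((F : E →ₘ[μ] ℝ) x) ^ 2 * (T.Γ F F : E →ₘ[μ] ℝ) x := by
  have h := Γ_comp hf F F
  rw [T.Γ_symm] at h
  filter_upwards [h, Γ_comp hf F (T.comp f hf F)] with x h1 h2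
  rw [h2, h1]; ring

variable (T) in
/-- The product in the large algebra. -/
def mulA (F G : T.A) : T.A := ⟨F * G, T.mul_mem F.2 G.2⟩

lemma coeFn_mulA (F G : T.A) : ∀ᵐ x ∂μ, (T.mulA F G : E →ₘ[μ] ℝ) x =
    (F : E →ₘ[μ] ℝ) x * (G : E →ₘ[μ] ℝ) x := AEEqFun.coeFn_mul _ _

variable (T) in
/-- The product in the small algebra. -/
def mulSmall (u v : T.small) : T.small := ⟨T.mulA u v, T.ideal u.2 v.1.2⟩

lemma Γ_mulA (F G K : T.A) : ∀ᵐ x ∂μ, (T.Γ (T.mulA F G) K : E →ₘ[μ] ℝ) x =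
    (F : E →ₘ[μ] ℝ) x * (T.Γ G K : E →ₘ[μ] ℝ) x +
      (G : E →ₘ[μ] ℝ) x * (T.Γ F K : E →ₘ[μ] ℝ) x := by
  have hΨ : ContDiff ℝ (⊤ : ℕ∞) fun y : Fin 2 → ℝ => y 0 * y 1 := by fun_prop
  have e : T.mulA F G = ⟨smoothComp _ hΨ fun i => ((![F, G] i : T.A) : E →ₘ[μ] ℝ),
      T.smooth_mem _ hΨ _ fun i => (![F, G] i).2⟩ := by
    refine Subtype.ext (AEEqFun.ext ?_)
    filter_upwards [coeFn_mulA F G, coeFn_smoothComp _ hΨ fun i =>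
      ((![F, G] i : T.A) : E →ₘ[μ] ℝ)] with x h1 h2
    rw [h1]; exact h2.symm
  have d (y : Fin 2 → ℝ) : HasFDerivAt (fun y : Fin 2 → ℝ => y 0 * y 1)
      (y 0 • ContinuousLinearMap.proj (R := ℝ) (φ := fun _ : Fin 2 => ℝ) 1 +
        y 1 • ContinuousLinearMap.proj (R := ℝ) (φ := fun _ : Fin 2 => ℝ) 0) y :=
    HasFDerivAt.mul (ContinuousLinearMap.proj (R := ℝ) (φ := fun _ : Fin 2 => ℝ) 0).hasFDerivAt
      (ContinuousLinearMap.proj (R := ℝ) (φ := fun _ : Fin 2 => ℝ) 1).hasFDerivAt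
  rw [e]
  filter_upwards [T.Γ_diffusion _ hΨ ![F, G] K] with x hx
  rw [hx, Fin.sum_univ_two, partialDeriv, partialDeriv, (d _).fderiv]
  simp [add_comm]

/-- For each `t` the inequality `Γ(F + tG, F + tG) ≥ 0` holds off a null set depending on `t`.
Rational `t` give a common null set, density extends to real `t`, and the discriminant concludes. -/
lemma Γ_sq_le (F G : T.A) : ∀ᵐ x ∂μ, (T.Γ F G : E →ₘ[μ] ℝ) x ^ 2 ≤
    (T.Γ F F : E →ₘ[μ] ℝ) x * (T.Γ G G : E →ₘ[μ] ℝ) x := by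
  have h (t : ℚ) : ∀ᵐ x ∂μ, 0 ≤ (T.Γ G G : E →ₘ[μ] ℝ) x * ((t : ℝ) * t) +
      2 * (T.Γ F G : E →ₘ[μ] ℝ) x * t + (T.Γ F F : E →ₘ[μ] ℝ) x := by
    have h1 := T.Γ_add_ae F ((t : ℝ) • G) F
    have h2 := T.Γ_add_ae F ((t : ℝ) • G) ((t : ℝ) • G)
    rw [T.Γ_symm (F + _)] at h1 h2
    filter_upwards [T.Γ_nonneg (F + (t : ℝ) • G), T.Γ_add_ae F ((t : ℝ) • G) (F + (t : ℝ) • G),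
      h1, h2, T.Γ_smul_ae t G F, T.Γ_smul_ae t G ((t : ℝ) • G),
      (T.Γ_symm F ((t : ℝ) • G)) ▸ T.Γ_smul_ae t G F,
      (T.Γ_symm G ((t : ℝ) • G)) ▸ T.Γ_smul_ae t G G] with x a1 a2 a3 a4 a5 a6 a7 a8
    rw [T.Γ_symm F G]
    rw [a6, a8] at a4
    linarith
  filter_upwards [ae_all_iff.2 h] with x hx
  have hx' (t : ℝ) : 0 ≤ (T.Γ G G : E →ₘ[μ] ℝ) x * (t * t) +
      2 * (T.Γ F G : E →ₘ[μ] ℝ) x * t + (T.Γ F F : E →ₘ[μ] ℝ) x :=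
    Rat.denseRange_cast.induction_on t
      (isClosed_le continuous_const (by fun_prop)) hx
  have := discrim_le_zero hx'
  rw [discrim] at this
  linarith

/-- A weighted integral form of the Cauchy-Schwarz inequality for the carré du champ. -/
lemma integral_abs_Γ_le (u v : T.small) :
    ∫ x, |(T.Γ u v : E →ₘ[μ] ℝ) x| ∂μ ≤ T.form.q u * T.form.q v := by
  have key {t : ℝ} (ht : 0 < t) : 2 * ∫ x, |(T.Γ u v : E →ₘ[μ] ℝ) x| ∂μ ≤
      t * T.form.q u ^ 2 + t⁻¹ * T.form.q v ^ 2 := by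
    rw [GeneratedForm.q_sq, GeneratedForm.q_sq, form_B, form_B, ← integral_const_mul,
      ← integral_const_mul, ← integral_const_mul,
      ← integral_add ((T.integrable_Γ u u).const_mul _) ((T.integrable_Γ v v).const_mul _)]
    refine integral_mono_ae ((T.integrable_Γ u v).abs.const_mul _)
      (((T.integrable_Γ u u).const_mul _).add ((T.integrable_Γ v v).const_mul _)) ?_
    filter_upwards [Γ_sq_le (T := T) u v, T.Γ_nonneg u, T.Γ_nonneg v] with x h1 h2 h3
    have h4 : (t * (T.Γ u u : E →ₘ[μ] ℝ) x) * (t⁻¹ * (T.Γ v v : E →ₘ[μ] ℝ) x) =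
        (T.Γ u u : E →ₘ[μ] ℝ) x * (T.Γ v v : E →ₘ[μ] ℝ) x := by field_simp
    have h5 : 0 ≤ t * (T.Γ u u : E →ₘ[μ] ℝ) x := by positivity
    have h6 : 0 ≤ t⁻¹ * (T.Γ v v : E →ₘ[μ] ℝ) x := by positivity
    rw [← h4, ← sq_abs] at h1
    refine abs_le_of_sq_le_sq' ?_ (add_nonneg h5 h6) |>.2
    nlinarith [sq_nonneg (t * (T.Γ u u : E →ₘ[μ] ℝ) x - t⁻¹ * (T.Γ v v : E →ₘ[μ] ℝ) x)]
  -- The optimal weight is `t = q v / q u`; both seminorms are shifted by `ε` because they may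
  -- vanish.
  have hlim : Tendsto (fun ε : ℝ => (T.form.q u + ε) * (T.form.q v + ε)) (𝓝[>] 0)
      (𝓝 (T.form.q u * T.form.q v)) := by
    have : Tendsto (fun ε : ℝ => (T.form.q u + ε) * (T.form.q v + ε)) (𝓝 0)
        (𝓝 ((T.form.q u + 0) * (T.form.q v + 0))) :=
      Continuous.tendsto (by fun_prop) 0
    simp only [add_zero] at this
    exact this.mono_left nhdsWithin_le_nhds
  refine ge_of_tendsto hlim ?_
  filter_upwards [self_mem_nhdsWithin] with ε hε
  have hε : 0 < ε := hε
  have hu : 0 < T.form.q u + ε := by linarith [T.form.q_nonneg u]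
  have hv : 0 < T.form.q v + ε := by linarith [T.form.q_nonneg v]
  have h1 := key (div_pos hv hu)
  have h2 : T.form.q u ^ 2 ≤ (T.form.q u + ε) ^ 2 := by gcongr; exacts [T.form.q_nonneg u, by linarith]
  have h3 : T.form.q v ^ 2 ≤ (T.form.q v + ε) ^ 2 := by gcongr; exacts [T.form.q_nonneg v, by linarith]
  have h4 := mul_le_mul_of_nonneg_left h2 (div_pos hv hu).le
  have h5 := mul_le_mul_of_nonneg_left h3 (inv_pos.2 (div_pos hv hu)).le
  have h6 : (T.form.q v + ε) / (T.form.q u + ε) * (T.form.q u + ε) ^ 2 =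
    (T.form.q u + ε) * (T.form.q v + ε) := by field_simp
  have h7 : ((T.form.q v + ε) / (T.form.q u + ε))⁻¹ * (T.form.q v + ε) ^ 2 =
    (T.form.q u + ε) * (T.form.q v + ε) := by field_simp
  linarith

lemma Γ_sub_Γ (u v : T.A) : T.Γ u u - T.Γ v v = T.Γ (u - v) (u + v) := by
  simp only [map_sub, map_add, LinearMap.sub_apply, T.Γ_symm v u]
  abel

/-- By the polarisation `Γ(u,u) - Γ(v,v) = Γ(u-v, u+v)`, energy-Cauchy sequences have `L¹`-Cauchy
carrés du champ. -/
lemma integral_abs_Γ_sub_le (u v : T.small) :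
    ∫ x, |(T.Γ u u : E →ₘ[μ] ℝ) x - (T.Γ v v : E →ₘ[μ] ℝ) x| ∂μ ≤
      T.form.q (u - v) * (T.form.q u + T.form.q v) := by
  refine le_trans (le_of_eq (integral_congr_ae ?_)) ((integral_abs_Γ_le (u - v) (u + v)).trans
    (mul_le_mul_of_nonneg_left (T.form.q_add_le u v) (T.form.q_nonneg _)))
  have h := congrArg Subtype.val (Γ_sub_Γ (T := T) u v)
  rw [Submodule.coe_sub] at h
  have h1 := AEEqFun.coeFn_sub (T.Γ u u : E →ₘ[μ] ℝ) (T.Γ v v : E →ₘ[μ] ℝ)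
  rw [h] at h1
  filter_upwards [h1] with x hx
  rw [Pi.sub_apply] at hx
  rw [← hx]; rfl

lemma q_compSmall_le {f : ℝ → ℝ} (hf : ContDiff ℝ (⊤ : ℕ∞) f) (h0 : f 0 = 0) {C : ℝ}
    (hC : ∀ x, |deriv f x| ≤ C) (u : T.small) :
    T.form.q (T.compSmall f hf h0 u) ≤ C * T.form.q u := by
  have hC0 : 0 ≤ C := (abs_nonneg _).trans (hC 0)
  refine abs_le_of_sq_le_sq' ?_ (mul_nonneg hC0 (T.form.q_nonneg u)) |>.2
  rw [mul_pow, GeneratedForm.q_sq, GeneratedForm.q_sq, form_B, form_B, ← integral_const_mul]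
  refine integral_mono_ae (T.integrable_Γ _ _) ((T.integrable_Γ u u).const_mul _) ?_
  filter_upwards [Γ_comp_self hf (T := T) u, T.Γ_nonneg u] with x h1 h2
  have h3 : (T.Γ (T.compSmall f hf h0 u) (T.compSmall f hf h0 u) : E →ₘ[μ] ℝ) x =
    deriv f (((u : T.A) : E →ₘ[μ] ℝ) x) ^ 2 * (T.Γ u u : E →ₘ[μ] ℝ) x := h1
  rw [h3]
  refine mul_le_mul_of_nonneg_right ?_ h2
  exact sq_le_sq.2 ((hC _).trans (le_abs_self C))

lemma form_compSmall {f : ℝ → ℝ} (hf : ContDiff ℝ (⊤ : ℕ∞) f) (h0 : f 0 = 0) (u : T.small) :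
    T.form.B u (T.compSmall f hf h0 u) =
      ∫ x, deriv f (((u : T.A) : E →ₘ[μ] ℝ) x) * (T.Γ u u : E →ₘ[μ] ℝ) x ∂μ := by
  rw [T.form.symm]
  exact integral_congr_ae (Γ_comp hf (u : T.A) u)

/-- Pointwise `Γ(uφ,uφ) ≤ 2 u² Γ(φ,φ) + 2 φ² Γ(u,u)`, by the product rule and `Γ_sq_le`. It keeps
the energy of `u n * φ` bounded along an approximating sequence. -/
lemma q_mulSmall_le {u φ : T.small} {C D : ℝ}
    (hC : ∀ᵐ x ∂μ, |((φ : T.A) : E →ₘ[μ] ℝ) x| ≤ C)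
    (hD : ∀ᵐ x ∂μ, |(T.Γ φ φ : E →ₘ[μ] ℝ) x| ≤ D) :
    T.form.q (T.mulSmall u φ) ^ 2 ≤ 2 * D * ‖T.form.J u‖ ^ 2 + 2 * C ^ 2 * T.form.q u ^ 2 := by
  have hu : Integrable (fun x => ((u : T.A) : E →ₘ[μ] ℝ) x ^ 2) μ :=
    (T.memLp_of_mem u.2 2).integrable_sq
  have hn : ‖T.form.J u‖ ^ 2 = ∫ x, ((u : T.A) : E →ₘ[μ] ℝ) x ^ 2 ∂μ := by
    rw [← real_inner_self_eq_norm_sq, inner_eq]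
    exact integral_congr_ae (.of_forall fun x => (sq _).symm)
  rw [hn, GeneratedForm.q_sq, GeneratedForm.q_sq, form_B, form_B, ← integral_const_mul,
    ← integral_const_mul, ← integral_add (hu.const_mul _) ((T.integrable_Γ u u).const_mul _)]
  refine integral_mono_ae (T.integrable_Γ _ _)
    ((hu.const_mul _).add ((T.integrable_Γ u u).const_mul _)) ?_
  have e := Γ_mulA (T := T) u φ (T.mulA u φ)
  have e2 := Γ_mulA (T := T) u φ φ
  have e3 := Γ_mulA (T := T) u φ u
  rw [T.Γ_symm] at e2 e3
  filter_upwards [e, e2, e3, hC, hD, Γ_sq_le (T := T) u φ, T.Γ_nonneg u, T.Γ_nonneg φ] with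
    x h1 h2 h3 h4 h5 h6 h7 h8
  have h9 : (T.Γ (T.mulSmall u φ) (T.mulSmall u φ) : E →ₘ[μ] ℝ) x =
    (T.Γ (T.mulA u φ) (T.mulA u φ) : E →ₘ[μ] ℝ) x := rfl
  rw [h9, h1, h2, h3, T.Γ_symm φ u]
  generalize ((u : T.A) : E →ₘ[μ] ℝ) x = a at *
  generalize ((φ : T.A) : E →ₘ[μ] ℝ) x = b at *
  generalize (T.Γ u φ : E →ₘ[μ] ℝ) x = g at *
  generalize (T.Γ u u : E →ₘ[μ] ℝ) x = gu at *
  generalize (T.Γ φ φ : E →ₘ[μ] ℝ) x = gφ at *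
  have h10 : 2 * (a * b * g) ≤ a ^ 2 * gφ + b ^ 2 * gu := by
    refine abs_le_of_sq_le_sq' ?_ (by positivity) |>.2
    have : (a * b) ^ 2 * g ^ 2 ≤ (a * b) ^ 2 * (gu * gφ) :=
      mul_le_mul_of_nonneg_left h6 (sq_nonneg _)
    nlinarith [sq_nonneg (a ^ 2 * gφ - b ^ 2 * gu)]
  have h11 : b ^ 2 * gu ≤ C ^ 2 * gu :=
    mul_le_mul_of_nonneg_right (sq_le_sq.2 (h4.trans (le_abs_self C))) h7
  have h12 : a ^ 2 * gφ ≤ a ^ 2 * D :=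
    mul_le_mul_of_nonneg_left ((le_abs_self _).trans h5) (sq_nonneg _)
  nlinarith

/-- Multiply `2 Γ(u,u) = L(u²) - 2 u L u` by `φ` and integrate: `L` passes from `u²` to `φ`, and `∫
u φ L u` becomes the form. Both resulting terms have limits when `u` approximates an eigenfunction.
-/
lemma integral_mul_Γ (u φ : T.small) :
    ∫ x, ((φ : T.A) : E →ₘ[μ] ℝ) x * (T.Γ u u : E →ₘ[μ] ℝ) x ∂μ =
      2⁻¹ * ∫ x, ((u : T.A) : E →ₘ[μ] ℝ) x * ((u : T.A) : E →ₘ[μ] ℝ) x *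
        (T.L φ : E →ₘ[μ] ℝ) x ∂μ + T.form.B u (T.mulSmall u φ) := by
  have h1 := T.integral_by_parts (T.mulA u u) φ (Or.inr φ.2)
  have h2 := T.integral_by_parts φ (T.mulA u u) (Or.inl φ.2)
  have h3 := T.integral_by_parts u (T.mulA u φ) (Or.inl u.2)
  rw [T.Γ_symm, ← h1] at h2
  have h4 : T.form.B u (T.mulSmall u φ) =
    ∫ x, (T.Γ u (T.mulA u φ) : E →ₘ[μ] ℝ) x ∂μ := rfl
  rw [← neg_eq_iff_eq_neg, ← h4] at h3
  rw [← h3]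
  have h5 : ∫ x, ((u : T.A) : E →ₘ[μ] ℝ) x * ((u : T.A) : E →ₘ[μ] ℝ) x *
      (T.L φ : E →ₘ[μ] ℝ) x ∂μ = ∫ x, ((φ : T.A) : E →ₘ[μ] ℝ) x *
        (T.L (T.mulA u u) : E →ₘ[μ] ℝ) x ∂μ := by
    rw [← h2]
    refine integral_congr_ae ?_
    filter_upwards [coeFn_mulA (T := T) u u] with x hx
    rw [hx]
  rw [h5, ← integral_const_mul, ← sub_eq_add_neg, ← integral_sub]
  · refine integral_congr_ae ?_
    have e := congrArg (fun f : E →ₘ[μ] ℝ => (f : E → ℝ)) (T.two_mul_Γ u u)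
    have e1 := AEEqFun.coeFn_smul (2 : ℝ) (T.Γ u u : E →ₘ[μ] ℝ)
    have e2 := AEEqFun.coeFn_sub ((T.L (T.mulA u u) : E →ₘ[μ] ℝ) -
      ((u : T.A) : E →ₘ[μ] ℝ) * (T.L u : E →ₘ[μ] ℝ)) (((u : T.A) : E →ₘ[μ] ℝ) *
        (T.L u : E →ₘ[μ] ℝ))
    have e3 := AEEqFun.coeFn_sub (T.L (T.mulA u u) : E →ₘ[μ] ℝ)
      (((u : T.A) : E →ₘ[μ] ℝ) * (T.L u : E →ₘ[μ] ℝ))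
    have e4 := AEEqFun.coeFn_mul ((u : T.A) : E →ₘ[μ] ℝ) (T.L u : E →ₘ[μ] ℝ)
    filter_upwards [e1, e2, e3, e4, coeFn_mulA (T := T) u φ] with x a1 a2 a3 a4 a5
    have a6 := congrFun e x
    have a7 : (2 : ℝ) * (T.Γ u u : E →ₘ[μ] ℝ) x = (T.L (T.mulA u u) : E →ₘ[μ] ℝ) x -
        ((u : T.A) : E →ₘ[μ] ℝ) x * (T.L u : E →ₘ[μ] ℝ) x -
        ((u : T.A) : E →ₘ[μ] ℝ) x * (T.L u : E →ₘ[μ] ℝ) x := by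
      rw [Pi.sub_apply, a3, Pi.sub_apply, a4] at a2
      exact (a1.symm.trans a6).trans a2
    rw [a5]
    linear_combination (((φ : T.A) : E →ₘ[μ] ℝ) x / 2) * a7
  · refine Integrable.const_mul ?_ _
    exact (T.memLp_of_mem φ.2 2).integrable_mul
      (T.memLp_of_mem (T.L_mem₀ _ (T.mulSmall u u).2) 2)
  · exact (T.memLp_of_mem (T.mulSmall u φ).2 2).integrable_mul
      (T.memLp_of_mem (T.L_mem₀ _ u.2) 2)

end DiffusionTriple

namespace DiffusionTriple

variable {E : Type*} [MeasurableSpace E] {μ : Measure E} [IsProbabilityMeasure μ]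
  {T : DiffusionTriple μ}

/-! ### Passage to the limit along approximating sequences -/

lemma tendsto_integral_mul_mul {a b : ℕ → Lp ℝ 2 μ} {a' b' : Lp ℝ 2 μ}
    (ha : Tendsto a atTop (𝓝 a')) (hb : Tendsto b atTop (𝓝 b')) {φ : E → ℝ}
    (hφ : AEStronglyMeasurable φ μ) {C : ℝ} (hC : ∀ᵐ x ∂μ, |φ x| ≤ C) :
    Tendsto (fun n => ∫ x, a n x * b n x * φ x ∂μ) atTop (𝓝 (∫ x, a' x * b' x * φ x ∂μ)) := by
  have hm (f : Lp ℝ 2 μ) : MemLp (fun x => f x * φ x) 2 μ :=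
    MemLp.of_le_mul (c := C) (Lp.memLp f) ((Lp.aestronglyMeasurable f).mul hφ) (by
      filter_upwards [hC] with x hx
      rw [norm_mul, mul_comm]
      exact mul_le_mul_of_nonneg_right hx (norm_nonneg _))
  have hlim : Tendsto (fun n => (hm (b n)).toLp) atTop (𝓝 (hm b').toLp) := by
    rw [tendsto_iff_norm_sub_tendsto_zero] at hb ⊢
    refine squeeze_zero (fun n => norm_nonneg _) (fun n => ?_) (by simpa using hb.const_mul C)
    refine Lp.norm_le_mul_norm_of_ae_le_mul ?_
    filter_upwards [hC, Lp.coeFn_sub (b n) b', Lp.coeFn_sub (hm (b n)).toLp (hm b').toLp,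
      (hm (b n)).coeFn_toLp, (hm b').coeFn_toLp] with x h1 h2 h3 h4 h5
    rw [h2, h3, Pi.sub_apply, Pi.sub_apply, h4, h5, ← sub_mul, norm_mul, mul_comm]
    exact mul_le_mul_of_nonneg_right h1 (norm_nonneg _)
  refine ((ha.inner hlim).congr fun n => ?_).trans_eq ?_
  · rw [inner_eq]
    refine integral_congr_ae ?_
    filter_upwards [(hm (b n)).coeFn_toLp] with x hx
    rw [hx, mul_assoc]
  · rw [inner_eq]
    refine congrArg _ (integral_congr_ae ?_)
    filter_upwards [(hm b').coeFn_toLp] with x hx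
    rw [hx, mul_assoc]

/-- The limit `g` plays the role of `Γ(F,F)` for an `F` that need not belong to the algebra. -/
lemma exists_limit_Γ {F : Lp ℝ 2 μ} {u : ℕ → T.small} (hu : T.form.IsApprox F u) :
    ∃ g : E → ℝ, Integrable g μ ∧ (∀ᵐ x ∂μ, 0 ≤ g x) ∧
      Tendsto (fun n => ∫ x, |(T.Γ (u n) (u n) : E →ₘ[μ] ℝ) x - g x| ∂μ) atTop (𝓝 0) := by
  set a : ℕ → Lp ℝ 1 μ := fun n => (T.integrable_Γ (u n) (u n)).toL1 _ with ha
  have hdist (n m : ℕ) : ‖a n - a m‖ =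
      ∫ x, |(T.Γ (u n) (u n) : E →ₘ[μ] ℝ) x - (T.Γ (u m) (u m) : E →ₘ[μ] ℝ) x| ∂μ := by
    rw [ha, ← Integrable.toL1_sub, L1.norm_of_fun_eq_integral_norm]
    rfl
  have hcau : CauchySeq a := by
    obtain ⟨C, hC, hCu⟩ := hu.q_le
    obtain ⟨M, hM⟩ := eventually_atTop.1 hCu
    refine Metric.cauchySeq_iff.2 fun ε hε => ?_
    obtain ⟨N, hN⟩ := hu.q_sub_le (by positivity : 0 < ε / (4 * C))
    refine ⟨N + M, fun n hn m hm => ?_⟩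
    rw [dist_eq_norm, hdist]
    have h1 := hN n (by omega) m (by omega)
    have h2 : T.form.q (u n) + T.form.q (u m) ≤ 2 * C := by
      linarith [hM n (by omega), hM m (by omega)]
    have h3 := mul_le_mul h1 h2
      (add_nonneg (T.form.q_nonneg _) (T.form.q_nonneg _)) (by positivity)
    have h4 : ε / (4 * C) * (2 * C) = ε / 2 := by field_simp; norm_num
    linarith [integral_abs_Γ_sub_le (u n) (u m)]
  obtain ⟨g, hg⟩ := cauchySeq_tendsto_of_complete hcau
  refine ⟨g, L1.integrable_coeFn g, ?_, ?_⟩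
  · refine (Lp.coeFn_nonneg g).2 (ge_of_tendsto' hg fun n => ?_)
    rw [← Lp.coeFn_nonneg]
    filter_upwards [(T.integrable_Γ (u n) (u n)).coeFn_toL1, T.Γ_nonneg (u n)] with x h1 h2
    rw [h1]; exact h2
  · rw [tendsto_iff_norm_sub_tendsto_zero] at hg
    refine hg.congr fun n => ?_
    rw [L1.norm_eq_integral_norm]
    refine integral_congr_ae ?_
    filter_upwards [(T.integrable_Γ (u n) (u n)).coeFn_toL1, Lp.coeFn_sub (a n) g] with x h1 h2
    rw [h2, Pi.sub_apply, h1, Real.norm_eq_abs]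

/-- As `h` is merely integrable, approximating its sign in `L¹` by the small algebra is not enough:
the approximants need a common bound. Composition with `sin` bounds them by 1, stays in the small
algebra because `sin 0 = 0`, and turns the sign into `± sin 1`, which still detects `|h|`. -/
lemma ae_eq_zero_of_forall_integral {h : E → ℝ} (hh : Integrable h μ)
    (h0 : ∀ φ : T.small, ∫ x, h x * ((φ : T.A) : E →ₘ[μ] ℝ) x ∂μ = 0) :
    ∀ᵐ x ∂μ, h x = 0 := by
  set s : E → ℝ := fun x => if 0 < h x then 1 else if h x < 0 then -1 else 0 with hs
  have hsm : AEStronglyMeasurable s μ := by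
    have : Measurable fun y : ℝ => if 0 < y then (1 : ℝ) else if y < 0 then -1 else 0 :=
      Measurable.ite measurableSet_Ioi measurable_const
        (Measurable.ite measurableSet_Iio measurable_const measurable_const)
    exact (this.comp_aemeasurable hh.aemeasurable).aestronglyMeasurable
  have hsL : MemLp s 1 μ := MemLp.of_bound hsm 1 (.of_forall fun x => by
    rw [hs]; beta_reduce
    split_ifs <;> simp)
  have hex (n : ℕ) := T.dense 1 le_rfl ENNReal.one_ne_top s hsL ((n + 1 : ℝ≥0∞)⁻¹) (by simp)
  choose G hG hGs using hex
  have hlim : Tendsto (fun n => eLpNorm ((G n : E → ℝ) - s) 1 μ) atTop (𝓝 0) := by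
    have h1 : Tendsto (fun n : ℕ => ((n + 1 : ℝ≥0∞)⁻¹)) atTop (𝓝 0) := by
      have := (tendsto_add_atTop_iff_nat 1).2 ENNReal.tendsto_inv_nat_nhds_zero
      simpa using this
    refine tendsto_of_tendsto_of_tendsto_of_le_of_le tendsto_const_nhds h1 (fun _ => zero_le)
      fun n => ?_
    rw [eLpNorm_sub_comm]
    exact (hGs n).le
  obtain ⟨ns, -, hns⟩ := (tendstoInMeasure_of_tendsto_eLpNorm one_ne_zero
    (fun n => (G n).aestronglyMeasurable) hsm hlim).exists_seq_tendsto_ae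
  have hz (k : ℕ) : ∫ x, h x * Real.sin (G (ns k) x) ∂μ = 0 := by
    rw [← h0 (T.compSmall Real.sin Real.contDiff_sin Real.sin_zero
      ⟨⟨G (ns k), T.A₀_le (hG _)⟩, hG _⟩)]
    refine integral_congr_ae ?_
    filter_upwards [coeFn_comp Real.contDiff_sin (T := T) ⟨G (ns k), T.A₀_le (hG _)⟩] with x hx
    exact congrArg (h x * ·) hx.symm
  have hdom : Tendsto (fun k => ∫ x, h x * Real.sin (G (ns k) x) ∂μ) atTop
      (𝓝 (∫ x, h x * Real.sin (s x) ∂μ)) := by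
    refine tendsto_integral_of_dominated_convergence (fun x => |h x|) (fun k => ?_) hh.abs
      (fun k => .of_forall fun x => ?_) ?_
    · exact hh.aestronglyMeasurable.mul
        (Real.continuous_sin.comp_aestronglyMeasurable (G (ns k)).aestronglyMeasurable)
    · rw [norm_mul, Real.norm_eq_abs, Real.norm_eq_abs]
      exact mul_le_of_le_one_right (abs_nonneg _) (Real.abs_sin_le_one _)
    · filter_upwards [hns] with x hx
      exact ((Real.continuous_sin.tendsto _).comp hx).const_mul _
  simp_rw [hz] at hdom
  have h1 := tendsto_nhds_unique hdom tendsto_const_nhds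
  have h2 : (fun x => h x * Real.sin (s x)) = fun x => |h x| * Real.sin 1 := by
    funext x
    rw [hs]; beta_reduce
    rcases lt_trichotomy (h x) 0 with h3 | h3 | h3
    · simp [h3, h3.not_gt, abs_of_neg h3]
    · simp [h3]
    · simp [h3, abs_of_pos h3]
  rw [h2, integral_mul_const] at h1
  have h3 : 0 < Real.sin 1 := Real.sin_pos_of_pos_of_lt_pi one_pos (by linarith [Real.pi_gt_three])
  have h4 := (integral_eq_zero_iff_of_nonneg (fun x => abs_nonneg (h x)) hh.abs).1
    ((mul_eq_zero.1 h1).resolve_right h3.ne')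
  filter_upwards [h4] with x hx
  exact abs_eq_zero.1 hx

section Limit

variable {F : Lp ℝ 2 μ} {lam : ℝ} {u : ℕ → T.small} {g : E → ℝ}

/-- Limit of `integral_mul_Γ`. It determines `Γ(F,F)` by duality in terms of `F²` alone, which is
where the spectral assumption on `F²` can enter. -/
lemma integral_mul_limit_Γ (hF : F ∈ T.eigenspace lam) (hu : T.form.IsApprox F u)
    (hg : Integrable g μ)
    (hlim : Tendsto (fun n => ∫ x, |(T.Γ (u n) (u n) : E →ₘ[μ] ℝ) x - g x| ∂μ) atTop (𝓝 0))
    (φ : T.small) :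
    ∫ x, g x * ((φ : T.A) : E →ₘ[μ] ℝ) x ∂μ =
      2⁻¹ * ∫ x, F x * F x * (T.L φ : E →ₘ[μ] ℝ) x ∂μ +
      lam * ∫ x, F x * F x * ((φ : T.A) : E →ₘ[μ] ℝ) x ∂μ := by
  obtain ⟨C, hC⟩ := T.bounded φ φ.2
  obtain ⟨D, hD⟩ := T.bounded _ (T.Γ_mem₀ φ φ φ.2 φ.2)
  obtain ⟨K, hK⟩ := T.bounded _ (T.L_mem₀ φ φ.2)
  have hφm := ((φ : T.A) : E →ₘ[μ] ℝ).aestronglyMeasurable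
  have hLm := (T.L φ : E →ₘ[μ] ℝ).aestronglyMeasurable
  have hC0 : 0 ≤ C := by
    obtain ⟨x, hx⟩ := hC.exists
    exact (abs_nonneg _).trans hx
  have hD0 : 0 ≤ D := by
    obtain ⟨x, hx⟩ := hD.exists
    exact (abs_nonneg _).trans hx
  -- the left-hand side
  have h1 : Tendsto (fun n => ∫ x, ((φ : T.A) : E →ₘ[μ] ℝ) x *
      (T.Γ (u n) (u n) : E →ₘ[μ] ℝ) x ∂μ) atTop
      (𝓝 (∫ x, g x * ((φ : T.A) : E →ₘ[μ] ℝ) x ∂μ)) := by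
    rw [tendsto_iff_norm_sub_tendsto_zero]
    refine squeeze_zero (fun n => norm_nonneg _) (fun n => ?_) (by simpa using hlim.const_mul C)
    have i1 : Integrable (fun x => ((φ : T.A) : E →ₘ[μ] ℝ) x *
        (T.Γ (u n) (u n) : E →ₘ[μ] ℝ) x) μ := (T.integrable_Γ _ _).bdd_mul hφm hC
    have i2 : Integrable (fun x => g x * ((φ : T.A) : E →ₘ[μ] ℝ) x) μ := hg.mul_bdd hφm hC
    rw [← integral_sub i1 i2, ← integral_const_mul]
    refine (norm_integral_le_integral_norm _).trans (integral_mono_ae (i1.sub i2).norm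
      (((T.integrable_Γ _ _).sub hg).abs.const_mul _) ?_)
    filter_upwards [hC] with x hx
    have : ((φ : T.A) : E →ₘ[μ] ℝ) x * (T.Γ (u n) (u n) : E →ₘ[μ] ℝ) x -
        g x * ((φ : T.A) : E →ₘ[μ] ℝ) x = ((φ : T.A) : E →ₘ[μ] ℝ) x *
          ((T.Γ (u n) (u n) : E →ₘ[μ] ℝ) x - g x) := by ring
    rw [this, norm_mul]
    exact mul_le_mul_of_nonneg_right hx (abs_nonneg _)
  -- the first term of the right-hand side
  have h2 := tendsto_integral_mul_mul hu.1 hu.1 hLm hK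
  -- the second term
  have h3 := (tendsto_integral_mul_mul (tendsto_const_nhds (x := F)) hu.1 hφm hC).const_mul lam
  -- The test function `u n * φ` varies with `n`: its energy is bounded by `R`, so `uniform`
  -- replaces `u n` by `F` in the first argument, and `eigenspace_weak` evaluates the result.
  have h4 : Tendsto (fun n => T.form.B (u n) (T.mulSmall (u n) φ)) atTop
      (𝓝 (lam * ∫ x, F x * F x * ((φ : T.A) : E →ₘ[μ] ℝ) x ∂μ)) := by
    have h5 : Tendsto (fun n => lam * (∫ x, F x * T.form.J (u n) x *
        ((φ : T.A) : E →ₘ[μ] ℝ) x ∂μ) - T.form.B (u n) (T.mulSmall (u n) φ)) atTop (𝓝 0) := by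
      obtain ⟨M, hM, hMu⟩ := hu.q_le
      have hJ : ∀ᶠ n in atTop, ‖T.form.J (u n)‖ < ‖F‖ + 1 :=
        hu.1.norm.eventually (gt_mem_nhds (by linarith))
      set R := √(2 * D * (‖F‖ + 1) ^ 2 + 2 * C ^ 2 * M ^ 2) with hR
      refine Metric.tendsto_nhds.2 fun ε hε => ?_
      have hR0 : 0 ≤ R := Real.sqrt_nonneg _
      obtain ⟨N, hN⟩ := hu.uniform (by positivity : 0 < ε / (2 * (R + 1)))
      filter_upwards [hMu, hJ, eventually_ge_atTop N] with n h6 h7 h8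
      have h9 : T.form.q (T.mulSmall (u n) φ) ≤ R := by
        refine Real.le_sqrt_of_sq_le ((q_mulSmall_le hC hD).trans ?_)
        have := T.form.q_nonneg (u n)
        gcongr
      have h10 := hN n h8 (T.mulSmall (u n) φ)
      rw [eigenspace_weak hF, neg_neg, inner_eq] at h10
      have h11 : ∫ x, F x * T.form.J (T.mulSmall (u n) φ) x ∂μ =
          ∫ x, F x * T.form.J (u n) x * ((φ : T.A) : E →ₘ[μ] ℝ) x ∂μ := by
        refine integral_congr_ae ?_
        filter_upwards [coeFn_mulA (T := T) (u n) φ] with x hx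
        rw [mul_assoc]
        exact congrArg (F x * ·) hx
      rw [h11] at h10
      rw [Real.dist_eq, sub_zero]
      refine h10.trans_lt ?_
      calc ε / (2 * (R + 1)) * T.form.q (T.mulSmall (u n) φ) ≤ ε / (2 * (R + 1)) * R := by gcongr
        _ < ε := by
          rw [div_mul_eq_mul_div, div_lt_iff₀ (by positivity)]
          nlinarith
    simpa using h3.sub h5
  simp_rw [integral_mul_Γ] at h1
  exact tendsto_nhds_unique h1 ((h2.const_mul _).add h4)

/-- The same limit with the test functions `f (u n)`, whose energy is bounded because `deriv f` is.
Almost everywhere convergence is needed for the nonlinear factor `deriv f (u n)`. -/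
lemma integral_mul_comp_eq (hF : F ∈ T.eigenspace lam) (hu : T.form.IsApprox F u)
    (hae : ∀ᵐ x ∂μ, Tendsto (fun n => ((u n : T.A) : E →ₘ[μ] ℝ) x) atTop (𝓝 (F x)))
    (hg : Integrable g μ)
    (hlim : Tendsto (fun n => ∫ x, |(T.Γ (u n) (u n) : E →ₘ[μ] ℝ) x - g x| ∂μ) atTop (𝓝 0))
    {f : ℝ → ℝ} (hf : ContDiff ℝ (⊤ : ℕ∞) f) (h0 : f 0 = 0) {C : ℝ}
    (hC : ∀ x, |deriv f x| ≤ C) :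
    lam * ∫ x, F x * f (F x) ∂μ = ∫ x, deriv f (F x) * g x ∂μ := by
  have hC0 : 0 ≤ C := (abs_nonneg _).trans (hC 0)
  have hfd : Continuous (deriv f) := hf.continuous_deriv (by simp)
  have hfm (v : E →ₘ[μ] ℝ) : AEStronglyMeasurable (fun x => deriv f (v x)) μ :=
    hfd.comp_aestronglyMeasurable v.aestronglyMeasurable
  have h1 : Tendsto (fun n => T.form.B (u n) (T.compSmall f hf h0 (u n))) atTop
      (𝓝 (∫ x, deriv f (F x) * g x ∂μ)) := by
    simp_rw [form_compSmall]
    have h2 : Tendsto (fun n => ∫ x, deriv f (((u n : T.A) : E →ₘ[μ] ℝ) x) * g x ∂μ) atTop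
        (𝓝 (∫ x, deriv f (F x) * g x ∂μ)) := by
      refine tendsto_integral_of_dominated_convergence (fun x => C * |g x|) (fun n => ?_)
        (hg.abs.const_mul _) (fun n => .of_forall fun x => ?_) ?_
      · exact (hfm _).mul hg.aestronglyMeasurable
      · rw [norm_mul]
        exact mul_le_mul_of_nonneg_right (hC _) (abs_nonneg _)
      · filter_upwards [hae] with x hx
        exact ((hfd.tendsto _).comp hx).mul_const _
    have h3 : Tendsto (fun n => (∫ x, deriv f (((u n : T.A) : E →ₘ[μ] ℝ) x) *
        (T.Γ (u n) (u n) : E →ₘ[μ] ℝ) x ∂μ) -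
        ∫ x, deriv f (((u n : T.A) : E →ₘ[μ] ℝ) x) * g x ∂μ) atTop (𝓝 0) := by
      rw [tendsto_zero_iff_norm_tendsto_zero]
      refine squeeze_zero (fun n => norm_nonneg _) (fun n => ?_) (by simpa using hlim.const_mul C)
      have i1 := (T.integrable_Γ (u n) (u n)).bdd_mul (hfm (u n : T.A)) (.of_forall fun x => hC _)
      have i2 := hg.bdd_mul (hfm (u n : T.A)) (.of_forall fun x => hC _)
      rw [← integral_sub i1 i2, ← integral_const_mul]
      refine (norm_integral_le_integral_norm _).trans (integral_mono_ae (i1.sub i2).norm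
        (((T.integrable_Γ _ _).sub hg).abs.const_mul _) (.of_forall fun x => ?_))
      beta_reduce
      rw [← mul_sub, norm_mul]
      exact mul_le_mul_of_nonneg_right (hC _) (abs_nonneg _)
    simpa using h3.add h2
  have hlip : LipschitzWith C.toNNReal f := by
    refine lipschitzWith_of_nnnorm_deriv_le (hf.differentiable (by simp)) fun x => ?_
    rw [← NNReal.coe_le_coe, coe_nnnorm, Real.coe_toNNReal _ hC0]
    exact hC x
  have h2 : Tendsto (fun n => lam * inner ℝ F (T.form.J (T.compSmall f hf h0 (u n)))) atTop
      (𝓝 (lam * ∫ x, F x * f (F x) ∂μ)) := by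
    have h3 := (((hlip.continuous_compLp h0).tendsto F).comp hu.1)
    have h4 := ((tendsto_const_nhds (x := F)).inner h3).const_mul lam
    have h5 : inner ℝ F (hlip.compLp h0 F) = ∫ x, F x * f (F x) ∂μ := by
      rw [inner_eq]
      refine integral_congr_ae ?_
      filter_upwards [hlip.coeFn_compLp h0 F] with x hx
      rw [hx]; rfl
    rw [h5] at h4
    refine h4.congr fun n => ?_
    congr 2
    refine Lp.ext ?_
    filter_upwards [hlip.coeFn_compLp h0 (T.form.J (u n)),
      coeFn_comp hf (T := T) (u n)] with x h6 h7
    exact h6.trans h7.symm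
  refine tendsto_nhds_unique h2 ?_
  have h3 : Tendsto (fun n => lam * inner ℝ F (T.form.J (T.compSmall f hf h0 (u n))) -
      T.form.B (u n) (T.compSmall f hf h0 (u n))) atTop (𝓝 0) := by
    obtain ⟨M, hM, hMu⟩ := hu.q_le
    refine Metric.tendsto_nhds.2 fun ε hε => ?_
    obtain ⟨N, hN⟩ := hu.uniform (by positivity : 0 < ε / (2 * (C * M + 1)))
    filter_upwards [hMu, eventually_ge_atTop N] with n h6 h8
    have h9 : T.form.q (T.compSmall f hf h0 (u n)) ≤ C * M :=
      (q_compSmall_le hf h0 hC _).trans (by gcongr)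
    have h10 := hN n h8 (T.compSmall f hf h0 (u n))
    rw [eigenspace_weak hF, neg_neg] at h10
    rw [Real.dist_eq, sub_zero]
    refine h10.trans_lt ?_
    calc ε / (2 * (C * M + 1)) * T.form.q (T.compSmall f hf h0 (u n))
        ≤ ε / (2 * (C * M + 1)) * (C * M) := by gcongr
      _ < ε := by
        have : 0 ≤ C * M := by positivity
        rw [div_mul_eq_mul_div, div_lt_iff₀ (by positivity)]
        nlinarith
  simpa using h3.add h1

end Limit

end DiffusionTriple

/-! ### The Stein kernel of a chaotic eigenfunction. -/

/-- `τ ≥ 0` is a square-integrable Stein kernel of the random variable `F ∈ L⁴`: integration by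
parts holds for smooth functions with bounded derivative. -/
structure IsSteinKernel {E : Type*} [MeasurableSpace E] (μ : Measure E) (F τ : E → ℝ) : Prop where
  aestronglyMeasurable : AEStronglyMeasurable F μ
  integrable_pow_four : Integrable (fun x => F x ^ 4) μ
  memLp : MemLp τ 2 μ
  nonneg : ∀ᵐ x ∂μ, 0 ≤ τ x
  ibp : ∀ f : ℝ → ℝ, ContDiff ℝ (⊤ : ℕ∞) f → (∃ C, ∀ x, |deriv f x| ≤ C) →
    ∫ x, F x * f (F x) ∂μ = ∫ x, deriv f (F x) * τ x ∂μ

namespace DiffusionTriple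

variable {E : Type*} [MeasurableSpace E] {μ : Measure E} [IsProbabilityMeasure μ]

lemma exists_isApprox_ae {T : DiffusionTriple μ} {κ : ℝ} {F : Lp ℝ 2 μ}
    (hF : F ∈ T.eigenspace κ) : ∃ u : ℕ → T.small, T.form.IsApprox F u ∧
      ∀ᵐ x ∂μ, Tendsto (fun n => ((u n : T.A) : E →ₘ[μ] ℝ) x) atTop (𝓝 (F x)) := by
  obtain ⟨u, hu⟩ := exists_isApprox_of_mem_eigenspace hF
  have h1 := (Lp.tendsto_Lp_iff_tendsto_eLpNorm' _ _).1 hu.1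
  obtain ⟨ns, hns, h2⟩ := (tendstoInMeasure_of_tendsto_eLpNorm two_ne_zero
    (fun n => Lp.aestronglyMeasurable _) (Lp.aestronglyMeasurable _) h1).exists_seq_tendsto_ae
  exact ⟨u ∘ ns, hu.comp hns, h2⟩

variable (T : FullMarkovTriple μ)

lemma one_mem_eigenspace : Lp.const 2 μ (1 : ℝ) ∈ T.eigenspace 0 := by
  have := T.L_one
  simpa [eigenspace] using this

lemma isEigenvalueNeg_zero : T.IsEigenvalueNeg 0 := by
  refine ⟨_, one_mem_eigenspace T, fun h => ?_⟩
  have h1 := Lp.norm_const' (p := 2) (μ := μ) (1 : ℝ) (by norm_num) (by norm_num)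
  rw [h] at h1
  simp at h1

lemma integral_eq_inner_one (F : Lp ℝ 2 μ) : ∫ x, F x ∂μ = inner ℝ F (Lp.const 2 μ (1 : ℝ)) := by
  rw [inner_eq]
  refine integral_congr_ae ?_
  filter_upwards [Lp.coeFn_const (p := 2) (μ := μ) (1 : ℝ)] with x hx
  rw [hx]; simp

lemma integral_eq_zero_of_mem_eigenspace {lam : ℝ} (hlam : lam ≠ 0) {F : Lp ℝ 2 μ}
    (hF : F ∈ T.eigenspace lam) : ∫ x, F x ∂μ = 0 := by
  rw [integral_eq_inner_one]
  exact eigenspace_orthogonal hlam hF (one_mem_eigenspace T)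

lemma mem_eigenSum {κ r : ℝ} (hκ : T.IsEigenvalueNeg κ) (h : κ ≤ r) {F : Lp ℝ 2 μ}
    (hF : F ∈ T.eigenspace κ) : F ∈ T.eigenSum r :=
  Submodule.le_topologicalClosure _ (Submodule.subset_span (Set.mem_biUnion (s := {κ : ℝ |
    T.IsEigenvalueNeg κ ∧ κ ≤ r}) (t := fun κ => T.eigenspace κ) ⟨hκ, h⟩ hF))

/-- A chaotic eigenfunction has a Stein kernel, and the spectral gap inequality for `F²` turns into
a quadratic inequality for the Stein kernel. -/
theorem IsChaoticEigenfunction.exists_isSteinKernel {F : Lp ℝ 2 μ} {η : ℝ}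
    (h : T.IsChaoticEigenfunction F η) (q₁ q₀ : ℝ) :
    1 < η ∧ ∃ τ : E → ℝ, IsSteinKernel μ F τ ∧
      ∫ x, (2 * τ x - (2 * F x + q₁) * F x) *
        (2 * τ x - (2 * F x + q₁) * F x + η * (F x ^ 2 + q₁ * F x + q₀)) ∂μ ≤ 0 := by
  obtain ⟨lam, hlam, hF0, hF, ⟨⟨hη, -, S, hS, hSF⟩, -⟩⟩ := h
  refine ⟨hη, ?_⟩
  set one := Lp.const 2 μ (1 : ℝ) with hone
  have hle : lam ≤ η * lam := by nlinarith
  -- `F` itself is admitted because `η > 1`, and the constants because 0 is an eigenvalue.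
  have hQ : S + (q₁ • F + q₀ • one) ∈ T.eigenSum (η * lam) := by
    refine add_mem hS (add_mem (Submodule.smul_mem _ _ ?_) (Submodule.smul_mem _ _ ?_))
    · exact mem_eigenSum T ⟨F, hF, hF0⟩ hle hF
    · exact mem_eigenSum T (isEigenvalueNeg_zero T) (by positivity) (one_mem_eigenspace T)
  obtain ⟨N, hN, hNle⟩ := exists_weakGen_of_mem_eigenSum (by positivity) hQ
  obtain ⟨u, hu, hae⟩ := exists_isApprox_ae hF
  obtain ⟨g, hg, hg0, hlim⟩ := exists_limit_Γ hu
  -- Formally `N = L(F² + q₁F + q₀) = 2 Γ(F,F) - λ (2F + q₁) F`; this is solved for `τ = Γ(F,F)/λ`,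
  -- which is thereby in `L²`.
  set τ : Lp ℝ 2 μ := (2 * lam)⁻¹ • (N + ((2 * lam) • S + (lam * q₁) • F)) with hτ
  have hτx : ∀ᵐ x ∂μ, τ x = (2 * lam)⁻¹ * (N x + 2 * lam * F x ^ 2 + lam * q₁ * F x) := by
    filter_upwards [hSF, Lp.coeFn_smul (2 * lam)⁻¹ (N + ((2 * lam) • S + (lam * q₁) • F)),
      Lp.coeFn_add N ((2 * lam) • S + (lam * q₁) • F),
      Lp.coeFn_add ((2 * lam) • S) ((lam * q₁) • F), Lp.coeFn_smul (2 * lam) S,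
      Lp.coeFn_smul (lam * q₁) F] with x h1 h2 h3 h4 h5 h6
    rw [hτ, h2, Pi.smul_apply, h3, Pi.add_apply, h4, Pi.add_apply, h5, h6, Pi.smul_apply,
      Pi.smul_apply, h1]
    simp only [smul_eq_mul]
    ring
  -- The `L¹` limit and the spectral definition have the same integrals against the small algebra.
  have hgτ : ∀ᵐ x ∂μ, g x = lam * τ x := by
    have hτi : Integrable (fun x => lam * τ x) μ :=
      ((Lp.memLp τ).integrable one_le_two).const_mul lam
    have : ∀ᵐ x ∂μ, g x - lam * τ x = 0 := by
      refine ae_eq_zero_of_forall_integral (T := T.toDiffusionTriple) (hg.sub hτi) fun φ => ?_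
      obtain ⟨C, hC⟩ := T.bounded φ φ.2
      have i1 := hg.mul_bdd ((φ : T.A) : E →ₘ[μ] ℝ).aestronglyMeasurable hC
      have i2 := hτi.mul_bdd ((φ : T.A) : E →ₘ[μ] ℝ).aestronglyMeasurable hC
      simp_rw [sub_mul]
      rw [integral_sub i1 i2, integral_mul_limit_Γ hF hu hg hlim φ]
      have e1 : ∫ x, F x * F x * (T.L φ : E →ₘ[μ] ℝ) x ∂μ = inner ℝ S (T.form.Λ φ) := by
        rw [inner_eq]
        refine integral_congr_ae ?_
        filter_upwards [hSF] with x hx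
        rw [hx, ← sq]; rfl
      have e2 : ∫ x, F x * F x * ((φ : T.A) : E →ₘ[μ] ℝ) x ∂μ = inner ℝ S (T.form.J φ) := by
        rw [inner_eq]
        refine integral_congr_ae ?_
        filter_upwards [hSF] with x hx
        rw [hx, ← sq]; rfl
      have e3 : ∫ x, lam * τ x * ((φ : T.A) : E →ₘ[μ] ℝ) x ∂μ =
          lam * inner ℝ τ (T.form.J φ) := by
        simp_rw [inner_eq, mul_assoc]
        rw [integral_const_mul]; rfl
      have e4 := hN φ
      have e5 := eigenspace_weak hF φ
      have e6 := eigenspace_weak (one_mem_eigenspace T) φ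
      rw [zero_mul, neg_zero] at e6
      rw [inner_add_left, inner_add_left, real_inner_smul_left, real_inner_smul_left, e5, e6] at e4
      rw [e1, e2, e3, hτ, real_inner_smul_left, inner_add_left, inner_add_left,
        real_inner_smul_left, real_inner_smul_left, e4]
      field_simp
      ring
    filter_upwards [this] with x hx
    linarith
  refine ⟨τ, ⟨Lp.aestronglyMeasurable F, ?_, Lp.memLp τ, ?_, ?_⟩, ?_⟩
  · refine (Lp.memLp S).integrable_sq.congr ?_
    filter_upwards [hSF] with x hx
    rw [hx]; ring
  · filter_upwards [hgτ, hg0] with x h1 h2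
    rw [h1] at h2
    exact nonneg_of_mul_nonneg_right h2 hlam
  · rintro f hf ⟨C, hC⟩
    -- Composition in the small algebra requires a function vanishing at 0; the constant `f 0` is
    -- restored below since `F` is centred.
    have hd (x : ℝ) : deriv (fun y => f y - f 0) x = deriv f x := deriv_sub_const _
    have h1 := integral_mul_comp_eq hF hu hae hg hlim (f := fun y => f y - f 0)
      (hf.sub contDiff_const) (sub_self _) (C := C) (fun x => by rw [hd]; exact hC x)
    simp_rw [hd] at h1
    have h2 : ∫ x, deriv f (F x) * g x ∂μ = lam * ∫ x, deriv f (F x) * τ x ∂μ := by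
      rw [← integral_const_mul]
      refine integral_congr_ae ?_
      filter_upwards [hgτ] with x hx
      rw [hx]; ring
    rw [h2] at h1
    have hC0 : 0 ≤ C := (abs_nonneg _).trans (hC 0)
    have hlip : LipschitzWith C.toNNReal fun y => f y - f 0 := by
      refine lipschitzWith_of_nnnorm_deriv_le
        ((hf.sub contDiff_const).differentiable (by simp)) fun x => ?_
      rw [← NNReal.coe_le_coe, coe_nnnorm, Real.coe_toNNReal _ hC0, hd]
      exact hC x
    have i1 : Integrable (fun x => F x * (f (F x) - f 0)) μ :=
      (Lp.memLp F).integrable_mul (hlip.comp_memLp (sub_self _) (Lp.memLp F))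
    have i2 : Integrable (fun x => F x * f 0) μ :=
      ((Lp.memLp F).integrable one_le_two).mul_const _
    have h3 : ∫ x, F x * f (F x) ∂μ = ∫ x, F x * (f (F x) - f 0) ∂μ := by
      have : ∀ x, F x * f (F x) = F x * (f (F x) - f 0) + F x * f 0 := fun x => by ring
      simp_rw [this]
      rw [integral_add i1 i2, integral_mul_const,
        integral_eq_zero_of_mem_eigenspace T hlam.ne' hF, zero_mul, add_zero]
    rw [h3]
    exact mul_left_cancel₀ hlam.ne' h1
  -- `2τ - (2F + q₁)F` is `N / λ`, so the integral is the spectral quadratic expression divided by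
  -- `λ²`.
  · have e : ∫ x, (2 * τ x - (2 * F x + q₁) * F x) *
        (2 * τ x - (2 * F x + q₁) * F x + η * (F x ^ 2 + q₁ * F x + q₀)) ∂μ =
        (lam ^ 2)⁻¹ * inner ℝ N (N + (η * lam) • (S + (q₁ • F + q₀ • one))) := by
      rw [inner_eq, ← integral_const_mul]
      refine integral_congr_ae ?_
      filter_upwards [hSF, hτx, Lp.coeFn_add N ((η * lam) • (S + (q₁ • F + q₀ • one))),
        Lp.coeFn_smul (η * lam) (S + (q₁ • F + q₀ • one)), Lp.coeFn_add S (q₁ • F + q₀ • one),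
        Lp.coeFn_add (q₁ • F) (q₀ • one), Lp.coeFn_smul q₁ F, Lp.coeFn_smul q₀ one,
        Lp.coeFn_const (p := 2) (μ := μ) (1 : ℝ)] with x h1 h2 h3 h4 h5 h6 h7 h8 h9
      rw [h2, h3, Pi.add_apply, h4, Pi.smul_apply, h5, Pi.add_apply, h6, Pi.add_apply, h7, h8,
        Pi.smul_apply, Pi.smul_apply, h9, h1]
      simp only [smul_eq_mul, Function.const_apply]
      field_simp
      ring
    rw [e]
    exact mul_nonpos_of_nonneg_of_nonpos (by positivity) hNle

end DiffusionTriple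

/-! ### The Stein identity for larger classes of test functions. -/

namespace IsSteinKernel

variable {E : Type*} [MeasurableSpace E] {μ : Measure E} [IsProbabilityMeasure μ] {F τ : E → ℝ}

lemma memLp_sq (h : IsSteinKernel μ F τ) : MemLp (fun x => F x ^ 2) 2 μ := by
  refine (memLp_two_iff_integrable_sq (f := fun x => F x ^ 2) (h.aestronglyMeasurable.pow 2)).2
    (h.integrable_pow_four.congr (.of_forall fun x => ?_))
  ring

lemma memLp_two (h : IsSteinKernel μ F τ) : MemLp F 2 μ := by
  refine (memLp_two_iff_integrable_sq h.aestronglyMeasurable).2 (h.memLp_sq.integrable one_le_two)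

lemma integral_eq_zero (h : IsSteinKernel μ F τ) : ∫ x, F x ∂μ = 0 := by
  have := h.ibp (fun _ => 1) contDiff_const ⟨0, by simp⟩
  simpa using this

/-- Integration by parts for functions of cubic growth. -/
lemma ibp_of_growth (h : IsSteinKernel μ F τ) {f : ℝ → ℝ} (hf : ContDiff ℝ (⊤ : ℕ∞) f) {C : ℝ}
    (hC : ∀ x, |f x| ≤ C * (1 + |x| ^ 3)) (hC' : ∀ x, |deriv f x| ≤ C * (1 + x ^ 2)) :
    ∫ x, F x * f (F x) ∂μ = ∫ x, deriv f (F x) * τ x ∂μ := by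
  have hC0 : 0 ≤ C := by have := (abs_nonneg _).trans (hC 0); simpa using this
  have hfd : Continuous (deriv f) := hf.continuous_deriv (by simp)
  -- Smooth truncations: bounded, dominated by `|x|` and convergent to `x`. Thus `f ∘ s n` has a
  -- bounded derivative, and `1 + F ^ 4` and `(1 + F ^ 2) * |τ|` dominate up to constants.
  set s : ℕ → ℝ → ℝ := fun n x => (n + 1) * Real.sin (x / (n + 1)) with hs
  have hsc (n : ℕ) : ContDiff ℝ (⊤ : ℕ∞) (s n) := by
    rw [hs]; fun_prop
  have hsd (n : ℕ) (x : ℝ) : HasDerivAt (s n) (Real.cos (x / (n + 1))) x := by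
    have := (((hasDerivAt_id x).div_const ((n : ℝ) + 1)).sin).const_mul ((n : ℝ) + 1)
    refine this.congr_deriv ?_
    have : (n : ℝ) + 1 ≠ 0 := by positivity
    simp only [id]
    field_simp
  have hs_le (n : ℕ) (x : ℝ) : |s n x| ≤ |x| := by
    have h0 : (0 : ℝ) < n + 1 := by positivity
    rw [hs]; beta_reduce
    rw [abs_mul, abs_of_pos h0]
    calc ((n : ℝ) + 1) * |Real.sin (x / (n + 1))| ≤ (n + 1) * |x / (n + 1)| := by
          exact mul_le_mul_of_nonneg_left Real.abs_sin_le_abs h0.le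
      _ = |x| := by rw [abs_div, abs_of_pos h0]; field_simp
  have hs_le' (n : ℕ) (x : ℝ) : |s n x| ≤ n + 1 := by
    have h0 : (0 : ℝ) < n + 1 := by positivity
    rw [hs]; beta_reduce
    rw [abs_mul, abs_of_pos h0]
    exact mul_le_of_le_one_right h0.le (Real.abs_sin_le_one _)
  have hs_lim (x : ℝ) : Tendsto (fun n => s n x) atTop (𝓝 x) := by
    have h1 : HasDerivAt (fun t => Real.sin (x * t)) x 0 := by
      have := ((hasDerivAt_id (0 : ℝ)).const_mul x).sin
      simpa using this
    have h2 := h1.tendsto_slope_zero_right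
    have h3 : Tendsto (fun n : ℕ => ((n : ℝ) + 1)⁻¹) atTop (𝓝[>] 0) := by
      refine tendsto_nhdsWithin_iff.2 ⟨?_, .of_forall fun n => ?_⟩
      · exact tendsto_inv_atTop_zero.comp
          (tendsto_atTop_add_const_right _ _ tendsto_natCast_atTop_atTop)
      · exact Set.mem_Ioi.2 (by positivity)
    refine (h2.comp h3).congr fun n => ?_
    simp [hs, div_eq_mul_inv]
  have hd (n : ℕ) (x : ℝ) : deriv (fun y => f (s n y)) x =
      deriv f (s n x) * Real.cos (x / (n + 1)) :=
    ((hf.differentiable (by simp) _).hasDerivAt.comp x (hsd n x)).deriv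
  have key (n : ℕ) : ∫ x, F x * f (s n (F x)) ∂μ =
      ∫ x, deriv f (s n (F x)) * Real.cos (F x / (n + 1)) * τ x ∂μ := by
    have := h.ibp (fun y => f (s n y)) (hf.comp (hsc n)) ⟨C * (1 + (n + 1) ^ 2), fun x => ?_⟩
    · simp_rw [hd] at this
      exact this
    · rw [hd, abs_mul]
      calc |deriv f (s n x)| * |Real.cos (x / (n + 1))| ≤ |deriv f (s n x)| * 1 := by
            gcongr; exact Real.abs_cos_le_one _
        _ ≤ C * (1 + s n x ^ 2) := by rw [mul_one]; exact hC' _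
        _ ≤ C * (1 + (n + 1) ^ 2) := by
            have := sq_le_sq' (abs_le.1 (hs_le' n x)).1 (abs_le.1 (hs_le' n x)).2
            gcongr
  have hcont {φ : ℝ → ℝ} (hφ : Continuous φ) : AEStronglyMeasurable (fun x => φ (F x)) μ :=
    hφ.comp_aestronglyMeasurable h.aestronglyMeasurable
  have h1 : Tendsto (fun n => ∫ x, F x * f (s n (F x)) ∂μ) atTop (𝓝 (∫ x, F x * f (F x) ∂μ)) := by
    refine tendsto_integral_of_dominated_convergence (fun x => 2 * C * (1 + F x ^ 4))
      (fun n => ?_) (((integrable_const _).add h.integrable_pow_four).const_mul _)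
      (fun n => .of_forall fun x => ?_) (.of_forall fun x => ?_)
    · exact h.aestronglyMeasurable.mul (hcont (hf.continuous.comp (hsc n).continuous))
    · rw [Real.norm_eq_abs, abs_mul]
      have h2 : |f (s n (F x))| ≤ C * (1 + |F x| ^ 3) := by
        refine (hC _).trans ?_
        have := hs_le n (F x)
        gcongr
      have h3 : F x ^ 4 = |F x| ^ 4 := by rw [← abs_pow, abs_of_nonneg (by positivity)]
      rw [h3]
      have h4 := mul_le_mul_of_nonneg_left h2 (abs_nonneg (F x))
      have h5 : |F x| ≤ 1 + |F x| ^ 4 := by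
        nlinarith [sq_nonneg (|F x| - 1), sq_nonneg (|F x| ^ 2 - 1), sq_nonneg (|F x|)]
      nlinarith
    · exact ((hf.continuous.tendsto (F x)).comp (hs_lim (F x))).const_mul (F x)
  have h2 : Tendsto (fun n : ℕ => ∫ x, deriv f (s n (F x)) * Real.cos (F x / (n + 1)) * τ x ∂μ)
      atTop (𝓝 (∫ x, deriv f (F x) * τ x ∂μ)) := by
    have hi₁ : MemLp (fun x => 1 + F x ^ 2) 2 μ := (memLp_const (1 : ℝ)).add h.memLp_sq
    have hi : MemLp (fun x => C * (1 + F x ^ 2)) 2 μ := hi₁.const_mul C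
    refine tendsto_integral_of_dominated_convergence (fun x => C * (1 + F x ^ 2) * |τ x|)
      (fun n => ?_) (hi.integrable_mul h.memLp.abs)
      (fun n => .of_forall fun x => ?_) (.of_forall fun x => ?_)
    · exact (hcont (φ := fun y => deriv f (s n y) * Real.cos (y / (n + 1)))
        ((hfd.comp (hsc n).continuous).mul (by fun_prop))).mul h.memLp.1
    · rw [norm_mul, norm_mul]
      refine mul_le_mul_of_nonneg_right ?_ (abs_nonneg _)
      calc |deriv f (s n (F x))| * |Real.cos (F x / (n + 1))| ≤ |deriv f (s n (F x))| * 1 := by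
            gcongr; exact Real.abs_cos_le_one _
        _ ≤ C * (1 + s n (F x) ^ 2) := by rw [mul_one]; exact hC' _
        _ ≤ C * (1 + F x ^ 2) := by
            have := sq_le_sq.2 (hs_le n (F x))
            gcongr
    · have h3 : Tendsto (fun n : ℕ => Real.cos (F x / (n + 1))) atTop (𝓝 1) := by
        have h4 : Tendsto (fun n : ℕ => F x / ((n : ℝ) + 1)) atTop (𝓝 0) :=
          tendsto_const_nhds.div_atTop
            (tendsto_atTop_add_const_right _ _ tendsto_natCast_atTop_atTop)
        have := (Real.continuous_cos.tendsto 0).comp h4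
        rwa [Real.cos_zero] at this
      have := (((hfd.tendsto _).comp (hs_lim (F x))).mul h3).mul_const (τ x)
      rwa [mul_one] at this
  simp_rw [key] at h1
  exact tendsto_nhds_unique h1 h2

/-- Integration by parts for functions with a bounded continuous derivative. -/
lemma ibp_continuous (h : IsSteinKernel μ F τ) {g : ℝ → ℝ} (hg : Continuous g) {C : ℝ}
    (hC : ∀ x, |g x| ≤ C) :
    ∫ x, F x * (∫ y in (0 : ℝ)..F x, g y) ∂μ = ∫ x, g (F x) * τ x ∂μ := by
  have hC0 : 0 ≤ C := (abs_nonneg _).trans (hC 0)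
  -- Mollifying `g` at scale `1 / (n + 1)` keeps the bound `C`; the primitives are then smooth with
  -- bounded derivative.
  set φ : ℕ → ContDiffBump (0 : ℝ) := fun n =>
    ⟨((n : ℝ) + 1)⁻¹, 2 * ((n : ℝ) + 1)⁻¹, by positivity, by
      have : 0 < ((n : ℝ) + 1)⁻¹ := by positivity
      linarith⟩ with hφ
  set gn : ℕ → ℝ → ℝ := fun n =>
    convolution ((φ n).normed volume) g (ContinuousLinearMap.lsmul ℝ ℝ) volume with hgn
  have hsm (n : ℕ) : ContDiff ℝ (⊤ : ℕ∞) (gn n) :=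
    (φ n).hasCompactSupport_normed.contDiff_convolution_left _ (φ n).contDiff_normed
      hg.locallyIntegrable
  have hlim (x : ℝ) : Tendsto (fun n => gn n x) atTop (𝓝 (g x)) := by
    refine ContDiffBump.convolution_tendsto_right_of_continuous ?_ hg x
    have : Tendsto (fun n : ℕ => 2 * ((n : ℝ) + 1)⁻¹) atTop (𝓝 (2 * 0)) :=
      (tendsto_inv_atTop_zero.comp
        (tendsto_atTop_add_const_right _ _ tendsto_natCast_atTop_atTop)).const_mul 2
    simpa using this
  have hb (n : ℕ) (x : ℝ) : |gn n x| ≤ C := by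
    have h1 : ∫ t, (φ n).normed volume t * C = C := by
      rw [integral_mul_const, (φ n).integral_normed, one_mul]
    rw [hgn, ← h1, ← Real.norm_eq_abs]
    refine norm_integral_le_of_norm_le ((φ n).integrable_normed.mul_const C)
      (.of_forall fun t => ?_)
    rw [ContinuousLinearMap.lsmul_apply, norm_smul, Real.norm_eq_abs, Real.norm_eq_abs,
      abs_of_nonneg ((φ n).nonneg_normed t)]
    exact mul_le_mul_of_nonneg_left (hC _) ((φ n).nonneg_normed t)
  set fn : ℕ → ℝ → ℝ := fun n x => ∫ y in (0 : ℝ)..x, gn n y with hfn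
  have hder (n : ℕ) (x : ℝ) : HasDerivAt (fn n) (gn n x) x :=
    intervalIntegral.integral_hasDerivAt_right ((hsm n).continuous.intervalIntegrable _ _)
      ((hsm n).continuous.stronglyMeasurableAtFilter _ _) (hsm n).continuous.continuousAt
  have hfsm (n : ℕ) : ContDiff ℝ (⊤ : ℕ∞) (fn n) := by
    refine contDiff_infty_iff_deriv.2 ⟨fun x => (hder n x).differentiableAt, ?_⟩
    rw [funext fun x => (hder n x).deriv]
    exact hsm n
  have hfb (n : ℕ) (x : ℝ) : |fn n x| ≤ C * |x| := by
    have := intervalIntegral.norm_integral_le_of_norm_le_const (a := 0) (b := x) (f := gn n)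
      (C := C) fun y _ => hb n y
    simpa using this
  have hflim (x : ℝ) : Tendsto (fun n => fn n x) atTop (𝓝 (∫ y in (0 : ℝ)..x, g y)) :=
    intervalIntegral.tendsto_integral_filter_of_dominated_convergence (fun _ => C)
      (.of_forall fun n => (hsm n).continuous.aestronglyMeasurable)
      (.of_forall fun n => .of_forall fun y _ => hb n y) (by simp)
      (.of_forall fun y _ => hlim y)
  have hcont {ψ : ℝ → ℝ} (hψ : Continuous ψ) : AEStronglyMeasurable (fun x => ψ (F x)) μ :=
    hψ.comp_aestronglyMeasurable h.aestronglyMeasurable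
  have h1 : Tendsto (fun n => ∫ x, F x * fn n (F x) ∂μ) atTop
      (𝓝 (∫ x, F x * (∫ y in (0 : ℝ)..F x, g y) ∂μ)) := by
    refine tendsto_integral_of_dominated_convergence (fun x => C * F x ^ 2)
      (fun n => h.aestronglyMeasurable.mul (hcont (hfsm n).continuous))
      (h.memLp_two.integrable_sq.const_mul C)
      (fun n => .of_forall fun x => ?_) (.of_forall fun x => (hflim _).const_mul _)
    rw [Real.norm_eq_abs, abs_mul, ← sq_abs]
    nlinarith [hfb n (F x), abs_nonneg (F x)]
  have h2 : Tendsto (fun n => ∫ x, gn n (F x) * τ x ∂μ) atTop (𝓝 (∫ x, g (F x) * τ x ∂μ)) := by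
    refine tendsto_integral_of_dominated_convergence (fun x => C * |τ x|)
      (fun n => (hcont (hsm n).continuous).mul h.memLp.1)
      ((h.memLp.integrable one_le_two).abs.const_mul C)
      (fun n => .of_forall fun x => ?_) (.of_forall fun x => (hlim _).mul_const _)
    rw [Real.norm_eq_abs, abs_mul]
    exact mul_le_mul_of_nonneg_right (hb n _) (abs_nonneg _)
  refine tendsto_nhds_unique h1 (h2.congr fun n => ?_)
  have := h.ibp (fn n) (hfsm n) ⟨C, fun x => by rw [(hder n x).deriv]; exact hb n x⟩
  simp_rw [fun x => (hder n x).deriv] at this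
  exact this.symm

/-- The defect in the Stein equation is controlled by the distance of the Stein kernel to `β`. -/
lemma abs_integral_sub_le (h : IsSteinKernel μ F τ) {f d β : ℝ → ℝ} {C : ℝ} (hC : 0 ≤ C)
    (hf : ∀ x y, |f x - f y| ≤ C * |x - y|) (hβ : Continuous β)
    (hβi : Integrable (fun x => β (F x)) μ)
    (hd : ∀ x, β x ≠ 0 → HasDerivAt f (d x) x) :
    |∫ x, F x * f (F x) ∂μ - ∫ x, β (F x) * d (F x) ∂μ| ≤ C * ∫ x, |τ x - β (F x)| ∂μ := by
  have hfc : Continuous f := by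
    refine (LipschitzWith.of_dist_le_mul (K := C.toNNReal) fun x y => ?_).continuous
    rw [Real.coe_toNNReal _ hC]
    exact hf x y
  -- The law of `F` may have atoms, so almost everywhere differentiability of `f` is of no use.
  -- Difference quotients are continuous, bounded by `C`, and tend to `d` wherever `β ≠ 0`;
  -- elsewhere the factor `β` kills them. Their primitives tend to `f - f 0`.
  set g : ℕ → ℝ → ℝ := fun n x => (n + 1) * (f (x + ((n : ℝ) + 1)⁻¹) - f x) with hg
  have hgc (n : ℕ) : Continuous (g n) := by rw [hg]; fun_prop
  have hgb (n : ℕ) (x : ℝ) : |g n x| ≤ C := by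
    have h0 : (0 : ℝ) < n + 1 := by positivity
    rw [hg]; beta_reduce
    rw [abs_mul, abs_of_pos h0]
    have := hf (x + ((n : ℝ) + 1)⁻¹) x
    rw [add_sub_cancel_left, abs_of_pos (inv_pos.2 h0)] at this
    calc ((n : ℝ) + 1) * |f (x + ((n : ℝ) + 1)⁻¹) - f x| ≤ (n + 1) * (C * ((n : ℝ) + 1)⁻¹) := by
          gcongr
      _ = C := by field_simp
  have hseq : Tendsto (fun n : ℕ => ((n : ℝ) + 1)⁻¹) atTop (𝓝[>] 0) := by
    refine tendsto_nhdsWithin_iff.2 ⟨?_, .of_forall fun n => ?_⟩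
    · exact tendsto_inv_atTop_zero.comp
        (tendsto_atTop_add_const_right _ _ tendsto_natCast_atTop_atTop)
    · exact Set.mem_Ioi.2 (by positivity)
  have hglim (x : ℝ) (hx : β x ≠ 0) : Tendsto (fun n => g n x) atTop (𝓝 (d x)) := by
    refine ((hd x hx).tendsto_slope_zero_right.comp hseq).congr fun n => ?_
    simp [hg]
  set P : ℝ → ℝ := fun x => ∫ y in (0 : ℝ)..x, f y with hP
  have hPd (x : ℝ) : HasDerivAt P (f x) x :=
    intervalIntegral.integral_hasDerivAt_right (hfc.intervalIntegrable _ _)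
      (hfc.stronglyMeasurableAtFilter _ _) hfc.continuousAt
  have hgi (n : ℕ) (x : ℝ) : ∫ y in (0 : ℝ)..x, g n y =
      (n + 1) * (P (x + ((n : ℝ) + 1)⁻¹) - P x) - (n + 1) * (P (0 + ((n : ℝ) + 1)⁻¹) - P 0) := by
    refine intervalIntegral.integral_eq_sub_of_hasDerivAt
      (f := fun x => (n + 1) * (P (x + ((n : ℝ) + 1)⁻¹) - P x)) (fun y _ => ?_)
      ((hgc n).intervalIntegrable _ _)
    exact (((hPd _).comp_add_const y _).sub (hPd y)).const_mul _
  have hPlim (x : ℝ) : Tendsto (fun n : ℕ => ((n : ℝ) + 1) * (P (x + ((n : ℝ) + 1)⁻¹) - P x)) atTop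
      (𝓝 (f x)) := by
    refine ((hPd x).tendsto_slope_zero_right.comp hseq).congr fun n => ?_
    simp
  have hfn (x : ℝ) : Tendsto (fun n => ∫ y in (0 : ℝ)..x, g n y) atTop (𝓝 (f x - f 0)) := by
    simp_rw [hgi]
    exact (hPlim x).sub (hPlim 0)
  have hcont {ψ : ℝ → ℝ} (hψ : Continuous ψ) : AEStronglyMeasurable (fun x => ψ (F x)) μ :=
    hψ.comp_aestronglyMeasurable h.aestronglyMeasurable
  have h1 : Tendsto (fun n => ∫ x, F x * (∫ y in (0 : ℝ)..F x, g n y) ∂μ) atTop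
      (𝓝 (∫ x, F x * (f (F x) - f 0) ∂μ)) := by
    refine tendsto_integral_of_dominated_convergence (fun x => C * F x ^ 2)
      (fun n => h.aestronglyMeasurable.mul (hcont (ψ := fun z => ∫ y in (0 : ℝ)..z, g n y) ?_))
      (h.memLp_two.integrable_sq.const_mul C)
      (fun n => .of_forall fun x => ?_) (.of_forall fun x => (hfn _).const_mul _)
    · exact intervalIntegral.continuous_primitive (fun a b => (hgc n).intervalIntegrable a b) 0
    · have := intervalIntegral.norm_integral_le_of_norm_le_const (a := 0) (b := F x) (f := g n)
        (C := C) fun y _ => hgb n y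
      rw [sub_zero, Real.norm_eq_abs] at this
      rw [Real.norm_eq_abs, abs_mul, ← sq_abs]
      nlinarith [abs_nonneg (F x)]
  have h2 : Tendsto (fun n => ∫ x, β (F x) * g n (F x) ∂μ) atTop
      (𝓝 (∫ x, β (F x) * d (F x) ∂μ)) := by
    refine tendsto_integral_of_dominated_convergence (fun x => C * |β (F x)|)
      (fun n => (hcont hβ).mul (hcont (hgc n))) (hβi.abs.const_mul C)
      (fun n => .of_forall fun x => ?_) (.of_forall fun x => ?_)
    · rw [Real.norm_eq_abs, abs_mul, mul_comm]
      exact mul_le_mul_of_nonneg_right (hgb n _) (abs_nonneg _)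
    · by_cases hx : β (F x) = 0
      · simp [hx]
      · exact (hglim _ hx).const_mul _
  have hFi : Integrable F μ := h.memLp_two.integrable one_le_two
  have h3 : ∫ x, F x * (f (F x) - f 0) ∂μ = ∫ x, F x * f (F x) ∂μ := by
    have i1 : Integrable (fun x => F x * f (F x)) μ := by
      have j₁ : MemLp (fun x => C * |F x|) 2 μ := h.memLp_two.abs.const_mul C
      have j₂ : MemLp (fun x => |f 0| + C * |F x|) 2 μ := (memLp_const |f 0|).add j₁
      refine h.memLp_two.integrable_mul (j₂.of_le (hcont hfc) (.of_forall fun x => ?_))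
      have := hf (F x) 0
      rw [sub_zero] at this
      have h4 := abs_sub_abs_le_abs_sub (f (F x)) (f 0)
      rw [Real.norm_eq_abs, Real.norm_eq_abs]
      exact le_trans (by linarith) (le_abs_self _)
    simp_rw [mul_sub]
    rw [integral_sub i1 (hFi.mul_const _), integral_mul_const, h.integral_eq_zero, zero_mul,
      sub_zero]
  rw [h3] at h1
  have hτi := h.memLp.integrable one_le_two
  refine le_of_tendsto (h1.sub h2).abs (.of_forall fun n => ?_)
  have i1 : Integrable (fun x => g n (F x) * τ x) μ :=
    hτi.bdd_mul (hcont (hgc n)) (.of_forall fun x => hgb n _)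
  have i2 : Integrable (fun x => β (F x) * g n (F x)) μ :=
    hβi.mul_bdd (hcont (hgc n)) (.of_forall fun x => hgb n _)
  rw [h.ibp_continuous (hgc n) (hgb n), ← integral_sub i1 i2, ← integral_const_mul]
  refine (norm_integral_le_integral_norm (μ := μ) _).trans (integral_mono (i1.sub i2).norm
    ((hτi.sub hβi).abs.const_mul C) fun x => ?_)
  have : g n (F x) * τ x - β (F x) * g n (F x) = g n (F x) * (τ x - β (F x)) := by ring
  simp only [Pi.sub_apply]
  rw [this, norm_mul]
  exact mul_le_mul_of_nonneg_right (hgb n _) (abs_nonneg _)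

end IsSteinKernel

namespace IsSteinKernel

variable {E : Type*} [MeasurableSpace E] {μ : Measure E} [IsProbabilityMeasure μ] {F τ : E → ℝ}

lemma ibp_cubic (h : IsSteinKernel μ F τ) (a₃ a₂ a₁ a₀ : ℝ) :
    ∫ x, F x * (a₃ * F x ^ 3 + a₂ * F x ^ 2 + a₁ * F x + a₀) ∂μ =
      ∫ x, (3 * a₃ * F x ^ 2 + 2 * a₂ * F x + a₁) * τ x ∂μ := by
  have hd (x : ℝ) : deriv (fun y : ℝ => a₃ * y ^ 3 + a₂ * y ^ 2 + a₁ * y + a₀) x =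
      3 * a₃ * x ^ 2 + 2 * a₂ * x + a₁ := by
    have h1 := (((((hasDerivAt_id x).pow 3).const_mul a₃).add
      (((hasDerivAt_id x).pow 2).const_mul a₂)).add ((hasDerivAt_id x).const_mul a₁)).add_const a₀
    refine (h1.congr_deriv ?_).deriv
    simp only [id]
    norm_num
    ring
  have := h.ibp_of_growth (f := fun y : ℝ => a₃ * y ^ 3 + a₂ * y ^ 2 + a₁ * y + a₀) (by fun_prop)
    (C := 3 * |a₃| + 2 * |a₂| + |a₁| + |a₀|) (fun x => ?_) (fun x => ?_)
  · simp_rw [hd] at this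
    exact this
  · have e1 := abs_add_le (a₃ * x ^ 3 + a₂ * x ^ 2 + a₁ * x) a₀
    have e2 := abs_add_le (a₃ * x ^ 3 + a₂ * x ^ 2) (a₁ * x)
    have e3 := abs_add_le (a₃ * x ^ 3) (a₂ * x ^ 2)
    rw [abs_mul, abs_mul, abs_pow, abs_pow] at e3
    rw [abs_mul] at e2
    have n0 := abs_nonneg x
    have n1 : |x| ^ 2 ≤ 1 + |x| ^ 3 := by
      rcases le_total |x| 1 with hx | hx
      · nlinarith [pow_nonneg n0 3, pow_le_one₀ n0 hx (n := 2)]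
      · nlinarith [sq_nonneg |x|]
    have n2 : |x| ≤ 1 + |x| ^ 3 := by
      rcases le_total |x| 1 with hx | hx
      · nlinarith [pow_nonneg n0 3]
      · nlinarith [sq_nonneg |x|, one_le_pow₀ hx (n := 2)]
    have n3 := pow_nonneg n0 3
    have m3 := abs_nonneg a₃
    have m2 := mul_le_mul_of_nonneg_left n1 (abs_nonneg a₂)
    have m1 := mul_le_mul_of_nonneg_left n2 (abs_nonneg a₁)
    have k2 : 0 ≤ |a₂| * (1 + |x| ^ 3) := by positivity
    have k3 : 0 ≤ |a₃| * (1 + |x| ^ 3) := by positivity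
    have k0 : 0 ≤ |a₀| * |x| ^ 3 := by positivity
    nlinarith
  · rw [hd]
    have e2 := abs_add_le (3 * a₃ * x ^ 2 + 2 * a₂ * x) a₁
    have e3 := abs_add_le (3 * a₃ * x ^ 2) (2 * a₂ * x)
    rw [abs_mul, abs_mul, abs_mul, abs_mul, abs_pow, sq_abs, abs_of_pos (three_pos (α := ℝ)),
      abs_of_pos (two_pos (α := ℝ))] at e3
    have n1 : |x| ≤ 1 + x ^ 2 := by nlinarith [sq_abs x, sq_nonneg (|x| - 1), abs_nonneg x]
    have m2 := mul_le_mul_of_nonneg_left n1 (abs_nonneg a₂)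
    have k1 : 0 ≤ |a₁| * x ^ 2 := by positivity
    have k0 : 0 ≤ |a₀| * (1 + x ^ 2) := by positivity
    nlinarith [abs_nonneg a₃]

lemma memLp_quadratic (h : IsSteinKernel μ F τ) (a₂ a₁ a₀ : ℝ) :
    MemLp (fun x => a₂ * F x ^ 2 + a₁ * F x + a₀) 2 μ := by
  have h1 : MemLp (fun x => a₂ * F x ^ 2 + a₁ * F x) 2 μ :=
    (h.memLp_sq.const_mul a₂).add (h.memLp_two.const_mul a₁)
  exact h1.add (memLp_const a₀)

/-- The quadratic inequality from the spectral condition, after integration by parts. -/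
lemma integral_sub_sq_le (h : IsSteinKernel μ F τ) {η q₁ q₀ : ℝ}
    (hspec : ∫ x, (2 * τ x - (2 * F x + q₁) * F x) *
        (2 * τ x - (2 * F x + q₁) * F x + η * (F x ^ 2 + q₁ * F x + q₀)) ∂μ ≤ 0) (a : ℝ) :
    ∫ x, (2 * τ x - (2 * F x + q₁) * F x + a * (F x ^ 2 + q₁ * F x + q₀)) ^ 2 ∂μ ≤
      a ^ 2 * ∫ x, (F x ^ 2 + q₁ * F x + q₀) ^ 2 ∂μ -
        (2 * a - η) / 6 * ∫ x, (2 * F x + q₁) ^ 3 * F x ∂μ := by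
  set Q : E → ℝ := fun x => F x ^ 2 + q₁ * F x + q₀ with hQ
  set D : E → ℝ := fun x => 2 * F x + q₁ with hD
  set n : E → ℝ := fun x => 2 * τ x - D x * F x with hn
  have hQL : MemLp Q 2 μ := by
    have := h.memLp_quadratic 1 q₁ q₀
    simpa only [one_mul] using this
  have hDF : MemLp (fun x => D x * F x) 2 μ := by
    refine (h.memLp_quadratic 2 q₁ 0).congr_norm ?_ (.of_forall fun x => ?_)
    · exact ((h.aestronglyMeasurable.const_mul 2).add_const q₁).mul h.aestronglyMeasurable
    · rw [hD]; congr 1; ring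
  have hDD : MemLp (fun x => D x ^ 2) 2 μ := by
    refine (h.memLp_quadratic 4 (4 * q₁) (q₁ ^ 2)).congr_norm ?_ (.of_forall fun x => ?_)
    · exact ((h.aestronglyMeasurable.const_mul 2).add_const q₁).pow 2
    · rw [hD]; congr 1; ring
  have hnL : MemLp n 2 μ := (h.memLp.const_mul 2).sub hDF
  have hnn : Integrable (fun x => n x * (n x + η * Q x)) μ :=
    hnL.integrable_mul (hnL.add (hQL.const_mul η))
  have hnQ : Integrable (fun x => n x * Q x) μ := hnL.integrable_mul hQL
  have hQQ : Integrable (fun x => Q x ^ 2) μ := hQL.integrable_sq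
  have hDτ : Integrable (fun x => D x ^ 2 * τ x) μ := hDD.integrable_mul h.memLp
  have hQτ : Integrable (fun x => Q x * τ x) μ := hQL.integrable_mul h.memLp
  have hDFQ : Integrable (fun x => D x * F x * Q x) μ := hDF.integrable_mul hQL
  -- With `n` standing for `LQ / λ`, the square is split so that the spectral expression `n (n + η
  -- Q)` can be discarded.
  have e1 : ∫ x, (n x + a * Q x) ^ 2 ∂μ = ∫ x, n x * (n x + η * Q x) ∂μ +
      (2 * a - η) * ∫ x, n x * Q x ∂μ + a ^ 2 * ∫ x, Q x ^ 2 ∂μ := by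
    have i1 : Integrable (fun x => (2 * a - η) * (n x * Q x)) μ := hnQ.const_mul _
    have i2 : Integrable (fun x => a ^ 2 * Q x ^ 2) μ := hQQ.const_mul _
    have i3 : Integrable (fun x => n x * (n x + η * Q x) + (2 * a - η) * (n x * Q x)) μ :=
      hnn.add i1
    rw [← integral_const_mul, ← integral_const_mul, ← integral_add hnn i1, ← integral_add i3 i2]
    congr 1; funext x; ring
  -- As `D = Q'` and `D' = 2`, the Stein identity is applied to `D³`, of derivative `6 D²`, and to
  -- `D Q`, of derivative `D² + 2 Q`. Together they give `∫ n Q = -∫ D² τ = -(1/6) ∫ D³ F`.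
  have e2 : ∫ x, D x ^ 3 * F x ∂μ = 6 * ∫ x, D x ^ 2 * τ x ∂μ := by
    have := h.ibp_cubic 8 (12 * q₁) (6 * q₁ ^ 2) (q₁ ^ 3)
    rw [← integral_const_mul]
    refine Eq.trans ?_ (this.trans ?_) <;> congr 1 <;> funext x <;> rw [hD] <;> ring
  have e3 : ∫ x, D x * F x * Q x ∂μ = ∫ x, D x ^ 2 * τ x ∂μ + 2 * ∫ x, Q x * τ x ∂μ := by
    have := h.ibp_cubic 2 (3 * q₁) (2 * q₀ + q₁ ^ 2) (q₁ * q₀)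
    rw [← integral_const_mul, ← integral_add hDτ (hQτ.const_mul 2)]
    refine Eq.trans ?_ (this.trans ?_) <;> congr 1 <;> funext x <;> rw [hD, hQ] <;> ring
  have e4 : ∫ x, n x * Q x ∂μ = 2 * ∫ x, Q x * τ x ∂μ - ∫ x, D x * F x * Q x ∂μ := by
    rw [← integral_const_mul, ← integral_sub (hQτ.const_mul 2) hDFQ]
    congr 1; funext x; rw [hn]; ring
  have h1 : ∫ x, n x * (n x + η * Q x) ∂μ ≤ 0 := hspec
  have e5 : ∫ x, n x * Q x ∂μ = -(1 / 6) * ∫ x, D x ^ 3 * F x ∂μ := by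
    rw [e4, e3, e2]; ring
  rw [e1, e5]
  linarith

end IsSteinKernel

/-! ### The polynomials Q and U in terms of the centred variable. -/

section Pearson

variable {m b₀ b₁ b₂ : ℝ}

/-- The linear coefficient of the polynomial `Q` shifted by the mean. -/
noncomputable def shiftedCoeffOne (m b₁ b₂ : ℝ) : ℝ := 2 * m + 2 * (b₁ + m) / (2 * b₂ - 1)

/-- The constant coefficient of the polynomial `Q` shifted by the mean. -/
noncomputable def shiftedCoeffZero (m b₀ b₁ b₂ : ℝ) : ℝ :=
  m ^ 2 + 2 * (b₁ + m) / (2 * b₂ - 1) * m + 1 / (b₂ - 1) * (b₀ + m * (b₁ + m) / (2 * b₂ - 1))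

lemma pearsonQ_eval (y : ℝ) : (pearsonQ m b₀ b₁ b₂).eval (y + m) =
    y ^ 2 + shiftedCoeffOne m b₁ b₂ * y + shiftedCoeffZero m b₀ b₁ b₂ := by
  simp only [pearsonQ, shiftedCoeffOne, shiftedCoeffZero, Polynomial.eval_add, Polynomial.eval_pow,
    Polynomial.eval_X, Polynomial.eval_mul, Polynomial.eval_C]
  ring

lemma pearsonU_eval (y : ℝ) : (pearsonU m b₀ b₁ b₂).eval (y + m) =
    (1 - b₂) * (y ^ 2 + shiftedCoeffOne m b₁ b₂ * y + shiftedCoeffZero m b₀ b₁ b₂) ^ 2 -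
      1 / 12 * ((2 * y + shiftedCoeffOne m b₁ b₂) ^ 3 * y) := by
  have hd : (Polynomial.derivative (pearsonQ m b₀ b₁ b₂)).eval (y + m) =
      2 * y + shiftedCoeffOne m b₁ b₂ := by
    simp only [pearsonQ, shiftedCoeffOne, Polynomial.derivative_add, Polynomial.derivative_X_pow,
      Polynomial.derivative_mul, Polynomial.derivative_C, Polynomial.derivative_X,
      Polynomial.eval_add, Polynomial.eval_mul, Polynomial.eval_pow, Polynomial.eval_X,
      Polynomial.eval_C, Polynomial.eval_zero, Polynomial.eval_one]
    norm_num
    ring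
  rw [pearsonU, Polynomial.eval_sub, Polynomial.eval_mul, Polynomial.eval_mul,
    Polynomial.eval_mul, Polynomial.eval_pow, Polynomial.eval_pow, hd, pearsonQ_eval]
  simp only [Polynomial.eval_sub, Polynomial.eval_X, Polynomial.eval_C, add_sub_cancel_right]
  ring

/-- This identity dictates the coefficients of `Q`: it amounts to `2 b = Q' (x - m) - 2 (1 - b₂) Q`,
so that `τ - b(G)` becomes `LQ / λ` plus a multiple of `Q`. -/
lemma two_mul_sub_pearson (h1 : b₂ ≠ 1 / 2) (h2 : b₂ ≠ 1) (t y : ℝ) :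
    2 * (t - (b₂ * (y + m) ^ 2 + b₁ * (y + m) + b₀)) =
      2 * t - (2 * y + shiftedCoeffOne m b₁ b₂) * y + 2 * (1 - b₂) *
        (y ^ 2 + shiftedCoeffOne m b₁ b₂ * y + shiftedCoeffZero m b₀ b₁ b₂) := by
  have h3 : 2 * b₂ - 1 ≠ 0 := fun h => h1 (by linarith)
  have h4 : b₂ - 1 ≠ 0 := sub_ne_zero.2 h2
  rw [shiftedCoeffOne, shiftedCoeffZero]
  field_simp
  ring

variable {E : Type*} [MeasurableSpace E] {μ : Measure E} [IsProbabilityMeasure μ] {F τ : E → ℝ}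

lemma IsSteinKernel.integrable_pearsonQ_sq (h : IsSteinKernel μ F τ) :
    Integrable (fun x => (pearsonQ m b₀ b₁ b₂).eval (F x + m) ^ 2) μ := by
  simp_rw [pearsonQ_eval]
  have := h.memLp_quadratic 1 (shiftedCoeffOne m b₁ b₂) (shiftedCoeffZero m b₀ b₁ b₂)
  simp only [one_mul] at this
  exact this.integrable_sq

lemma IsSteinKernel.integrable_cube_mul (h : IsSteinKernel μ F τ) (q : ℝ) :
    Integrable (fun x => (2 * F x + q) ^ 3 * F x) μ := by
  have h1 := (h.memLp_quadratic 4 (4 * q) (q ^ 2)).integrable_mul (h.memLp_quadratic 2 q 0)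
  refine h1.congr (.of_forall fun x => ?_)
  simp only [Pi.mul_apply]
  ring

lemma IsSteinKernel.integrable_pearsonU (h : IsSteinKernel μ F τ) :
    Integrable (fun x => (pearsonU m b₀ b₁ b₂).eval (F x + m)) μ := by
  have h1 := h.integrable_pearsonQ_sq (m := m) (b₀ := b₀) (b₁ := b₁) (b₂ := b₂)
  simp_rw [pearsonQ_eval] at h1
  simp_rw [pearsonU_eval]
  exact (h1.const_mul _).sub ((h.integrable_cube_mul _).const_mul _)

/-- The squared distance of the Stein kernel of `F` to the diffusion coefficient `b (F + m)`
is controlled by the polynomials `U` and `Q`. -/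
lemma IsSteinKernel.integral_sub_pearson_sq_le (h : IsSteinKernel μ F τ) {η : ℝ}
    (h1 : b₂ ≠ 1 / 2) (h2 : b₂ ≠ 1)
    (hspec : ∫ x, (2 * τ x - (2 * F x + shiftedCoeffOne m b₁ b₂) * F x) *
        (2 * τ x - (2 * F x + shiftedCoeffOne m b₁ b₂) * F x +
          η * (F x ^ 2 + shiftedCoeffOne m b₁ b₂ * F x + shiftedCoeffZero m b₀ b₁ b₂)) ∂μ ≤ 0) :
    ∫ x, (τ x - (b₂ * (F x + m) ^ 2 + b₁ * (F x + m) + b₀)) ^ 2 ∂μ ≤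
      2 * (1 - b₂ - η / 4) * ∫ x, (pearsonU m b₀ b₁ b₂).eval (F x + m) ∂μ +
        (η - 2 * (1 - b₂)) * (1 - b₂) / 2 *
          ∫ x, (pearsonQ m b₀ b₁ b₂).eval (F x + m) ^ 2 ∂μ := by
  -- The value of `a` is the coefficient of `Q` in `two_mul_sub_pearson`.
  have h3 := h.integral_sub_sq_le hspec (2 * (1 - b₂))
  simp_rw [← two_mul_sub_pearson h1 h2, mul_pow] at h3
  rw [integral_const_mul] at h3
  have i1 := h.integrable_pearsonQ_sq (m := m) (b₀ := b₀) (b₁ := b₁) (b₂ := b₂)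
  simp_rw [pearsonQ_eval] at i1
  simp_rw [pearsonU_eval, pearsonQ_eval]
  rw [integral_sub (i1.const_mul _) ((h.integrable_cube_mul _).const_mul _), integral_const_mul,
    integral_const_mul]
  linarith

end Pearson

/-! ### An association inequality for Lipschitz functions. -/

section Association

variable {ν : Measure ℝ} [IsProbabilityMeasure ν]

lemma exists_eq_zero_of_integral_eq_zero {φ : ℝ → ℝ} (hφ : Continuous φ) (hi : Integrable φ ν)
    (h0 : ∫ x, φ x ∂ν = 0) : ∃ c, φ c = 0 := by
  by_contra! hne
  have pos_of (ψ : ℝ → ℝ) (hψ : ∀ x, 0 < ψ x) (hψi : Integrable ψ ν) (hψ0 : ∫ x, ψ x ∂ν = 0) :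
      False := by
    have h1 := (integral_eq_zero_iff_of_nonneg (fun x => (hψ x).le) hψi).1 hψ0
    obtain ⟨x, hx⟩ := h1.exists
    exact (hψ x).ne' hx
  have h1 : ∀ x y, 0 < φ x → φ y < 0 → False := by
    intro x y hx hy
    obtain ⟨c, hc⟩ := mem_range_of_exists_le_of_exists_ge hφ ⟨y, hy.le⟩ ⟨x, hx.le⟩
    exact hne c hc
  rcases lt_or_gt_of_ne (hne 0) with h2 | h2
  · refine pos_of (fun x => -φ x) (fun x => ?_) hi.neg (by rw [integral_neg, h0, neg_zero])
    rcases lt_or_gt_of_ne (hne x) with h3 | h3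
    · linarith
    · exact (h1 x 0 h3 h2).elim
  · refine pos_of φ (fun x => ?_) hi h0
    rcases lt_or_gt_of_ne (hne x) with h3 | h3
    · exact (h1 0 x h2 h3).elim
    · exact h3

/-- Chebyshev's association inequality for an increasing centred function. -/
lemma integral_mul_nonpos_of_antitone {φ ψ : ℝ → ℝ} (hφ : Continuous φ) (hmono : Monotone φ)
    (hanti : Antitone ψ) (hi : Integrable φ ν) (hψφ : Integrable (fun x => ψ x * φ x) ν)
    (h0 : ∫ x, φ x ∂ν = 0) : ∫ x, ψ x * φ x ∂ν ≤ 0 := by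
  obtain ⟨c, hc⟩ := exists_eq_zero_of_integral_eq_zero hφ hi h0
  have h1 : ∫ x, ψ x * φ x ∂ν = ∫ x, (ψ x - ψ c) * φ x ∂ν := by
    simp_rw [sub_mul]
    rw [integral_sub hψφ (hi.const_mul _), integral_const_mul, h0, mul_zero, sub_zero]
  rw [h1]
  refine integral_nonpos fun x => ?_
  rcases le_total x c with hx | hx
  · have h2 := hanti hx
    have h3 := hmono hx
    rw [hc] at h3
    exact mul_nonpos_of_nonneg_of_nonpos (sub_nonneg.2 h2) h3
  · have h2 := hanti hx
    have h3 := hmono hx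
    rw [hc] at h3
    exact mul_nonpos_of_nonpos_of_nonneg (sub_nonpos.2 h2) h3

variable {m K : ℝ} {h : ℝ → ℝ}

/-- Both `h + K (x - m)` and `-h + K (x - m)` are nondecreasing and centred, so the association
inequality applies to each. -/
lemma abs_integral_mul_le_of_antitone (hν2 : Integrable (fun x : ℝ => x) ν) (hm : ∫ x, x ∂ν = m)
    (hh : ∀ x y, |h x - h y| ≤ K * |x - y|) (hc : Continuous h) (hi : Integrable h ν)
    (h0 : ∫ x, h x ∂ν = 0) {ψ : ℝ → ℝ} (hanti : Antitone ψ)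
    (hψ : Integrable (fun x => ψ x * h x) ν) (hψ' : Integrable (fun x => ψ x * (m - x)) ν) :
    |∫ x, ψ x * h x ∂ν| ≤ K * ∫ x, ψ x * (m - x) ∂ν := by
  have hlin : Integrable (fun x => K * (x - m)) ν := (hν2.sub (integrable_const m)).const_mul K
  have hlin0 : ∫ x, K * (x - m) ∂ν = 0 := by
    rw [integral_const_mul, integral_sub hν2 (integrable_const m), hm]
    simp
  have key (σ : ℝ) (hσ : |σ| = 1) : σ * ∫ x, ψ x * h x ∂ν ≤ K * ∫ x, ψ x * (m - x) ∂ν := by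
    have hi1 : Integrable (fun x => σ * h x) ν := hi.const_mul σ
    have j1 : Integrable (fun x => σ * (ψ x * h x)) ν := hψ.const_mul σ
    have j2 : Integrable (fun x => K * (ψ x * (m - x))) ν := hψ'.const_mul K
    have e : (fun x => ψ x * (σ * h x + K * (x - m))) =
        fun x => σ * (ψ x * h x) - K * (ψ x * (m - x)) := by funext x; ring
    have h1 := integral_mul_nonpos_of_antitone (ν := ν) (φ := fun x => σ * h x + K * (x - m))
      (ψ := ψ) (by fun_prop) ?_ hanti (hi1.add hlin) (by rw [e]; exact j1.sub j2)
      (by rw [integral_add hi1 hlin, hlin0, integral_const_mul, h0]; simp)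
    · rw [e, integral_sub j1 j2, integral_const_mul, integral_const_mul] at h1
      linarith
    · intro x y hxy
      have h2 := hh x y
      have h3 : |σ * (h x - h y)| ≤ K * |x - y| := by rw [abs_mul, hσ, one_mul]; exact h2
      rw [abs_of_nonpos (sub_nonpos.2 hxy)] at h3
      have := (abs_le.1 h3).2
      beta_reduce
      linarith
  refine abs_le'.2 ⟨by simpa using key 1 (by simp), by simpa using key (-1) (by simp)⟩

end Association

/-! ### Density and tail function of a Pearson distribution. -/

/-- A Pearson distribution with an explicit density. -/
structure PearsonDensity (m b₀ b₁ b₂ : ℝ) (ν : Measure ℝ) (l u : EReal) (p : ℝ → ℝ) : Prop where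
  prob : IsProbabilityMeasure ν
  integrable_sq : Integrable (fun x : ℝ => x ^ 2) ν
  mean : ∫ x, x ∂ν = m
  lt : l < u
  measurable : Measurable p
  pos : ∀ x : ℝ, l < x → x < u → 0 < p x
  zero : ∀ x : ℝ, ¬(l < x ∧ x < u) → p x = 0
  eq_withDensity : ν = volume.withDensity (fun x => ENNReal.ofReal (p x))
  diffusion : ∀ x : ℝ, l < x → x < u →
    b₂ * x ^ 2 + b₁ * x + b₀ = -(∫ y in Set.Iic x, (y - m) * p y) / p x

namespace PearsonDensity

variable {m b₀ b₁ b₂ : ℝ} {ν : Measure ℝ} {l u : EReal} {p : ℝ → ℝ}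

lemma nonneg (H : PearsonDensity m b₀ b₁ b₂ ν l u p) (x : ℝ) : 0 ≤ p x := by
  by_cases hx : l < x ∧ x < u
  · exact (H.pos x hx.1 hx.2).le
  · exact (H.zero x hx).ge

lemma integrable_id (H : PearsonDensity m b₀ b₁ b₂ ν l u p) : Integrable (fun x : ℝ => x) ν := by
  have := H.prob
  exact ((memLp_two_iff_integrable_sq (by fun_prop)).2 H.integrable_sq).integrable one_le_two

lemma ae_mem (H : PearsonDensity m b₀ b₁ b₂ ν l u p) : ∀ᵐ x : ℝ ∂ν, l < x ∧ x < u := by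
  rw [H.eq_withDensity, ae_withDensity_iff (by have := H.measurable; fun_prop)]
  refine .of_forall fun x hx => ?_
  by_contra h
  exact hx (by rw [H.zero x h, ENNReal.ofReal_zero])

lemma setIntegral_eq (H : PearsonDensity m b₀ b₁ b₂ ν l u p) (φ : ℝ → ℝ) {s : Set ℝ}
    (hs : MeasurableSet s) : ∫ x in s, φ x ∂ν = ∫ x in s, φ x * p x := by
  have hp := H.measurable
  rw [H.eq_withDensity, restrict_withDensity hs,
    integral_withDensity_eq_integral_toReal_smul (by fun_prop) (by simp)]
  refine integral_congr_ae (.of_forall fun x => ?_)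
  simp only [smul_eq_mul]
  rw [ENNReal.toReal_ofReal (H.nonneg x), mul_comm]

lemma integrable_iff (H : PearsonDensity m b₀ b₁ b₂ ν l u p) (φ : ℝ → ℝ) :
    Integrable φ ν ↔ Integrable fun x => φ x * p x := by
  have hp := H.measurable
  rw [H.eq_withDensity, integrable_withDensity_iff (by fun_prop) (by simp)]
  refine integrable_congr (.of_forall fun x => ?_)
  beta_reduce
  rw [ENNReal.toReal_ofReal (H.nonneg x)]

/-- The tail function `s (x) = ∫_{-∞}^x (m - y) dν`. -/
noncomputable def tail (m : ℝ) (ν : Measure ℝ) (x : ℝ) : ℝ := ∫ y in Set.Iic x, (m - y) ∂ν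

lemma integrable_sub (H : PearsonDensity m b₀ b₁ b₂ ν l u p) :
    Integrable (fun x : ℝ => m - x) ν := by
  have := H.prob
  exact (integrable_const m).sub H.integrable_id

lemma integral_sub_eq_zero (H : PearsonDensity m b₀ b₁ b₂ ν l u p) : ∫ x, (m - x) ∂ν = 0 := by
  have := H.prob
  rw [integral_sub (integrable_const m) H.integrable_id, H.mean]
  simp

lemma diffusion_mul (H : PearsonDensity m b₀ b₁ b₂ ν l u p) {x : ℝ} (hl : l < x) (hu : x < u) :
    (b₂ * x ^ 2 + b₁ * x + b₀) * p x = tail m ν x := by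
  rw [H.diffusion x hl hu, div_mul_cancel₀ _ (H.pos x hl hu).ne', tail,
    H.setIntegral_eq _ measurableSet_Iic, ← integral_neg]
  congr 1; funext y; ring

lemma measure_Ioo_pos (H : PearsonDensity m b₀ b₁ b₂ ν l u p) {a b : ℝ} (ha : l < a) (hb : b < u)
    (hab : a < b) : 0 < ν (Set.Ioo a b) := by
  have hp := H.measurable
  rw [pos_iff_ne_zero, H.eq_withDensity, withDensity_apply _ measurableSet_Ioo]
  intro h0
  rw [lintegral_eq_zero_iff (by fun_prop)] at h0
  have h1 : ∀ᵐ x : ℝ ∂(volume.restrict (Set.Ioo a b)), False := by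
    filter_upwards [h0, ae_restrict_mem measurableSet_Ioo] with x h2 hx
    have h3 := H.pos x (ha.trans (EReal.coe_lt_coe_iff.2 hx.1))
      ((EReal.coe_lt_coe_iff.2 hx.2).trans hb)
    rw [Pi.zero_apply, ENNReal.ofReal_eq_zero] at h2
    linarith
  have h2 := Filter.eventually_false_iff_eq_bot.1 h1
  rw [ae_eq_bot, Measure.restrict_eq_zero, Real.volume_Ioo, ENNReal.ofReal_eq_zero] at h2
  linarith

lemma exists_between_left {x : ℝ} (hx : l < x) : ∃ a : ℝ, l < a ∧ a < x := by
  obtain ⟨a, h1, h2⟩ := EReal.lt_iff_exists_real_btwn.1 hx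
  exact ⟨a, h1, EReal.coe_lt_coe_iff.1 h2⟩

lemma exists_between_right {x : ℝ} (hx : x < u) : ∃ a : ℝ, x < a ∧ a < u := by
  obtain ⟨a, h1, h2⟩ := EReal.lt_iff_exists_real_btwn.1 hx
  exact ⟨a, EReal.coe_lt_coe_iff.1 h1, h2⟩

lemma tail_eq_Ioi (H : PearsonDensity m b₀ b₁ b₂ ν l u p) (x : ℝ) :
    tail m ν x = ∫ y in Set.Ioi x, (y - m) ∂ν := by
  have h1 := integral_add_compl (measurableSet_Iic (a := x)) H.integrable_sub
  rw [H.integral_sub_eq_zero, Set.compl_Iic] at h1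
  have h2 : ∫ y in Set.Ioi x, (y - m) ∂ν = -∫ y in Set.Ioi x, (m - y) ∂ν := by
    rw [← integral_neg]; congr 1; funext y; ring
  rw [h2, tail]
  linarith

lemma setIntegral_pos (H : PearsonDensity m b₀ b₁ b₂ ν l u p) {φ : ℝ → ℝ} (hφ : Integrable φ ν)
    {s : Set ℝ} (hs : MeasurableSet s) (h0 : ∀ x ∈ s, 0 ≤ φ x) {a b : ℝ} (ha : l < a) (hb : b < u)
    (hab : a < b) (hsub : Set.Ioo a b ⊆ s) (hpos : ∀ x ∈ Set.Ioo a b, 0 < φ x) :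
    0 < ∫ x in s, φ x ∂ν := by
  have hnn : 0 ≤ᵐ[ν.restrict s] φ := (ae_restrict_iff' hs).2 (.of_forall h0)
  refine (integral_nonneg_of_ae hnn).lt_of_ne fun h => ?_
  have h1 := (integral_eq_zero_iff_of_nonneg_ae hnn hφ.integrableOn).1 h.symm
  have h2 : ∀ᵐ x ∂(ν.restrict (Set.Ioo a b)), False := by
    filter_upwards [ae_mono (Measure.restrict_mono hsub le_rfl) h1,
      ae_restrict_mem measurableSet_Ioo] with x h3 h4
    exact (hpos x h4).ne' h3
  have h3 := Filter.eventually_false_iff_eq_bot.1 h2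
  rw [ae_eq_bot, Measure.restrict_eq_zero] at h3
  exact (H.measure_Ioo_pos ha hb hab).ne' h3

/-- To the left of the mean the integrand is non-negative; to the right, centring replaces the
integral by that of `y - m` over the opposite tail. -/
lemma tail_pos (H : PearsonDensity m b₀ b₁ b₂ ν l u p) {x : ℝ} (hl : l < x) (hu : x < u) :
    0 < tail m ν x := by
  rcases le_total x m with hx | hx
  · obtain ⟨a, ha, hax⟩ := exists_between_left hl
    refine H.setIntegral_pos H.integrable_sub measurableSet_Iic
      (fun y hy => sub_nonneg.2 (le_trans hy hx)) ha hu hax (fun y hy => hy.2.le)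
      fun y hy => sub_pos.2 (hy.2.trans_le hx)
  · obtain ⟨a, hax, ha⟩ := exists_between_right hu
    rw [H.tail_eq_Ioi]
    have hi : Integrable (fun y : ℝ => y - m) ν := by
      refine H.integrable_sub.neg.congr (.of_forall fun y => ?_)
      simp
    refine H.setIntegral_pos hi measurableSet_Ioi
      (fun y hy => sub_nonneg.2 (hx.trans (le_of_lt hy))) hl ha hax (fun y hy => hy.1)
      fun y hy => sub_pos.2 (hx.trans_lt hy.1)

lemma coeff_pos (H : PearsonDensity m b₀ b₁ b₂ ν l u p) {x : ℝ} (hl : l < x) (hu : x < u) :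
    0 < b₂ * x ^ 2 + b₁ * x + b₀ := by
  have h1 := H.tail_pos hl hu
  rw [← H.diffusion_mul hl hu] at h1
  exact pos_of_mul_pos_left h1 (H.pos x hl hu).le

/-- The interval of the distribution. -/
def support (l u : EReal) : Set ℝ := {x : ℝ | l < x ∧ x < u}

lemma isOpen_support : IsOpen (support l u) :=
  (isOpen_lt continuous_const continuous_coe_real_ereal).inter
    (isOpen_lt continuous_coe_real_ereal continuous_const)

lemma ordConnected_support : (support l u).OrdConnected :=
  ⟨fun _ hx _ hy _ hz => ⟨hx.1.trans_le (EReal.coe_le_coe_iff.2 hz.1),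
    (EReal.coe_le_coe_iff.2 hz.2).trans_lt hy.2⟩⟩

lemma continuous_setIntegral_Iic (H : PearsonDensity m b₀ b₁ b₂ ν l u p) {φ : ℝ → ℝ}
    (hi : Integrable φ ν) : Continuous fun x => ∫ y in Set.Iic x, φ y ∂ν := by
  have hi' := (H.integrable_iff φ).1 hi
  have h1 (x : ℝ) : ∫ y in Set.Iic x, φ y ∂ν =
      (∫ y in Set.Iic (0 : ℝ), φ y * p y) + ∫ y in (0 : ℝ)..x, φ y * p y := by
    rw [H.setIntegral_eq φ measurableSet_Iic,
      ← intervalIntegral.integral_Iic_sub_Iic hi'.integrableOn hi'.integrableOn]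
    ring
  simp_rw [h1]
  exact continuous_const.add
    (intervalIntegral.continuous_primitive (fun a b => hi'.intervalIntegrable) 0)

/-- `p` is only assumed measurable, but on the interval it equals `tail / b`, a continuous function.
-/
lemma continuousAt_density (H : PearsonDensity m b₀ b₁ b₂ ν l u p) {x : ℝ}
    (hx : x ∈ support l u) : ContinuousAt p x := by
  have h1 : ContinuousAt (fun x => tail m ν x / (b₂ * x ^ 2 + b₁ * x + b₀)) x :=
    (H.continuous_setIntegral_Iic H.integrable_sub).continuousAt.div (by fun_prop)
      (H.coeff_pos hx.1 hx.2).ne'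
  refine h1.congr ?_
  filter_upwards [isOpen_support.mem_nhds hx] with y hy
  rw [← H.diffusion_mul hy.1 hy.2, mul_div_cancel_left₀ _ (H.coeff_pos hy.1 hy.2).ne']

lemma hasDerivAt_setIntegral_Iic (H : PearsonDensity m b₀ b₁ b₂ ν l u p) {φ : ℝ → ℝ}
    (hφ : Continuous φ) (hi : Integrable φ ν) {x : ℝ} (hx : x ∈ support l u) :
    HasDerivAt (fun x => ∫ y in Set.Iic x, φ y ∂ν) (φ x * p x) x := by
  have hi' := (H.integrable_iff φ).1 hi
  have h1 (x : ℝ) : ∫ y in Set.Iic x, φ y ∂ν =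
      (∫ y in Set.Iic (0 : ℝ), φ y * p y) + ∫ y in (0 : ℝ)..x, φ y * p y := by
    rw [H.setIntegral_eq φ measurableSet_Iic,
      ← intervalIntegral.integral_Iic_sub_Iic hi'.integrableOn hi'.integrableOn]
    ring
  simp_rw [h1]
  refine HasDerivAt.const_add _ (intervalIntegral.integral_hasDerivAt_right
    hi'.intervalIntegrable ?_ (hφ.continuousAt.mul (H.continuousAt_density hx)))
  exact (hφ.measurable.mul H.measurable).stronglyMeasurable.stronglyMeasurableAtFilter

lemma hasDerivAt_tail (H : PearsonDensity m b₀ b₁ b₂ ν l u p) {x : ℝ} (hx : x ∈ support l u) :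
    HasDerivAt (tail m ν) ((m - x) * p x) x :=
  H.hasDerivAt_setIntegral_Iic (by fun_prop) H.integrable_sub hx

/-- Mass near the left endpoint is small. -/
lemma exists_setIntegral_lt (H : PearsonDensity m b₀ b₁ b₂ ν l u p) {ψ : ℝ → ℝ}
    (hψ : Integrable ψ ν) {x ε : ℝ} (hx : l < x) (hε : 0 < ε) :
    ∃ y : ℝ, l < y ∧ y < x ∧ ∫ t in Set.Iic y, ψ t ∂ν < ε := by
  obtain ⟨v, hv, hvm, hlim⟩ := exists_seq_strictAnti_tendsto' hx
  have hvr (n : ℕ) : ((v n).toReal : EReal) = v n :=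
    EReal.coe_toReal (ne_top_of_lt (hvm n).2) (ne_bot_of_gt (hvm n).1)
  have h1 : Tendsto (fun n => ∫ t in Set.Iic (v n).toReal, ψ t ∂ν) atTop
      (𝓝 (∫ t in ⋂ n, Set.Iic (v n).toReal, ψ t ∂ν)) := by
    refine tendsto_setIntegral_of_antitone (fun _ => measurableSet_Iic) (fun i j hij => ?_)
      ⟨0, hψ.integrableOn⟩
    refine Set.Iic_subset_Iic.2 (EReal.coe_le_coe_iff.1 ?_)
    rw [hvr, hvr]
    exact hv.antitone hij
  have h2 : ν (⋂ n, Set.Iic (v n).toReal) = 0 := by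
    refine measure_mono_null (fun t ht => ?_) (ae_iff.1 H.ae_mem)
    simp only [Set.mem_iInter, Set.mem_Iic] at ht
    refine fun h => (h.1).not_ge (ge_of_tendsto' hlim fun n => ?_)
    rw [← hvr]
    exact EReal.coe_le_coe_iff.2 (ht n)
  rw [setIntegral_measure_zero _ h2] at h1
  obtain ⟨n, hn⟩ := (h1.eventually (gt_mem_nhds hε)).exists
  refine ⟨(v n).toReal, ?_, ?_, hn⟩
  · rw [hvr]; exact (hvm n).1
  · rw [← EReal.coe_lt_coe_iff, hvr]; exact (hvm n).2

/-- Reflection of a Pearson distribution. -/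
lemma reflect (H : PearsonDensity m b₀ b₁ b₂ ν l u p) :
    PearsonDensity (-m) b₀ (-b₁) b₂ (ν.map Neg.neg) (-u) (-l) (fun x => p (-x)) where
  prob := by
    have := H.prob
    exact Measure.isProbabilityMeasure_map (by fun_prop)
  integrable_sq := by
    rw [integrable_map_measure (by fun_prop) (by fun_prop)]
    refine H.integrable_sq.congr (.of_forall fun x => ?_)
    simp
  mean := by
    rw [integral_map (by fun_prop) (by fun_prop), integral_neg, H.mean]
  lt := EReal.neg_lt_neg_iff.2 H.lt
  measurable := H.measurable.comp measurable_neg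
  pos x h1 h2 := H.pos _ (by rw [EReal.coe_neg]; exact EReal.lt_neg_comm.1 h2)
    (by rw [EReal.coe_neg]; exact EReal.neg_lt_comm.1 h1)
  zero x h := H.zero _ fun h' => h ⟨by
    have := h'.2
    rw [EReal.coe_neg] at this
    exact EReal.neg_lt_comm.1 this, by
    have := h'.1
    rw [EReal.coe_neg] at this
    exact EReal.lt_neg_comm.1 this⟩
  eq_withDensity := by
    have hp := H.measurable
    ext s hs
    rw [Measure.map_apply measurable_neg hs, H.eq_withDensity,
      withDensity_apply _ (measurable_neg hs), withDensity_apply _ hs]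
    have := (Measure.measurePreserving_neg (volume : Measure ℝ)).setLIntegral_comp_preimage hs
      (f := fun x => ENNReal.ofReal (p (-x))) (by fun_prop)
    rw [← this]
    simp
  diffusion x h1 h2 := by
    have h3 := H.diffusion (-x) (by rw [EReal.coe_neg]; exact EReal.lt_neg_comm.1 h2)
      (by rw [EReal.coe_neg]; exact EReal.neg_lt_comm.1 h1)
    -- Reflection exchanges the two tails, whose integrals agree because the law is centred at `m`.
    have h4 : ∫ y in Set.Iic x, (y - -m) * p (-y) = ∫ y in Set.Iic (-x), (y - m) * p y := by
      have e1 := H.tail_eq_Ioi (-x)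
      rw [tail, H.setIntegral_eq _ measurableSet_Iic, H.setIntegral_eq _ measurableSet_Ioi] at e1
      have e2 := integral_comp_neg_Iic x (fun y => (m - y) * p y)
      have e3 : ∫ y in Set.Iic x, (y - -m) * p (-y) = ∫ y in Set.Iic x, (m - -y) * p (-y) := by
        congr 1; funext y; ring
      have e4 : ∫ y in Set.Ioi (-x), (m - y) * p y = -∫ y in Set.Ioi (-x), (y - m) * p y := by
        rw [← integral_neg]; congr 1; funext y; ring
      have e5 : ∫ y in Set.Iic (-x), (y - m) * p y = -∫ y in Set.Iic (-x), (m - y) * p y := by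
        rw [← integral_neg]; congr 1; funext y; ring
      rw [e3, e2, e4, ← e1, e5]
    rw [h4, ← h3]
    ring

end PearsonDensity

lemma continuous_of_abs_sub_le {h : ℝ → ℝ} {K : ℝ} (hh : ∀ x y, |h x - h y| ≤ K * |x - y|) :
    Continuous h := by
  have hK : 0 ≤ K := by
    have := (abs_nonneg _).trans (hh 1 0)
    simpa using this
  refine (LipschitzWith.of_dist_le_mul (K := K.toNNReal) fun x y => ?_).continuous
  rw [Real.coe_toNNReal _ hK]
  exact hh x y

lemma nonneg_of_abs_sub_le {h : ℝ → ℝ} {K : ℝ} (hh : ∀ x y, |h x - h y| ≤ K * |x - y|) :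
    0 ≤ K := by
  have := (abs_nonneg _).trans (hh 1 0)
  simpa using this

/-! ### The diffusion coefficient and iterated tails near the endpoints. -/

namespace PearsonDensity

variable {m b₀ b₁ b₂ : ℝ} {ν : Measure ℝ} {l u : EReal} {p : ℝ → ℝ}

lemma memLp_id (H : PearsonDensity m b₀ b₁ b₂ ν l u p) : MemLp (fun x : ℝ => x) 2 ν :=
  (memLp_two_iff_integrable_sq (by fun_prop)).2 H.integrable_sq

lemma memLp_of_abs_sub_le (H : PearsonDensity m b₀ b₁ b₂ ν l u p) {h : ℝ → ℝ} {K : ℝ}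
    (hh : ∀ x y, |h x - h y| ≤ K * |x - y|) : MemLp h 2 ν := by
  have := H.prob
  have j₁ : MemLp (fun x : ℝ => K * |x|) 2 ν := H.memLp_id.abs.const_mul K
  have j₂ : MemLp (fun x : ℝ => |h 0| + K * |x|) 2 ν := (memLp_const |h 0|).add j₁
  refine j₂.of_le (continuous_of_abs_sub_le hh).aestronglyMeasurable (.of_forall fun x => ?_)
  have h1 := hh x 0
  rw [sub_zero] at h1
  have h2 := abs_sub_abs_le_abs_sub (h x) (h 0)
  rw [Real.norm_eq_abs, Real.norm_eq_abs]
  exact le_trans (by linarith) (le_abs_self _)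

lemma exists_mem_support (H : PearsonDensity m b₀ b₁ b₂ ν l u p) : ∃ x, x ∈ support l u := by
  obtain ⟨a, h1, h2⟩ := EReal.lt_iff_exists_real_btwn.1 H.lt
  exact ⟨a, h1, h2⟩

lemma left_lt_mean (H : PearsonDensity m b₀ b₁ b₂ ν l u p) : l < m := by
  by_contra! hm
  obtain ⟨x, hx⟩ := H.exists_mem_support
  refine (H.tail_pos hx.1 hx.2).not_ge (integral_nonpos_of_ae ?_)
  filter_upwards [ae_restrict_of_ae H.ae_mem] with y hy
  have := EReal.coe_lt_coe_iff.1 (hm.trans_lt hy.1)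
  rw [Pi.zero_apply]
  linarith

/-- A Gronwall argument. If `b a > 0`, then `p = tail / b` gives `tail' = (m - x) p ≤ M * tail` near
`a`, so `tail * exp (-M x)` is nonincreasing there. But it is positive and arbitrarily small near
`a`, a contradiction. -/
lemma coeff_left_eq_zero {a : ℝ} (H : PearsonDensity m b₀ b₁ b₂ ν a u p) :
    b₂ * a ^ 2 + b₁ * a + b₀ = 0 := by
  set β : ℝ → ℝ := fun x => b₂ * x ^ 2 + b₁ * x + b₀ with hβ
  have hβc : Continuous β := by fun_prop
  obtain ⟨x₀, hx₀⟩ := H.exists_mem_support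
  have hax₀ : a < x₀ := EReal.coe_lt_coe_iff.1 hx₀.1
  have hmem {x : ℝ} (h1 : a < x) (h2 : x ≤ x₀) : x ∈ support a u :=
    ⟨EReal.coe_lt_coe_iff.2 h1, (EReal.coe_le_coe_iff.2 h2).trans_lt hx₀.2⟩
  have h0 : 0 ≤ β a := by
    refine ge_of_tendsto (hβc.continuousWithinAt (s := Set.Ioi a)) ?_
    filter_upwards [Ioo_mem_nhdsGT hax₀] with x hx
    exact (H.coeff_pos (hmem hx.1 hx.2.le).1 (hmem hx.1 hx.2.le).2).le
  refine le_antisymm (not_lt.1 fun hpos => ?_) h0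
  have hpos : 0 < β a := hpos
  obtain ⟨r, har, hr⟩ : ∃ r > a, ∀ x ∈ Set.Ioo a r, β a / 2 < β x := by
    have h1 : ∀ᶠ x in 𝓝[>] a, β a / 2 < β x :=
      (hβc.continuousWithinAt (s := Set.Ioi a)).eventually (lt_mem_nhds (by linarith))
    exact (mem_nhdsGT_iff_exists_Ioo_subset).1 h1
  have ham : a < m := EReal.coe_lt_coe_iff.1 H.left_lt_mean
  -- The factor 2 compensates for `b > b a / 2` near `a`.
  set M := 2 * (m - a) / β a with hM
  have hM0 : 0 < M := by rw [hM]; exact div_pos (by linarith) hpos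
  set r' := min r x₀ with hr'
  have har' : a < r' := lt_min har hax₀
  have hder (x : ℝ) (hx : x ∈ Set.Ioo a r') : HasDerivAt (fun x => tail m ν x * Real.exp (-M * x))
      ((m - x) * p x * Real.exp (-M * x) + tail m ν x * (Real.exp (-M * x) * -M)) x := by
    have h1 := H.hasDerivAt_tail (hmem hx.1 (hx.2.le.trans (min_le_right _ _)))
    have h2 : HasDerivAt (fun x => Real.exp (-M * x)) (Real.exp (-M * x) * -M) x := by
      simpa using ((hasDerivAt_id x).const_mul (-M)).exp
    exact h1.mul h2
  have hanti : AntitoneOn (fun x => tail m ν x * Real.exp (-M * x)) (Set.Ioo a r') := by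
    refine antitoneOn_of_deriv_nonpos (convex_Ioo _ _)
      (fun x hx => (hder x hx).continuousAt.continuousWithinAt)
      (fun x hx => ?_) fun x hx => ?_
    · rw [interior_Ioo] at hx
      exact (hder x hx).differentiableAt.differentiableWithinAt
    · rw [interior_Ioo] at hx
      rw [(hder x hx).deriv]
      have hx' := hmem hx.1 (hx.2.le.trans (min_le_right _ _))
      have h1 := H.diffusion_mul hx'.1 hx'.2
      have h2 : β a / 2 < β x := hr x ⟨hx.1, hx.2.trans_le (min_le_left _ _)⟩
      have h3 : (m - x) * p x ≤ M * tail m ν x := by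
        have h4 := H.pos x hx'.1 hx'.2
        have h5 : (m - a) * p x ≤ M * (β x * p x) := by
          rw [hM, div_mul_eq_mul_div, le_div_iff₀ hpos]
          have : (m - a) * p x * (β a) ≤ (m - a) * p x * (2 * β x) :=
            mul_le_mul_of_nonneg_left (by linarith) (mul_nonneg (by linarith) h4.le)
          linarith
        have h6 : (m - x) * p x ≤ (m - a) * p x :=
          mul_le_mul_of_nonneg_right (by linarith [hx.1]) h4.le
        rw [← h1]
        exact h6.trans h5
      nlinarith [Real.exp_pos (-M * x)]
  obtain ⟨x, hxa, hxr⟩ := exists_between har'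
  have hx := hmem hxa (hxr.le.trans (min_le_right _ _))
  have hs := H.tail_pos hx.1 hx.2
  have hε : 0 < tail m ν x * Real.exp (-M * x) / Real.exp (-M * a) := by positivity
  obtain ⟨y, hya, hyx, hy⟩ := H.exists_setIntegral_lt H.integrable_sub hx.1 hε
  have hya' := EReal.coe_lt_coe_iff.1 hya
  have h1 := hanti ⟨hya', hyx.trans hxr⟩ ⟨hxa, hxr⟩ hyx.le
  beta_reduce at h1
  rw [lt_div_iff₀ (Real.exp_pos _)] at hy
  have h2 : Real.exp (-M * y) ≤ Real.exp (-M * a) := by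
    rw [Real.exp_le_exp]; nlinarith
  have h3 : 0 ≤ tail m ν y :=
    (H.tail_pos hya ((EReal.coe_lt_coe_iff.2 hyx).trans hx.2)).le
  have h4 := mul_le_mul_of_nonneg_left h2 h3
  have h5 : (∫ t in Set.Iic y, (m - t) ∂ν) = tail m ν y := rfl
  rw [h5] at hy
  linarith

lemma deriv_coeff_left_nonneg {a : ℝ} (H : PearsonDensity m b₀ b₁ b₂ ν a u p) :
    0 ≤ 2 * b₂ * a + b₁ := by
  have h0 := H.coeff_left_eq_zero
  obtain ⟨x₀, hx₀⟩ := H.exists_mem_support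
  have hax₀ : a < x₀ := EReal.coe_lt_coe_iff.1 hx₀.1
  have hc : Continuous fun x => b₂ * (x + a) + b₁ := by fun_prop
  have e : 2 * b₂ * a + b₁ = b₂ * (a + a) + b₁ := by ring
  rw [e]
  refine ge_of_tendsto (hc.continuousWithinAt (s := Set.Ioi a)) ?_
  filter_upwards [Ioo_mem_nhdsGT hax₀] with x hx
  have h1 := H.coeff_pos (EReal.coe_lt_coe_iff.2 hx.1)
    ((EReal.coe_lt_coe_iff.2 hx.2).trans hx₀.2)
  have h2 : b₂ * x ^ 2 + b₁ * x + b₀ = (x - a) * (b₂ * (x + a) + b₁) := by linear_combination h0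
  rw [h2] at h1
  exact (pos_of_mul_pos_right h1 (sub_pos.2 hx.1).le).le

/-- The expression is `b' x + (m - x)`, the logarithmic slope of `tail * b` times `b`. At a finite
endpoint `b' ≥ 0` and `m - a > 0`; at `-∞` it grows because `2 b₂ - 1 < 0`. -/
lemma exists_slope_pos (H : PearsonDensity m b₀ b₁ b₂ ν l u p) (hb : b₂ < 1 / 2) :
    ∃ x ∈ support l u, x ≤ m ∧ 0 < (2 * b₂ - 1) * x + b₁ + m := by
  obtain ⟨x₀, hx₀⟩ := H.exists_mem_support
  induction l with
  | bot =>
    set t := (b₁ + m) / (1 - 2 * b₂) - 1 with ht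
    have h1 : 0 < 1 - 2 * b₂ := by linarith
    refine ⟨min (min x₀ m) t, ⟨EReal.bot_lt_coe _, ?_⟩,
      (min_le_left _ _).trans (min_le_right _ _), ?_⟩
    · exact (EReal.coe_le_coe_iff.2 ((min_le_left _ _).trans (min_le_left _ _))).trans_lt hx₀.2
    · have h2 : min (min x₀ m) t ≤ t := min_le_right _ _
      have h3 : (1 - 2 * b₂) * t = b₁ + m - (1 - 2 * b₂) := by rw [ht]; field_simp
      nlinarith
  | top => exact absurd H.lt not_top_lt
  | coe a =>
    have h1 := H.deriv_coeff_left_nonneg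
    have h2 : a < m := EReal.coe_lt_coe_iff.1 H.left_lt_mean
    have hax₀ : a < x₀ := EReal.coe_lt_coe_iff.1 hx₀.1
    have hc : Continuous fun x => (2 * b₂ - 1) * x + b₁ + m := by fun_prop
    have h3 : ∀ᶠ x in 𝓝[>] a, 0 < (2 * b₂ - 1) * x + b₁ + m :=
      (hc.continuousWithinAt (s := Set.Ioi a)).eventually (lt_mem_nhds (by nlinarith))
    have h3' : ∀ᶠ x in 𝓝[>] a, x ∈ Set.Ioo a x₀ := Ioo_mem_nhdsGT hax₀
    have h3'' : ∀ᶠ x in 𝓝[>] a, x ∈ Set.Ioo a m := Ioo_mem_nhdsGT h2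
    obtain ⟨x, h4, h5, h6⟩ := (h3.and (h3'.and h3'')).exists
    exact ⟨x, ⟨EReal.coe_lt_coe_iff.2 h5.1, (EReal.coe_lt_coe_iff.2 h5.2).trans hx₀.2⟩,
      h6.2.le, h4⟩

/-- The iterated tail function. -/
noncomputable def tail₂ (m : ℝ) (ν : Measure ℝ) (x : ℝ) : ℝ :=
  ∫ y in Set.Iic x, (x - y) * (m - y) ∂ν

lemma integrable_mul_sub (H : PearsonDensity m b₀ b₁ b₂ ν l u p) :
    Integrable (fun y : ℝ => y * (m - y)) ν := by
  have := H.prob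
  exact H.memLp_id.integrable_mul ((memLp_const m).sub H.memLp_id)

lemma integrable_sub_mul_sub (H : PearsonDensity m b₀ b₁ b₂ ν l u p) (x : ℝ) :
    Integrable (fun y : ℝ => (x - y) * (m - y)) ν := by
  have := H.prob
  exact ((memLp_const x).sub H.memLp_id).integrable_mul ((memLp_const m).sub H.memLp_id)

lemma tail₂_eq (H : PearsonDensity m b₀ b₁ b₂ ν l u p) (x : ℝ) :
    tail₂ m ν x = x * tail m ν x - ∫ y in Set.Iic x, y * (m - y) ∂ν := by
  rw [tail₂, tail, ← integral_const_mul, ← integral_sub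
    (H.integrable_sub.integrableOn.const_mul x) H.integrable_mul_sub.integrableOn]
  congr 1; funext y; ring

lemma hasDerivAt_tail₂ (H : PearsonDensity m b₀ b₁ b₂ ν l u p) {x : ℝ} (hx : x ∈ support l u) :
    HasDerivAt (tail₂ m ν) (tail m ν x) x := by
  rw [funext H.tail₂_eq]
  have h1 := ((hasDerivAt_id x).mul (H.hasDerivAt_tail hx)).sub
    (H.hasDerivAt_setIntegral_Iic (φ := fun y => y * (m - y)) (by fun_prop)
      H.integrable_mul_sub hx)
  refine h1.congr_deriv ?_
  simp only [id]
  ring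

/-- The difference of the two sides has derivative `tail * ((2 b₂ - 1) x + b₁ + m - c)`, which is
non-negative up to `x₁`, as the slope is decreasing and equals `c` at `x₁`. Near `l` the difference
is bounded below by an arbitrarily small negative number. -/
lemma tail₂_le_mul (H : PearsonDensity m b₀ b₁ b₂ ν l u p) {x₁ : ℝ} (hx₁ : x₁ ∈ support l u)
    (hm : x₁ ≤ m) (hb : b₂ < 1 / 2) {x : ℝ} (hl : l < x) (hx : x ≤ x₁) :
    ((2 * b₂ - 1) * x₁ + b₁ + m) * tail₂ m ν x ≤
      tail m ν x * (b₂ * x ^ 2 + b₁ * x + b₀) := by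
  set c := (2 * b₂ - 1) * x₁ + b₁ + m with hc
  rcases le_or_gt c 0 with hc0 | hc0
  · have h1 : 0 ≤ tail₂ m ν x := by
      refine setIntegral_nonneg measurableSet_Iic fun y hy => ?_
      have hy : y ≤ x := hy
      exact mul_nonneg (by linarith) (by linarith)
    have hxu : (x : EReal) < u := (EReal.coe_le_coe_iff.2 hx).trans_lt hx₁.2
    have := mul_pos (H.tail_pos hl hxu) (H.coeff_pos hl hxu)
    nlinarith
  have hmem {y : ℝ} (h1 : l < y) (h2 : y ≤ x₁) : y ∈ support l u :=
    ⟨h1, (EReal.coe_le_coe_iff.2 h2).trans_lt hx₁.2⟩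
  set Ψ : ℝ → ℝ := fun x => tail m ν x * (b₂ * x ^ 2 + b₁ * x + b₀) - c * tail₂ m ν x with hΨ
  have hder {y : ℝ} (hy : y ∈ support l u) :
      HasDerivAt Ψ (tail m ν y * ((2 * b₂ - 1) * y + b₁ + m - c)) y := by
    have h1 : HasDerivAt (fun x : ℝ => b₂ * x ^ 2 + b₁ * x + b₀) (2 * b₂ * y + b₁) y := by
      have := ((((hasDerivAt_id y).pow 2).const_mul b₂).add
        ((hasDerivAt_id y).const_mul b₁)).add_const b₀
      refine this.congr_deriv ?_
      simp only [id]
      norm_num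
      ring
    refine (((H.hasDerivAt_tail hy).mul h1).sub ((H.hasDerivAt_tail₂ hy).const_mul c)).congr_deriv ?_
    rw [← H.diffusion_mul hy.1 hy.2]
    ring
  suffices h : 0 ≤ Ψ x by rw [hΨ] at h; beta_reduce at h; linarith
  refine le_of_forall_pos_lt_add fun ε hε => ?_
  obtain ⟨y, hly, hyx, hy⟩ := H.exists_setIntegral_lt (ψ := fun t => (m - t) * (m - t))
    (H.integrable_sub_mul_sub m) hl (div_pos hε hc0)
  have h1 : tail₂ m ν y ≤ ∫ t in Set.Iic y, (m - t) * (m - t) ∂ν := by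
    refine setIntegral_mono_on (H.integrable_sub_mul_sub y).integrableOn
      (H.integrable_sub_mul_sub m).integrableOn measurableSet_Iic fun t ht => ?_
    have ht : t ≤ y := ht
    exact mul_le_mul_of_nonneg_right (by linarith) (by linarith)
  have hmono : MonotoneOn Ψ (Set.Icc y x) := by
    have hsub {z : ℝ} (hz : z ∈ Set.Icc y x) : z ∈ support l u :=
      hmem (hly.trans_le (EReal.coe_le_coe_iff.2 hz.1)) (hz.2.trans hx)
    refine monotoneOn_of_deriv_nonneg (convex_Icc _ _)
      (fun z hz => (hder (hsub hz)).continuousAt.continuousWithinAt)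
      (fun z hz => (hder (hsub (interior_subset hz))).differentiableAt.differentiableWithinAt)
      fun z hz => ?_
    have hz := interior_subset hz
    rw [(hder (hsub hz)).deriv]
    refine mul_nonneg (H.tail_pos (hsub hz).1 (hsub hz).2).le ?_
    have : z ≤ x₁ := hz.2.trans hx
    rw [hc]
    nlinarith
  have h2 : Ψ y ≤ Ψ x := hmono ⟨le_rfl, hyx.le⟩ ⟨hyx.le, le_rfl⟩ hyx.le
  have hy' := hmem hly (hyx.le.trans hx)
  have h3 := mul_pos (H.tail_pos hy'.1 hy'.2) (H.coeff_pos hy'.1 hy'.2)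
  have h4 : c * tail₂ m ν y < ε := by
    rw [lt_div_iff₀ hc0] at hy
    nlinarith
  have h5 : Ψ y = tail m ν y * (b₂ * y ^ 2 + b₁ * y + b₀) - c * tail₂ m ν y := rfl
  linarith

/-- The centred version of the Stein numerator near the left endpoint. -/
lemma abs_stein_numerator_le (H : PearsonDensity m b₀ b₁ b₂ ν l u p) {h : ℝ → ℝ} {K : ℝ}
    (hh : ∀ x y, |h x - h y| ≤ K * |x - y|) (h0 : ∫ x, h x ∂ν = 0) {x : ℝ} (hx : x ≤ m) :
    |tail m ν x * h x - (m - x) * ∫ y in Set.Iic x, h y ∂ν| ≤ 2 * K * tail₂ m ν x := by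
  have := H.prob
  have hL := H.memLp_of_abs_sub_le hh
  have hc := continuous_of_abs_sub_le hh
  have hi : Integrable h ν := hL.integrable one_le_two
  have hmL : MemLp (fun y : ℝ => m - y) 2 ν := (memLp_const m).sub H.memLp_id
  have hxL : MemLp (fun y : ℝ => x - y) 2 ν := (memLp_const x).sub H.memLp_id
  have hdL : MemLp (fun y : ℝ => h x - h y) 2 ν := (memLp_const (h x)).sub hL
  have i1 : Integrable (fun y => (m - y) * (h x - h y)) ν := hmL.integrable_mul hdL
  have i2 : Integrable (fun y => (x - y) * h y) ν := hxL.integrable_mul hL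
  -- The first integral is at most `K * tail₂` by the Lipschitz bound. The second has the antitone
  -- weight `(x - y)⁺` and falls under the association inequality, with the same bound.
  have e : tail m ν x * h x - (m - x) * ∫ y in Set.Iic x, h y ∂ν =
      (∫ y in Set.Iic x, (m - y) * (h x - h y) ∂ν) + ∫ y in Set.Iic x, (x - y) * h y ∂ν := by
    rw [← integral_add i1.integrableOn i2.integrableOn, tail, ← integral_mul_const,
      ← integral_const_mul, ← integral_sub (H.integrable_sub.integrableOn.mul_const _)
        (hi.integrableOn.const_mul _)]
    congr 1; funext y; ring
  have h1 : |∫ y in Set.Iic x, (m - y) * (h x - h y) ∂ν| ≤ K * tail₂ m ν x := by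
    rw [tail₂, ← integral_const_mul, ← Real.norm_eq_abs]
    refine norm_integral_le_of_norm_le ((H.integrable_sub_mul_sub x).integrableOn.const_mul K) ?_
    refine (ae_restrict_iff' measurableSet_Iic).2 (.of_forall fun y hy => ?_)
    have hy : y ≤ x := hy
    have h2 := hh x y
    rw [abs_of_nonneg (sub_nonneg.2 hy)] at h2
    rw [Real.norm_eq_abs, abs_mul, abs_of_nonneg (by linarith : 0 ≤ m - y)]
    nlinarith
  have hind (φ : ℝ → ℝ) : ∫ y, max (x - y) 0 * φ y ∂ν = ∫ y in Set.Iic x, (x - y) * φ y ∂ν := by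
    rw [← integral_indicator measurableSet_Iic]
    congr 1; funext y
    by_cases hy : y ≤ x
    · rw [Set.indicator_of_mem (Set.mem_Iic.2 hy), max_eq_left (by linarith)]
    · rw [Set.indicator_of_notMem (by simpa using hy), max_eq_right (by linarith), zero_mul]
  have hψL : MemLp (fun y : ℝ => max (x - y) 0) 2 ν := by
    refine hxL.of_le (by fun_prop) (.of_forall fun y => ?_)
    rw [Real.norm_eq_abs, Real.norm_eq_abs, abs_of_nonneg (le_max_right _ _)]
    exact max_le (le_abs_self _) (abs_nonneg _)
  have h2 := abs_integral_mul_le_of_antitone (ψ := fun y => max (x - y) 0) H.integrable_id H.mean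
    hh hc hi h0 (fun y z hyz => max_le_max (by linarith) le_rfl) (hψL.integrable_mul hL)
    (hψL.integrable_mul hmL)
  rw [hind, hind] at h2
  rw [e]
  refine (abs_add_le _ _).trans ?_
  have h3 : tail₂ m ν x = ∫ y in Set.Iic x, (x - y) * (m - y) ∂ν := rfl
  rw [← h3] at h2
  linarith

/-- The indicator of a left half-line is antitone, so this is again the association inequality. -/
lemma abs_setIntegral_le (H : PearsonDensity m b₀ b₁ b₂ ν l u p) {h : ℝ → ℝ} {K : ℝ}
    (hh : ∀ x y, |h x - h y| ≤ K * |x - y|) (h0 : ∫ x, h x ∂ν = 0) (x : ℝ) :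
    |∫ y in Set.Iic x, h y ∂ν| ≤ K * tail m ν x := by
  have := H.prob
  have hi : Integrable h ν := (H.memLp_of_abs_sub_le hh).integrable one_le_two
  have hind (φ : ℝ → ℝ) : (fun y => (Set.Iic x).indicator 1 y * φ y) =
      (Set.Iic x).indicator φ := by
    funext y
    by_cases hy : y ∈ Set.Iic x <;> simp [hy]
  have h1 := abs_integral_mul_le_of_antitone (ψ := (Set.Iic x).indicator 1) H.integrable_id H.mean
    hh (continuous_of_abs_sub_le hh) hi h0 (fun y z hyz => ?_)
    (by rw [hind]; exact hi.indicator measurableSet_Iic)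
    (by rw [hind fun y => m - y]; exact H.integrable_sub.indicator measurableSet_Iic)
  · rw [hind, hind fun y => m - y, integral_indicator measurableSet_Iic,
      integral_indicator measurableSet_Iic] at h1
    exact h1
  · by_cases hz : z ∈ Set.Iic x
    · have hy : y ∈ Set.Iic x := le_trans hyz hz
      simp [hz, hy]
    · rw [Set.indicator_of_notMem hz]
      exact Set.indicator_nonneg (fun _ _ => zero_le_one) y

end PearsonDensity

/-! ### Fourth moment and leading coefficient. -/

namespace PearsonDensity

variable {m b₀ b₁ b₂ : ℝ} {ν : Measure ℝ} {l u : EReal} {p : ℝ → ℝ}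

/-- If `b₂ ≥ 1/2`, the derivative `p x² ((3 b₂ - 1) x² + ...)` of `tail * x³` is non-negative for
large `x`, hence `tail ≥ c / x³`. Since `tail = b p ≤ B x² p`, the function `x⁴ p` dominates a
multiple of `1 / x` and is not integrable. -/
lemma lt_half_of_top (H : PearsonDensity m b₀ b₁ b₂ ν l ⊤ p)
    (h4 : Integrable (fun x : ℝ => x ^ 4) ν) : b₂ < 1 / 2 := by
  by_contra! hb
  obtain ⟨x₀, hx₀⟩ := H.exists_mem_support
  -- Beyond `X` the quadratic term, of coefficient at least `1/2`, absorbs the lower order terms.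
  set X := max x₀ (2 * (|3 * b₁ + m| + |3 * b₀|) + 1) with hX
  have hX0 : x₀ ≤ X := le_max_left _ _
  have hX1 : 2 * (|3 * b₁ + m| + |3 * b₀|) + 1 ≤ X := le_max_right _ _
  have hX2 : 1 ≤ X := by linarith [abs_nonneg (3 * b₁ + m), abs_nonneg (3 * b₀)]
  have hmem {x : ℝ} (hx : X ≤ x) : x ∈ support l ⊤ :=
    ⟨hx₀.1.trans_le (EReal.coe_le_coe_iff.2 (hX0.trans hx)), EReal.coe_lt_top _⟩
  have hder {x : ℝ} (hx : X ≤ x) : HasDerivAt (fun x => tail m ν x * x ^ 3)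
      ((m - x) * p x * x ^ 3 + tail m ν x * (3 * x ^ 2)) x := by
    have h1 : HasDerivAt (fun x : ℝ => x ^ 3) (3 * x ^ 2) x := by
      simpa using hasDerivAt_pow 3 x
    exact (H.hasDerivAt_tail (hmem hx)).mul h1
  have hmono : MonotoneOn (fun x => tail m ν x * x ^ 3) (Set.Ici X) := by
    refine monotoneOn_of_deriv_nonneg (convex_Ici _)
      (fun z hz => (hder hz).continuousAt.continuousWithinAt)
      (fun z hz => (hder (interior_subset hz)).differentiableAt.differentiableWithinAt)
      fun z hz => ?_
    have hz : X ≤ z := interior_subset hz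
    rw [(hder hz).deriv, ← H.diffusion_mul (hmem hz).1 (hmem hz).2]
    have e : (m - z) * p z * z ^ 3 + (b₂ * z ^ 2 + b₁ * z + b₀) * p z * (3 * z ^ 2) =
        p z * z ^ 2 * ((3 * b₂ - 1) * z ^ 2 + (3 * b₁ + m) * z + 3 * b₀) := by ring
    rw [e]
    refine mul_nonneg (mul_nonneg (H.nonneg z) (sq_nonneg z)) ?_
    have hz1 : 1 ≤ z := hX2.trans hz
    have k1 := neg_abs_le (3 * b₁ + m)
    have k2 := neg_abs_le (3 * b₀)
    have k3 : -|3 * b₁ + m| * z ≤ (3 * b₁ + m) * z := by gcongr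
    have k4 : |3 * b₀| ≤ |3 * b₀| * z := le_mul_of_one_le_right (abs_nonneg _) hz1
    have k5 : 2 * (|3 * b₁ + m| + |3 * b₀|) * z ≤ z * z := by gcongr; linarith
    have k6 : 1 / 2 * z ^ 2 ≤ (3 * b₂ - 1) * z ^ 2 := by gcongr; linarith
    nlinarith
  set c := tail m ν X * X ^ 3 with hc
  have hc0 : 0 < c := mul_pos (H.tail_pos (hmem le_rfl).1 (hmem le_rfl).2) (by positivity)
  set B := |b₂| + |b₁| + |b₀| with hB
  have hβB {x : ℝ} (hx : X ≤ x) : b₂ * x ^ 2 + b₁ * x + b₀ ≤ B * x ^ 2 := by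
    have hx1 : 1 ≤ x := hX2.trans hx
    have k0 : x ≤ x ^ 2 := by nlinarith
    have k1 : b₂ * x ^ 2 ≤ |b₂| * x ^ 2 := by gcongr; exact le_abs_self _
    have k2 : b₁ * x ≤ |b₁| * x ^ 2 :=
      (mul_le_mul_of_nonneg_right (le_abs_self _) (by linarith)).trans (by gcongr)
    have k3 : b₀ ≤ |b₀| * x ^ 2 := (le_abs_self _).trans
      (le_mul_of_one_le_right (abs_nonneg _) (by nlinarith))
    rw [hB]; linarith
  have hB0 : 0 < B := by
    have h1 := (H.coeff_pos (hmem le_rfl).1 (hmem le_rfl).2).trans_le (hβB le_rfl)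
    exact pos_of_mul_pos_left h1 (sq_nonneg X)
  have hint := ((H.integrable_iff _).1 h4).integrableOn (s := Set.Ioi X)
  refine not_integrableOn_Ioi_inv (a := X) ?_
  refine (hint.const_mul (B / c)).mono (by fun_prop) ?_
  refine (ae_restrict_iff' measurableSet_Ioi).2 (.of_forall fun x hx => ?_)
  have hx : X ≤ x := le_of_lt hx
  have hx1 : 0 < x := by linarith
  have h1 : c ≤ tail m ν x * x ^ 3 := hmono (Set.mem_Ici.2 le_rfl) hx hx
  have hp := H.pos x (hmem hx).1 (hmem hx).2
  have h2 : tail m ν x ≤ B * x ^ 2 * p x := by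
    rw [← H.diffusion_mul (hmem hx).1 (hmem hx).2]
    exact mul_le_mul_of_nonneg_right (hβB hx) hp.le
  rw [Real.norm_eq_abs, Real.norm_eq_abs, abs_of_pos (by positivity), abs_of_pos (by positivity)]
  rw [inv_le_iff_one_le_mul₀ hx1]
  have h3 : c ≤ B * (x ^ 4 * p x) * x := by
    calc c ≤ tail m ν x * x ^ 3 := h1
      _ ≤ B * x ^ 2 * p x * x ^ 3 := by gcongr
      _ = B * (x ^ 4 * p x) * x := by ring
  rw [div_mul_eq_mul_div, div_mul_eq_mul_div, le_div_iff₀ hc0]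
  linarith

lemma mean_lt_right (H : PearsonDensity m b₀ b₁ b₂ ν l u p) : m < u := by
  have := H.reflect.left_lt_mean
  rw [EReal.coe_neg] at this
  exact EReal.neg_lt_neg_iff.1 this

lemma coeff_right_eq_zero {a : ℝ} (H : PearsonDensity m b₀ b₁ b₂ ν l a p) :
    b₂ * a ^ 2 + b₁ * a + b₀ = 0 := by
  have h := H.reflect
  rw [← EReal.coe_neg] at h
  have := h.coeff_left_eq_zero
  linarith

lemma deriv_coeff_right_nonpos {a : ℝ} (H : PearsonDensity m b₀ b₁ b₂ ν l a p) :
    2 * b₂ * a + b₁ ≤ 0 := by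
  have h := H.reflect
  rw [← EReal.coe_neg] at h
  have := h.deriv_coeff_left_nonneg
  linarith

/-- The fourth moment of a Pearson distribution is finite only if the leading coefficient of the
diffusion coefficient is small. -/
lemma lt_half (H : PearsonDensity m b₀ b₁ b₂ ν l u p)
    (h4 : Integrable (fun x : ℝ => x ^ 4) ν) : b₂ < 1 / 2 := by
  have h4' : Integrable (fun x : ℝ => x ^ 4) (ν.map Neg.neg) := by
    rw [integrable_map_measure (by fun_prop) (by fun_prop)]
    refine h4.congr (.of_forall fun x => ?_)
    simp only [Function.comp]
    ring
  induction l with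
  | top => exact absurd H.lt not_top_lt
  | bot =>
    have h := H.reflect
    rw [EReal.neg_bot] at h
    exact h.lt_half_of_top h4'
  | coe a =>
    induction u with
    | bot => exact absurd H.lt not_lt_bot
    | top => exact H.lt_half_of_top h4
    | coe b =>
      have hab : a < b := EReal.coe_lt_coe_iff.1 H.lt
      have h1 := H.coeff_left_eq_zero
      have h2 := H.coeff_right_eq_zero
      have h3 := H.coeff_pos (x := (a + b) / 2) (EReal.coe_lt_coe_iff.2 (by linarith))
        (EReal.coe_lt_coe_iff.2 (by linarith))
      -- On a bounded interval `b` vanishes at both ends, so its positivity at the midpoint forces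
      -- `b₂ < 0`.
      have h5 : b₂ * ((a + b) / 2) ^ 2 + b₁ * ((a + b) / 2) + b₀ = -(b₂ * (b - a) ^ 2 / 4) := by
        linear_combination (h1 + h2) / 2
      rw [h5] at h3
      have h6 : 0 < (b - a) ^ 2 := by have := sub_pos.2 hab; positivity
      nlinarith

/-! ### The Stein equation -/

/-- The solution of the Stein equation on the interval of the distribution. -/
noncomputable def stein (m : ℝ) (ν : Measure ℝ) (h : ℝ → ℝ) (x : ℝ) : ℝ :=
  (∫ y in Set.Iic x, h y ∂ν) / tail m ν x

lemma abs_stein_le (H : PearsonDensity m b₀ b₁ b₂ ν l u p) {h : ℝ → ℝ} {K : ℝ}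
    (hh : ∀ x y, |h x - h y| ≤ K * |x - y|) (h0 : ∫ x, h x ∂ν = 0) {x : ℝ}
    (hx : x ∈ support l u) : |stein m ν h x| ≤ K := by
  have h1 := H.tail_pos hx.1 hx.2
  rw [stein, abs_div, abs_of_pos h1, div_le_iff₀ h1]
  exact H.abs_setIntegral_le hh h0 x

/-- By `hasDerivAt_stein` the left side is `b |f'|` for the Stein solution `f`, so this bounds `f'`
near the left endpoint by a constant that depends on `h` only through `K`. -/
lemma exists_bound_left (H : PearsonDensity m b₀ b₁ b₂ ν l u p) (hb : b₂ < 1 / 2) :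
    ∃ x₁ ∈ support l u, ∃ C, 0 ≤ C ∧ ∀ (h : ℝ → ℝ) (K : ℝ), (∀ x y, |h x - h y| ≤ K * |x - y|) →
      ∫ x, h x ∂ν = 0 → ∀ x : ℝ, l < x → x ≤ x₁ →
        |h x + (x - m) * stein m ν h x| ≤ K * C * (b₂ * x ^ 2 + b₁ * x + b₀) := by
  obtain ⟨x₁, hx₁, hm, hc⟩ := H.exists_slope_pos hb
  set c := (2 * b₂ - 1) * x₁ + b₁ + m with hcdef
  refine ⟨x₁, hx₁, 2 / c, by positivity, fun h K hh h0 x hl hx => ?_⟩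
  have hu : (x : EReal) < u := (EReal.coe_le_coe_iff.2 hx).trans_lt hx₁.2
  have hs := H.tail_pos hl hu
  have h1 := H.abs_stein_numerator_le hh h0 (hx.trans hm)
  have h2 := H.tail₂_le_mul hx₁ hm hb hl hx
  have hK := nonneg_of_abs_sub_le hh
  have e : h x + (x - m) * stein m ν h x =
      (tail m ν x * h x - (m - x) * ∫ y in Set.Iic x, h y ∂ν) / tail m ν x := by
    rw [stein]; field_simp; ring
  rw [e, abs_div, abs_of_pos hs, div_le_iff₀ hs]
  calc _ ≤ 2 * K * tail₂ m ν x := h1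
    _ ≤ 2 * K * ((tail m ν x * (b₂ * x ^ 2 + b₁ * x + b₀)) / c) := by
        gcongr
        rw [le_div_iff₀ hc, mul_comm]
        exact h2
    _ = K * (2 / c) * (b₂ * x ^ 2 + b₁ * x + b₀) * tail m ν x := by ring

lemma stein_reflect (H : PearsonDensity m b₀ b₁ b₂ ν l u p) {h : ℝ → ℝ} (hc : Continuous h)
    (hi : Integrable h ν) (h0 : ∫ x, h x ∂ν = 0) (x : ℝ) :
    stein (-m) (ν.map Neg.neg) (fun y => h (-y)) (-x) = -stein m ν h x := by
  have key {φ : ℝ → ℝ} (hφ : Continuous φ) (hφi : Integrable φ ν) (hφ0 : ∫ x, φ x ∂ν = 0) :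
      ∫ y in Set.Iic (-x), φ (-y) ∂(ν.map Neg.neg) = -∫ y in Set.Iic x, φ y ∂ν := by
    rw [setIntegral_map measurableSet_Iic (by fun_prop) (by fun_prop)]
    have e : (Neg.neg ⁻¹' Set.Iic (-x) : Set ℝ) = Set.Ici x := by ext y; simp
    rw [e]
    simp only [neg_neg]
    have h1 := integral_add_compl (measurableSet_Iic (a := x)) hφi
    rw [hφ0, Set.compl_Iic] at h1
    rw [H.setIntegral_eq φ measurableSet_Ici, integral_Ici_eq_integral_Ioi,
      ← H.setIntegral_eq φ measurableSet_Ioi]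
    linarith
  have ht : tail (-m) (ν.map Neg.neg) (-x) = tail m ν x := by
    have h1 := key (φ := fun y => y - m) (by fun_prop) (by
      refine H.integrable_sub.neg.congr (.of_forall fun y => ?_)
      simp) (by
      have := H.integral_sub_eq_zero
      rw [← neg_eq_zero, ← integral_neg] at this
      refine Eq.trans (congrArg _ (funext fun y => ?_)) this
      ring)
    rw [tail, tail, ← neg_inj, ← integral_neg]
    rw [← integral_neg] at h1
    have e1 : (fun y : ℝ => -(-m - y)) = fun y => m + y := by funext y; ring
    have e2 : (fun y : ℝ => -y - m) = fun y => -(m + y) := by funext y; ring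
    have e3 : (fun y : ℝ => -(y - m)) = fun y => m - y := by funext y; ring
    rw [e2, e3, integral_neg] at h1
    rw [e1]
    linarith
  rw [stein, stein, key hc hi h0, ht, neg_div]

lemma exists_bound_right (H : PearsonDensity m b₀ b₁ b₂ ν l u p) (hb : b₂ < 1 / 2) :
    ∃ x₂ ∈ support l u, ∃ C, 0 ≤ C ∧ ∀ (h : ℝ → ℝ) (K : ℝ), (∀ x y, |h x - h y| ≤ K * |x - y|) →
      ∫ x, h x ∂ν = 0 → ∀ x : ℝ, x₂ ≤ x → x < u →
        |h x + (x - m) * stein m ν h x| ≤ K * C * (b₂ * x ^ 2 + b₁ * x + b₀) := by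
  obtain ⟨x₂, hx₂, C, hC, hbd⟩ := H.reflect.exists_bound_left hb
  refine ⟨-x₂, ⟨?_, ?_⟩, C, hC, fun h K hh h0 x hx hu => ?_⟩
  · rw [EReal.coe_neg]; exact EReal.lt_neg_comm.1 hx₂.2
  · rw [EReal.coe_neg]; exact EReal.neg_lt_comm.1 hx₂.1
  have hc := continuous_of_abs_sub_le hh
  have := H.prob
  have hi := (H.memLp_of_abs_sub_le hh).integrable one_le_two
  have h1 := hbd (fun y => h (-y)) K (fun y z => by
      have := hh (-y) (-z)
      rwa [← neg_add', abs_neg, ← sub_eq_add_neg] at this) (by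
      rw [integral_map (by fun_prop) (by fun_prop)]
      simpa using h0) (-x) (by rw [EReal.coe_neg]; exact EReal.neg_lt_neg_iff.2 hu) (by linarith)
  rw [H.stein_reflect hc hi h0, neg_neg] at h1
  have e1 : h x + (-x - -m) * -stein m ν h x = h x + (x - m) * stein m ν h x := by ring
  have e2 : b₂ * (-x) ^ 2 + -b₁ * -x + b₀ = b₂ * x ^ 2 + b₁ * x + b₀ := by ring
  rwa [e1, e2] at h1

/-- The two ends are covered by the previous lemmas; on the compact middle part `b` is bounded away
from 0. -/
lemma exists_bound (H : PearsonDensity m b₀ b₁ b₂ ν l u p) (hb : b₂ < 1 / 2) :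
    ∃ C, 0 ≤ C ∧ ∀ (h : ℝ → ℝ) (K : ℝ), (∀ x y, |h x - h y| ≤ K * |x - y|) →
      ∫ x, h x ∂ν = 0 → ∀ x ∈ support l u,
        |h x + (x - m) * stein m ν h x| ≤ K * C * (b₂ * x ^ 2 + b₁ * x + b₀) := by
  have := H.prob
  obtain ⟨x₁, hx₁, C₁, hC₁, hl⟩ := H.exists_bound_left hb
  obtain ⟨x₂, hx₂, C₂, hC₂, hr⟩ := H.exists_bound_right hb
  set A := ∫ y, |y| ∂ν with hA
  have hcont : ContinuousOn (fun x => (|x| + A + |x - m|) / (b₂ * x ^ 2 + b₁ * x + b₀))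
      (Set.Icc x₁ x₂) := by
    refine ContinuousOn.div (by fun_prop) (by fun_prop) fun x hx => ?_
    have := ordConnected_support.out hx₁ hx₂ hx
    exact (H.coeff_pos this.1 this.2).ne'
  obtain ⟨C₃, hC₃⟩ := isCompact_Icc.bddAbove_image hcont
  refine ⟨max (max C₁ C₂) C₃, hC₁.trans ((le_max_left _ _).trans (le_max_left _ _)),
    fun h K hh h0 x hx => ?_⟩
  have hβ := H.coeff_pos hx.1 hx.2
  have hK := nonneg_of_abs_sub_le hh
  have mono {C : ℝ} (hC : C ≤ max (max C₁ C₂) C₃) : K * C * (b₂ * x ^ 2 + b₁ * x + b₀) ≤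
      K * max (max C₁ C₂) C₃ * (b₂ * x ^ 2 + b₁ * x + b₀) := by gcongr
  rcases le_or_gt x x₁ with h1 | h1
  · exact (hl h K hh h0 x hx.1 h1).trans (mono ((le_max_left _ _).trans (le_max_left _ _)))
  rcases le_or_gt x₂ x with h2 | h2
  · exact (hr h K hh h0 x h2 hx.2).trans (mono ((le_max_right _ _).trans (le_max_left _ _)))
  refine le_trans ?_ (mono (le_max_right _ _))
  have h3 : (|x| + A + |x - m|) / (b₂ * x ^ 2 + b₁ * x + b₀) ≤ C₃ :=
    hC₃ (Set.mem_image_of_mem (f := fun x => (|x| + A + |x - m|) / (b₂ * x ^ 2 + b₁ * x + b₀))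
      ⟨h1.le, h2.le⟩)
  rw [div_le_iff₀ hβ] at h3
  have hi := (H.memLp_of_abs_sub_le hh).integrable one_le_two
  -- A centred function is the average of its own increments.
  have h4 : |h x| ≤ K * (|x| + A) := by
    have e : h x = ∫ y, (h x - h y) ∂ν := by
      rw [integral_sub (integrable_const _) hi, h0]; simp
    have e2 : K * (|x| + A) = ∫ y, K * (|x| + |y|) ∂ν := by
      rw [integral_const_mul, integral_add (integrable_const _) H.integrable_id.abs]; simp [hA]
    rw [e, e2, ← Real.norm_eq_abs]
    refine norm_integral_le_of_norm_le
      (((integrable_const _).add H.integrable_id.abs).const_mul K) (.of_forall fun y => ?_)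
    exact (hh x y).trans (mul_le_mul_of_nonneg_left (abs_sub _ _) hK)
  have h5 := H.abs_stein_le hh h0 hx
  calc |h x + (x - m) * stein m ν h x| ≤ |h x| + |x - m| * |stein m ν h x| := by
        rw [← abs_mul]; exact abs_add_le _ _
    _ ≤ K * (|x| + A) + |x - m| * K := by gcongr
    _ = K * (|x| + A + |x - m|) := by ring
    _ ≤ K * C₃ * (b₂ * x ^ 2 + b₁ * x + b₀) := by rw [mul_assoc]; gcongr

/-- The Stein equation `b f' = h + (x - m) f`: the quotient rule, with the density eliminated
through `p = tail / b`. -/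
lemma hasDerivAt_stein (H : PearsonDensity m b₀ b₁ b₂ ν l u p) {h : ℝ → ℝ} (hc : Continuous h)
    (hi : Integrable h ν) {x : ℝ} (hx : x ∈ support l u) :
    HasDerivAt (stein m ν h)
      ((h x + (x - m) * stein m ν h x) / (b₂ * x ^ 2 + b₁ * x + b₀)) x := by
  have hs := (H.tail_pos hx.1 hx.2).ne'
  have hβ := (H.coeff_pos hx.1 hx.2).ne'
  refine ((H.hasDerivAt_setIntegral_Iic hc hi hx).div (H.hasDerivAt_tail hx) hs).congr_deriv ?_
  rw [stein]
  have h1 := H.diffusion_mul hx.1 hx.2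
  have h2 : p x = tail m ν x / (b₂ * x ^ 2 + b₁ * x + b₀) := by
    rw [eq_div_iff hβ, ← h1]; ring
  rw [h2]
  field_simp
  ring

end PearsonDensity

/-! ### Extension of the Stein solution to the whole line. -/

namespace PearsonDensity

variable {m b₀ b₁ b₂ : ℝ} {ν : Measure ℝ} {l u : EReal} {p : ℝ → ℝ}

open Classical in
/-- The projection of `ℝ` onto the closure of the interval `(l, u)`. -/
noncomputable def clamp (l u : EReal) (x : ℝ) : ℝ :=
  if (x : EReal) ≤ l then l.toReal else if u ≤ x then u.toReal else x

lemma clamp_of_mem {x : ℝ} (hx : x ∈ support l u) : clamp l u x = x := by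
  rw [clamp, if_neg hx.1.not_ge, if_neg hx.2.not_ge]

lemma clamp_of_le_left {a x : ℝ} (hx : x ≤ a) : clamp a u x = a := by
  rw [clamp, if_pos (EReal.coe_le_coe_iff.2 hx), EReal.toReal_coe]

lemma clamp_of_right_le {a x : ℝ} (hl : l < a) (hx : a ≤ x) : clamp l a x = a := by
  rw [clamp, if_neg (hl.trans_le (EReal.coe_le_coe_iff.2 hx)).not_ge,
    if_pos (EReal.coe_le_coe_iff.2 hx), EReal.toReal_coe]

lemma abs_clamp_sub_le (hlu : l < u) (x y : ℝ) : |clamp l u x - clamp l u y| ≤ |x - y| := by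
  induction l with
  | top => exact absurd hlu not_top_lt
  | bot =>
    induction u with
    | bot => exact absurd hlu not_lt_bot
    | top => simp [clamp]
    | coe b =>
      simp only [clamp, le_bot_iff, EReal.coe_ne_bot, if_false, EReal.coe_le_coe_iff,
        EReal.toReal_coe]
      split_ifs <;> first
        | exact le_rfl
        | rcases abs_cases (x - y) with ⟨h, _⟩ | ⟨h, _⟩ <;> rw [h, abs_le] <;> constructor <;>
            linarith
  | coe a =>
    induction u with
    | bot => exact absurd hlu not_lt_bot
    | top =>
      simp only [clamp, top_le_iff, EReal.coe_ne_top, if_false, EReal.coe_le_coe_iff,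
        EReal.toReal_coe]
      split_ifs <;> first
        | exact le_rfl
        | rcases abs_cases (x - y) with ⟨h, _⟩ | ⟨h, _⟩ <;> rw [h, abs_le] <;> constructor <;>
            linarith
    | coe b =>
      have hab := EReal.coe_lt_coe_iff.1 hlu
      simp only [clamp, EReal.coe_le_coe_iff, EReal.toReal_coe]
      split_ifs <;> first
        | exact le_rfl
        | rcases abs_cases (x - y) with ⟨h, _⟩ | ⟨h, _⟩ <;> rw [h, abs_le] <;> constructor <;>
            linarith

lemma hasDerivAt_clamp_of_mem {x : ℝ} (hx : x ∈ support l u) : HasDerivAt (clamp l u) 1 x := by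
  refine (hasDerivAt_id x).congr_of_eventuallyEq ?_
  filter_upwards [isOpen_support.mem_nhds hx] with y hy
  rw [clamp_of_mem hy, id]

lemma hasDerivAt_clamp_of_lt {a x : ℝ} (hx : x < a) : HasDerivAt (clamp a u) 0 x := by
  refine (hasDerivAt_const x a).congr_of_eventuallyEq ?_
  filter_upwards [Iio_mem_nhds hx] with y hy
  rw [clamp_of_le_left (le_of_lt hy)]

lemma hasDerivAt_clamp_of_gt {a x : ℝ} (hl : l < a) (hx : a < x) :
    HasDerivAt (clamp l a) 0 x := by
  refine (hasDerivAt_const x a).congr_of_eventuallyEq ?_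
  filter_upwards [Ioi_mem_nhds hx] with y hy
  rw [clamp_of_right_le hl (le_of_lt hy)]

/-- A point where the diffusion coefficient does not vanish is inside the interval or outside of
its closure. -/
lemma hasDerivAt_clamp_of_notMem (H : PearsonDensity m b₀ b₁ b₂ ν l u p) {x : ℝ}
    (hx : x ∉ support l u) (h0 : b₂ * x ^ 2 + b₁ * x + b₀ ≠ 0) : HasDerivAt (clamp l u) 0 x := by
  by_cases hl : l < x
  · have hu : u ≤ x := not_lt.1 fun h => hx ⟨hl, h⟩
    induction u with
    | bot => exact absurd H.lt not_lt_bot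
    | top => exact absurd hu (EReal.coe_lt_top x).not_ge
    | coe a =>
      rcases (EReal.coe_le_coe_iff.1 hu).eq_or_lt with h | h
      · exact absurd (h ▸ H.coeff_right_eq_zero) h0
      · exact hasDerivAt_clamp_of_gt H.lt h
  · have hl : x ≤ l := not_lt.1 hl
    induction l with
    | top => exact absurd H.lt not_top_lt
    | bot => exact absurd hl (EReal.bot_lt_coe x).not_ge
    | coe a =>
      rcases (EReal.coe_le_coe_iff.1 hl).eq_or_lt with h | h
      · exact absurd (h ▸ H.coeff_left_eq_zero) h0
      · exact hasDerivAt_clamp_of_lt h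

/-- The points of the closure of the interval satisfy the closed conditions which hold in the
interval, and outside of the interval the diffusion coefficient at the projection vanishes. -/
lemma clamp_mem_of_isClosed (hlu : l < u) {s : Set ℝ} (hs : IsClosed s) (hsub : support l u ⊆ s)
    (x : ℝ) : clamp l u x ∈ s := by
  obtain ⟨x₀, hx₀l, hx₀u⟩ := EReal.lt_iff_exists_real_btwn.1 hlu
  by_cases hl : l < x
  · by_cases hu : x < u
    · rw [clamp_of_mem ⟨hl, hu⟩]; exact hsub ⟨hl, hu⟩
    have hu : u ≤ x := not_lt.1 hu
    induction u with
    | bot => exact absurd hlu not_lt_bot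
    | top => exact absurd hu (EReal.coe_lt_top x).not_ge
    | coe a =>
      rw [clamp_of_right_le hlu (EReal.coe_le_coe_iff.1 hu)]
      have h1 : Set.Ioo x₀ a ⊆ s := fun y hy => hsub
        ⟨hx₀l.trans (EReal.coe_lt_coe_iff.2 hy.1), EReal.coe_lt_coe_iff.2 hy.2⟩
      have h2 := closure_minimal h1 hs
      have h3 : x₀ < a := EReal.coe_lt_coe_iff.1 hx₀u
      rw [closure_Ioo h3.ne] at h2
      exact h2 ⟨h3.le, le_rfl⟩
  · have hl : x ≤ l := not_lt.1 hl
    induction l with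
    | top => exact absurd hlu not_top_lt
    | bot => exact absurd hl (EReal.bot_lt_coe x).not_ge
    | coe a =>
      rw [clamp_of_le_left (EReal.coe_le_coe_iff.1 hl)]
      have h1 : Set.Ioo a x₀ ⊆ s := fun y hy => hsub
        ⟨EReal.coe_lt_coe_iff.2 hy.1, (EReal.coe_lt_coe_iff.2 hy.2).trans hx₀u⟩
      have h2 := closure_minimal h1 hs
      have h3 : a < x₀ := EReal.coe_lt_coe_iff.1 hx₀l
      rw [closure_Ioo h3.ne] at h2
      exact h2 ⟨le_rfl, h3.le⟩

lemma coeff_clamp_eq_zero (H : PearsonDensity m b₀ b₁ b₂ ν l u p) {x : ℝ}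
    (hx : x ∉ support l u) : b₂ * clamp l u x ^ 2 + b₁ * clamp l u x + b₀ = 0 := by
  by_cases hl : l < x
  · have hu : u ≤ x := not_lt.1 fun h => hx ⟨hl, h⟩
    induction u with
    | bot => exact absurd H.lt not_lt_bot
    | top => exact absurd hu (EReal.coe_lt_top x).not_ge
    | coe a =>
      rw [clamp_of_right_le H.lt (EReal.coe_le_coe_iff.1 hu)]
      exact H.coeff_right_eq_zero
  · have hl : x ≤ l := not_lt.1 hl
    induction l with
    | top => exact absurd H.lt not_top_lt
    | bot => exact absurd hl (EReal.bot_lt_coe x).not_ge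
    | coe a =>
      rw [clamp_of_le_left (EReal.coe_le_coe_iff.1 hl)]
      exact H.coeff_left_eq_zero

/-- Solutions of the Stein equation, up to an error which vanishes on the interval. -/
lemma exists_stein_solution (H : PearsonDensity m b₀ b₁ b₂ ν l u p) (hb : b₂ < 1 / 2) :
    ∃ C, 0 ≤ C ∧ ∀ (h : ℝ → ℝ) (K : ℝ), (∀ x y, |h x - h y| ≤ K * |x - y|) →
      ∫ x, h x ∂ν = 0 → ∃ f d : ℝ → ℝ, (∀ x y, |f x - f y| ≤ K * C * |x - y|) ∧
        (∀ x, b₂ * x ^ 2 + b₁ * x + b₀ ≠ 0 → HasDerivAt f (d x) x) ∧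
        ∀ x, |h x + (x - m) * f x - (b₂ * x ^ 2 + b₁ * x + b₀) * d x| ≤
          2 * K * |x - clamp l u x| := by
  classical
  obtain ⟨C, hC, hbd⟩ := H.exists_bound hb
  refine ⟨C, hC, fun h K hh h0 => ?_⟩
  have := H.prob
  have hK := nonneg_of_abs_sub_le hh
  have hc := continuous_of_abs_sub_le hh
  have hi := (H.memLp_of_abs_sub_le hh).integrable one_le_two
  have hlip : LipschitzOnWith (K * C).toNNReal (stein m ν h) (support l u) := by
    refine ordConnected_support.convex.lipschitzOnWith_of_nnnorm_hasDerivWithin_le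
      (fun x hx => (H.hasDerivAt_stein hc hi hx).hasDerivWithinAt) fun x hx => ?_
    rw [← NNReal.coe_le_coe, coe_nnnorm, Real.coe_toNNReal _ (by positivity), Real.norm_eq_abs,
      abs_div, abs_of_pos (H.coeff_pos hx.1 hx.2), div_le_iff₀ (H.coeff_pos hx.1 hx.2)]
    exact hbd h K hh h0 x hx
  -- The extension serves only to give values at finite endpoints; the solution on the line is `g ∘
  -- clamp`.
  obtain ⟨g, hg, hgs⟩ := hlip.extend_real
  have hglip (x y : ℝ) : |g x - g y| ≤ K * C * |x - y| := by
    have := hg.dist_le_mul x y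
    rwa [Real.coe_toNNReal _ (by positivity)] at this
  -- At a finite endpoint `b = 0`, so this bound forces `h + (x - m) g = 0` there; outside the
  -- interval only increments from the endpoint remain in the error.
  have hθ : ∀ x, |h (clamp l u x) + (clamp l u x - m) * g (clamp l u x)| ≤
      K * C * (b₂ * clamp l u x ^ 2 + b₁ * clamp l u x + b₀) := by
    refine fun x => clamp_mem_of_isClosed H.lt (s := {y | |h y + (y - m) * g y| ≤
      K * C * (b₂ * y ^ 2 + b₁ * y + b₀)}) ?_ (fun y hy => ?_) x
    · have := hg.continuous
      exact isClosed_le (by fun_prop) (by fun_prop)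
    · rw [Set.mem_ofPred_eq, ← hgs hy]
      exact hbd h K hh h0 y hy
  have hgK : ∀ x, |g (clamp l u x)| ≤ K := by
    refine fun x => clamp_mem_of_isClosed H.lt (s := {y | |g y| ≤ K}) ?_ (fun y hy => ?_) x
    · have := hg.continuous
      exact isClosed_le (by fun_prop) (by fun_prop)
    · rw [Set.mem_ofPred_eq, ← hgs hy]
      exact H.abs_stein_le hh h0 hy
  refine ⟨fun x => g (clamp l u x), fun x => if x ∈ support l u then
    (h x + (x - m) * stein m ν h x) / (b₂ * x ^ 2 + b₁ * x + b₀) else 0,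
    fun x y => (hglip _ _).trans ?_, fun x hx => ?_, fun x => ?_⟩
  · exact mul_le_mul_of_nonneg_left (abs_clamp_sub_le H.lt x y) (mul_nonneg hK hC)
  · by_cases hxs : x ∈ support l u
    · beta_reduce
      rw [if_pos hxs]
      refine (H.hasDerivAt_stein hc hi hxs).congr_of_eventuallyEq ?_
      filter_upwards [isOpen_support.mem_nhds hxs] with y hy
      rw [clamp_of_mem hy, hgs hy]
    · beta_reduce
      rw [if_neg hxs]
      have h1 := H.hasDerivAt_clamp_of_notMem hxs hx
      rw [hasDerivAt_iff_isLittleO] at h1 ⊢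
      refine Asymptotics.IsBigO.trans_isLittleO ?_ h1
      refine Asymptotics.IsBigO.of_bound (K * C) (.of_forall fun y => ?_)
      simpa using hglip (clamp l u y) (clamp l u x)
  · by_cases hxs : x ∈ support l u
    · beta_reduce
      rw [if_pos hxs, clamp_of_mem hxs, ← hgs hxs, mul_div_cancel₀ _ (H.coeff_pos hxs.1 hxs.2).ne']
      simp
    · beta_reduce
      rw [if_neg hxs]
      have h1 := hθ x
      have h2 := hgK x
      have h3 := hh x (clamp l u x)
      rw [H.coeff_clamp_eq_zero hxs, mul_zero] at h1
      have h4 := abs_eq_zero.1 (le_antisymm h1 (abs_nonneg _))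
      have e : h x + (x - m) * g (clamp l u x) - (b₂ * x ^ 2 + b₁ * x + b₀) * 0 =
          (h x - h (clamp l u x)) + (x - clamp l u x) * g (clamp l u x) := by
        linear_combination h4
      rw [e]
      refine (abs_add_le _ _).trans ?_
      rw [abs_mul]
      have h5 := mul_le_mul_of_nonneg_left h2 (abs_nonneg (x - clamp l u x))
      linarith

open Classical in
/-- A test function which controls the distance to the interval. -/
lemma exists_excess_bound (H : PearsonDensity m b₀ b₁ b₂ ν l u p) (hb : b₂ < 1 / 2) :
    ∃ κ, 0 < κ ∧ ∀ x, κ * |x - clamp l u x| ≤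
      (b₂ * x ^ 2 + b₁ * x + b₀) * (if x ∈ support l u then 0 else -1) -
        (x - m) * (clamp l u x - x) := by
  have hleft : ∃ κ, 0 < κ ∧ ∀ x : ℝ, x ≤ l → κ * |x - clamp l u x| ≤
      (b₂ * x ^ 2 + b₁ * x + b₀) * (-1) - (x - m) * (clamp l u x - x) := by
    induction l with
    | top => exact absurd H.lt not_top_lt
    | bot => exact ⟨1, one_pos, fun x hx => absurd hx (EReal.bot_lt_coe x).not_ge⟩
    | coe a =>
      have h1 : a < m := EReal.coe_lt_coe_iff.1 H.left_lt_mean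
      refine ⟨m - a, sub_pos.2 h1, fun x hx => ?_⟩
      have hx := EReal.coe_le_coe_iff.1 hx
      have h2 := H.coeff_left_eq_zero
      have h3 := H.deriv_coeff_left_nonneg
      rw [clamp_of_le_left hx, abs_of_nonpos (by linarith)]
      -- With `t = a - x`, the right-hand side is `(m - a) t + b'(a) t + (1 - b₂) t²`, and the last
      -- two terms are non-negative. The other endpoint is symmetric.
      have h4 : 0 ≤ (1 - b₂) * (a - x) ^ 2 := mul_nonneg (by linarith) (sq_nonneg _)
      have h5 : 0 ≤ (2 * b₂ * a + b₁) * (a - x) := mul_nonneg h3 (by linarith)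
      have e : b₂ * x ^ 2 + b₁ * x + b₀ = b₂ * (a - x) ^ 2 - (2 * b₂ * a + b₁) * (a - x) := by
        linear_combination h2
      rw [e]
      nlinarith
  have hright : ∃ κ, 0 < κ ∧ ∀ x : ℝ, u ≤ x → κ * |x - clamp l u x| ≤
      (b₂ * x ^ 2 + b₁ * x + b₀) * (-1) - (x - m) * (clamp l u x - x) := by
    clear hleft
    induction u with
    | bot => exact absurd H.lt not_lt_bot
    | top => exact ⟨1, one_pos, fun x hx => absurd hx (EReal.coe_lt_top x).not_ge⟩
    | coe a =>
      have h1 : m < a := EReal.coe_lt_coe_iff.1 H.mean_lt_right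
      refine ⟨a - m, sub_pos.2 h1, fun x hx => ?_⟩
      have hx := EReal.coe_le_coe_iff.1 hx
      have h2 := H.coeff_right_eq_zero
      have h3 := H.deriv_coeff_right_nonpos
      rw [clamp_of_right_le H.lt hx, abs_of_nonneg (by linarith)]
      have h4 : 0 ≤ (1 - b₂) * (x - a) ^ 2 := mul_nonneg (by linarith) (sq_nonneg _)
      have h5 : (2 * b₂ * a + b₁) * (x - a) ≤ 0 :=
        mul_nonpos_of_nonpos_of_nonneg h3 (by linarith)
      have e : b₂ * x ^ 2 + b₁ * x + b₀ = b₂ * (x - a) ^ 2 + (2 * b₂ * a + b₁) * (x - a) := by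
        linear_combination h2
      rw [e]
      nlinarith
  obtain ⟨κ₁, hκ₁, h1⟩ := hleft
  obtain ⟨κ₂, hκ₂, h2⟩ := hright
  refine ⟨min κ₁ κ₂, lt_min hκ₁ hκ₂, fun x => ?_⟩
  by_cases hx : x ∈ support l u
  · rw [if_pos hx, clamp_of_mem hx]; simp
  · rw [if_neg hx]
    by_cases hl : l < x
    · refine le_trans ?_ (h2 x (not_lt.1 fun h => hx ⟨hl, h⟩))
      gcongr
      exact min_le_right _ _
    · refine le_trans ?_ (h1 x (not_lt.1 hl))
      gcongr
      exact min_le_left _ _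

end PearsonDensity

/-! ### The distance to a Pearson law and the Stein discrepancy. -/

namespace IsSteinKernel

variable {E : Type*} [MeasurableSpace E] {μ : Measure E} [IsProbabilityMeasure μ] {F τ : E → ℝ}
variable {m b₀ b₁ b₂ : ℝ}

lemma memLp_pearson_coeff (h : IsSteinKernel μ F τ) :
    MemLp (fun x => b₂ * (F x + m) ^ 2 + b₁ * (F x + m) + b₀) 2 μ := by
  refine (h.memLp_quadratic b₂ (2 * b₂ * m + b₁) (b₂ * m ^ 2 + b₁ * m + b₀)).congr_norm
    ?_ (.of_forall fun x => ?_)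
  · have := h.aestronglyMeasurable.aemeasurable
    exact AEMeasurable.aestronglyMeasurable (by fun_prop)
  · congr 1; ring

lemma integrable_pearson_coeff_mul (h : IsSteinKernel μ F τ) {f d : ℝ → ℝ} {C : ℝ} (hC : 0 ≤ C)
    (hf : ∀ x y, |f x - f y| ≤ C * |x - y|)
    (hd : ∀ x, b₂ * x ^ 2 + b₁ * x + b₀ ≠ 0 → HasDerivAt f (d x) x) :
    Integrable (fun x => (b₂ * (F x + m) ^ 2 + b₁ * (F x + m) + b₀) * d (F x + m)) μ := by
  have hi := (h.memLp_pearson_coeff (m := m) (b₀ := b₀) (b₁ := b₁) (b₂ := b₂)).integrable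
    one_le_two
  have h1 : Integrable (fun x => (b₂ * (F x + m) ^ 2 + b₁ * (F x + m) + b₀) *
      deriv f (F x + m)) μ := by
    refine hi.mul_bdd (c := C) ?_ (.of_forall fun x => ?_)
    · have := h.aestronglyMeasurable.aemeasurable
      exact ((measurable_deriv f).comp_aemeasurable (this.add_const m)).aestronglyMeasurable
    · have hL : LipschitzWith C.toNNReal f := .of_dist_le_mul fun x y => by
        rw [Real.coe_toNNReal _ hC]; exact hf x y
      simpa [hC] using norm_deriv_le_of_lipschitz (x₀ := F x + m) hL
  refine h1.congr (.of_forall fun x => ?_)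
  by_cases hx : b₂ * (F x + m) ^ 2 + b₁ * (F x + m) + b₀ = 0
  · simp only [hx, zero_mul]
  · simp only [(hd _ hx).deriv]

lemma integrable_mul_lipschitz (h : IsSteinKernel μ F τ) {f : ℝ → ℝ} {C : ℝ}
    (hf : ∀ x y, |f x - f y| ≤ C * |x - y|) : Integrable (fun x => F x * f (F x + m)) μ := by
  refine h.memLp_two.integrable_mul (q := 2) (MemLp.of_le
    (g := fun x => |f m| + C * |F x|) ?_ ?_ (.of_forall fun x => ?_))
  · exact (memLp_const |f m|).add (h.memLp_two.abs.const_mul C)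
  · exact (continuous_of_abs_sub_le hf).comp_aestronglyMeasurable
      (h.aestronglyMeasurable.add aestronglyMeasurable_const)
  · have h1 := hf (F x + m) m
    rw [add_sub_cancel_right] at h1
    have h2 := abs_sub_abs_le_abs_sub (f (F x + m)) (f m)
    rw [Real.norm_eq_abs, Real.norm_eq_abs]
    exact le_trans (by linarith) (le_abs_self _)

lemma integrable_lipschitz (h : IsSteinKernel μ F τ) {f : ℝ → ℝ} {C : ℝ}
    (hf : ∀ x y, |f x - f y| ≤ C * |x - y|) : Integrable (fun x => f (F x + m)) μ := by
  have hi : Integrable (fun x => |f m| + C * |F x|) μ :=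
    (integrable_const _).add ((h.memLp_two.integrable one_le_two).abs.const_mul C)
  refine hi.mono' ?_ (.of_forall fun x => ?_)
  · exact (continuous_of_abs_sub_le hf).comp_aestronglyMeasurable
      (h.aestronglyMeasurable.add aestronglyMeasurable_const)
  · have h1 := hf (F x + m) m
    rw [add_sub_cancel_right] at h1
    have h2 := abs_sub_abs_le_abs_sub (f (F x + m)) (f m)
    rw [Real.norm_eq_abs]
    linarith

lemma abs_integral_sub_pearson_le (h : IsSteinKernel μ F τ) {f d : ℝ → ℝ} {C : ℝ} (hC : 0 ≤ C)
    (hf : ∀ x y, |f x - f y| ≤ C * |x - y|)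
    (hd : ∀ x, b₂ * x ^ 2 + b₁ * x + b₀ ≠ 0 → HasDerivAt f (d x) x) :
    |∫ x, F x * f (F x + m) ∂μ -
        ∫ x, (b₂ * (F x + m) ^ 2 + b₁ * (F x + m) + b₀) * d (F x + m) ∂μ| ≤
      C * ∫ x, |τ x - (b₂ * (F x + m) ^ 2 + b₁ * (F x + m) + b₀)| ∂μ := by
  refine h.abs_integral_sub_le (f := fun x => f (x + m)) (d := fun x => d (x + m))
    (β := fun x => b₂ * (x + m) ^ 2 + b₁ * (x + m) + b₀) hC (fun x y => ?_) (by fun_prop)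
    (h.memLp_pearson_coeff.integrable one_le_two) fun x hx => (hd _ hx).comp_add_const x m
  simpa using hf (x + m) (y + m)

end IsSteinKernel

namespace PearsonDensity

variable {m b₀ b₁ b₂ : ℝ} {ν : Measure ℝ} {l u : EReal} {p : ℝ → ℝ}

/-- A bound for the distance to a Pearson distribution in terms of the Stein discrepancy. -/
lemma exists_stein_discrepancy_bound (H : PearsonDensity m b₀ b₁ b₂ ν l u p) (hb : b₂ < 1 / 2) :
    ∃ C, 0 ≤ C ∧ ∀ (h : ℝ → ℝ) (K : ℝ), (∀ x y, |h x - h y| ≤ K * |x - y|) →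
      ∀ {E : Type*} [MeasurableSpace E] (μ : Measure E) [IsProbabilityMeasure μ] (F τ : E → ℝ),
        IsSteinKernel μ F τ → |∫ x, h (F x + m) ∂μ - ∫ x, h x ∂ν| ≤
          K * C * ∫ x, |τ x - (b₂ * (F x + m) ^ 2 + b₁ * (F x + m) + b₀)| ∂μ := by
  classical
  have := H.prob
  obtain ⟨C, hC, hsol⟩ := H.exists_stein_solution hb
  obtain ⟨κ, hκ, hexc⟩ := H.exists_excess_bound hb
  -- `C` comes from the Lipschitz constant of the Stein solution, and `4 / κ` from its error `2K *
  -- dist` outside the interval, where `E dist ≤ 2δ / κ`.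
  refine ⟨C + 4 / κ, by positivity, fun h K hh E _ μ _ F τ hF => ?_⟩
  set δ := ∫ x, |τ x - (b₂ * (F x + m) ^ 2 + b₁ * (F x + m) + b₀)| ∂μ
  have hK := nonneg_of_abs_sub_le hh
  have hcl := abs_clamp_sub_le H.lt
  have hcl2 (x y : ℝ) : |(clamp l u x - x) - (clamp l u y - y)| ≤ 2 * |x - y| := by
    have e : (clamp l u x - x) - (clamp l u y - y) = (clamp l u x - clamp l u y) - (x - y) := by
      ring
    rw [e]
    linarith [abs_sub (clamp l u x - clamp l u y) (x - y), hcl x y]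
  have hclint : Integrable (fun x => |F x + m - clamp l u (F x + m)|) μ :=
    (hF.integrable_lipschitz (m := m) hcl2).abs.congr (.of_forall fun x => abs_sub_comm _ _)
  -- The test function `clamp x - x` is 2-Lipschitz and vanishes on the interval; its Stein defect
  -- is at most `2δ` and at least `κ` times the mean distance to the interval.
  have hclamp : κ * ∫ x, |F x + m - clamp l u (F x + m)| ∂μ ≤ 2 * δ := by
    have hd (x : ℝ) (hx : b₂ * x ^ 2 + b₁ * x + b₀ ≠ 0) : HasDerivAt (fun x => clamp l u x - x)
        ((fun x => if x ∈ support l u then (0 : ℝ) else -1) x) x := by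
      beta_reduce
      split_ifs with hs
      · exact ((hasDerivAt_clamp_of_mem hs).sub (hasDerivAt_id x)).congr_deriv (sub_self 1)
      · exact ((H.hasDerivAt_clamp_of_notMem hs hx).sub (hasDerivAt_id x)).congr_deriv (zero_sub 1)
    have h1 := hF.abs_integral_sub_pearson_le (m := m) zero_le_two hcl2 hd
    have i1 := hF.integrable_pearson_coeff_mul (m := m) zero_le_two hcl2 hd
    have i2 := hF.integrable_mul_lipschitz (m := m) hcl2
    rw [← integral_const_mul]
    refine le_trans (integral_mono (hclint.const_mul κ) (i1.sub i2) fun x => ?_) ?_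
    · have := hexc (F x + m)
      rwa [add_sub_cancel_right] at this
    · rw [integral_sub' i1 i2]
      exact (neg_sub _ _).symm.le.trans ((neg_le_abs _).trans h1)
  obtain ⟨f, d, hf, hd, hfd⟩ := hsol (fun x => h x - ∫ y, h y ∂ν) K (by simpa using hh) (by
    rw [integral_sub ((H.memLp_of_abs_sub_le hh).integrable one_le_two) (integrable_const _)]
    simp)
  have i0 := hF.integrable_lipschitz (m := m) hh
  have i3 : Integrable (fun x => h (F x + m) - ∫ y, h y ∂ν) μ := i0.sub (integrable_const _)
  have i1 := hF.integrable_pearson_coeff_mul (m := m) (mul_nonneg hK hC) hf hd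
  have i2 := hF.integrable_mul_lipschitz (m := m) hf
  have i4 : Integrable (fun x => (h (F x + m) - ∫ y, h y ∂ν) + F x * f (F x + m)) μ := i3.add i2
  have h1 := hF.abs_integral_sub_pearson_le (m := m) (mul_nonneg hK hC) hf hd
  have h2 : |∫ x, (h (F x + m) - ∫ y, h y ∂ν) + F x * f (F x + m) -
      (b₂ * (F x + m) ^ 2 + b₁ * (F x + m) + b₀) * d (F x + m) ∂μ| ≤
      2 * K * ∫ x, |F x + m - clamp l u (F x + m)| ∂μ := by
    refine abs_integral_le_integral_abs.trans ?_
    rw [← integral_const_mul]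
    refine integral_mono (i4.sub i1).abs (hclint.const_mul _) fun x => ?_
    have := hfd (F x + m)
    rwa [add_sub_cancel_right] at this
  rw [integral_sub i4 i1, integral_add i3 i2, integral_sub i0 (integrable_const _)] at h2
  simp only [integral_const, probReal_univ, one_smul] at h2
  have h3 : 2 * K * ∫ x, |F x + m - clamp l u (F x + m)| ∂μ ≤ K * (4 / κ) * δ := by
    have : ∫ x, |F x + m - clamp l u (F x + m)| ∂μ ≤ 2 * δ / κ := by
      rw [le_div_iff₀ hκ]; linarith
    calc _ ≤ 2 * K * (2 * δ / κ) := by gcongr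
      _ = _ := by ring
  rw [mul_add, add_mul]
  rw [abs_le] at h1 h2 ⊢
  constructor <;> linarith [h1.1, h1.2, h2.1, h2.2]

/-- Passage from `L¹` to `L²` by non-negativity of the variance; the added 1 makes the constant
positive. -/
lemma exists_bound_sqrt (H : PearsonDensity m b₀ b₁ b₂ ν l u p) (hb : b₂ < 1 / 2) (K : ℝ) :
    ∃ C, 0 < C ∧ ∀ (h : ℝ → ℝ), (∀ x y, |h x - h y| ≤ K * |x - y|) →
      ∀ {E : Type*} [MeasurableSpace E] (μ : Measure E) [IsProbabilityMeasure μ] (F τ : E → ℝ),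
        IsSteinKernel μ F τ → |∫ x, h (F x + m) ∂μ - ∫ x, h x ∂ν| ≤
          C * √(∫ x, (τ x - (b₂ * (F x + m) ^ 2 + b₁ * (F x + m) + b₀)) ^ 2 ∂μ) := by
  obtain ⟨C, hC, hbd⟩ := H.exists_stein_discrepancy_bound hb
  refine ⟨|K| * C + 1, by positivity, fun h hh E _ μ _ F τ hF => (hbd h K hh μ F τ hF).trans ?_⟩
  have hK := nonneg_of_abs_sub_le hh
  rw [abs_of_nonneg hK]
  have hL : MemLp (fun x => τ x - (b₂ * (F x + m) ^ 2 + b₁ * (F x + m) + b₀)) 2 μ :=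
    hF.memLp.sub hF.memLp_pearson_coeff
  have hδ : (∫ x, |τ x - (b₂ * (F x + m) ^ 2 + b₁ * (F x + m) + b₀)| ∂μ) ≤
      √(∫ x, (τ x - (b₂ * (F x + m) ^ 2 + b₁ * (F x + m) + b₀)) ^ 2 ∂μ) := by
    refine Real.le_sqrt_of_sq_le ?_
    have := variance_nonneg (fun x => |τ x - (b₂ * (F x + m) ^ 2 + b₁ * (F x + m) + b₀)|) μ
    rw [variance_eq_sub (X := fun x => |τ x - (b₂ * (F x + m) ^ 2 + b₁ * (F x + m) + b₀)|)
      hL.abs] at this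
    simpa [sq_abs] using this
  have h0 : (0 : ℝ) ≤ √(∫ x, (τ x - (b₂ * (F x + m) ^ 2 + b₁ * (F x + m) + b₀)) ^ 2 ∂μ) :=
    Real.sqrt_nonneg _
  have := mul_le_mul_of_nonneg_left hδ (mul_nonneg hK hC)
  linarith

end PearsonDensity

/-! ### Assembly of the two estimates. -/

lemma IsPearsonLaw.exists_pearsonDensity {m b₀ b₁ b₂ : ℝ} {ν : Measure ℝ}
    (hν : IsPearsonLaw m b₀ b₁ b₂ ν) (h4 : Integrable (fun x : ℝ => x ^ 4) ν) :
    ∃ l u p, PearsonDensity m b₀ b₁ b₂ ν l u p := by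
  obtain ⟨hP, -, hm, l, u, p, hlu, hp, hpos, hzero, hd, hb⟩ := hν
  refine ⟨l, u, p, hP, ?_, hm, hlu, hp, hpos, hzero, hd, hb⟩
  refine (h4.add (integrable_const 1)).mono' (by fun_prop) (.of_forall fun x => ?_)
  rw [Real.norm_eq_abs, abs_of_nonneg (sq_nonneg x), Pi.add_apply]
  nlinarith [sq_nonneg (x ^ 2 - 1), sq_nonneg x]

lemma abs_sub_le_of_abs_deriv_le {h : ℝ → ℝ} {K : ℝ}
    (hh : ∀ a b, AbsolutelyContinuousOnInterval h a b) (hK : ∀ᵐ x : ℝ, |deriv h x| ≤ K) (x y : ℝ) :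
    |h x - h y| ≤ K * |x - y| := by
  rw [← (hh y x).integral_deriv_eq_sub]
  exact intervalIntegral.norm_integral_le_of_norm_le_const_ae (f := deriv h)
    (hK.mono fun z hz _ => hz)

/-- Convergence of a sequence under a bound which depends on a parameter, with a second term
which is only positive when the parameter exceeds the threshold `a`. -/
lemma tendsto_zero_of_le_of_threshold {X U Q η : ℕ → ℝ} {a : ℝ} (ha : 0 ≤ a)
    (hX : ∀ k, 0 ≤ X k) (hQ : ∀ k, 0 ≤ Q k) (hη : ∀ k, 0 ≤ η k)
    (hle : ∀ k, X k ≤ (a - η k / 2) * U k + (η k - a) * (a / 4) * Q k)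
    (hU : Tendsto U atTop (𝓝 0))
    (hsub : ∀ φ : ℕ → ℕ, StrictMono φ → (∀ r, a < η (φ r)) →
      BddAbove (Set.range fun r => Q (φ r)) ∧ Tendsto (fun r => η (φ r)) atTop (𝓝 a)) :
    Tendsto X atTop (𝓝 0) := by
  have key : ∀ φ : ℕ → ℕ, StrictMono φ → (∀ r, η (φ r) ≤ a) ∨ (∀ r, a < η (φ r)) →
      Tendsto (fun r => X (φ r)) atTop (𝓝 0) := by
    rintro φ hφ (h | h)
    · have hU' : Tendsto (fun r => a * |U (φ r)|) atTop (𝓝 0) := by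
        simpa using ((hU.comp hφ.tendsto_atTop).abs).const_mul a
      refine squeeze_zero (fun r => hX _) (fun r => (hle _).trans ?_) hU'
      have h1 : (η (φ r) - a) * (a / 4) * Q (φ r) ≤ 0 :=
        mul_nonpos_of_nonpos_of_nonneg
          (mul_nonpos_of_nonpos_of_nonneg (by linarith [h r]) (by linarith)) (hQ _)
      have h2 : (a - η (φ r) / 2) * U (φ r) ≤ a * |U (φ r)| :=
        (mul_le_mul_of_nonneg_left (le_abs_self _) (by linarith [h r])).trans
          (mul_le_mul_of_nonneg_right (by linarith [hη (φ r)]) (abs_nonneg _))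
      linarith
    · obtain ⟨⟨B, hB⟩, hlim⟩ := hsub φ hφ h
      have hlim' : Tendsto (fun r => (a - η (φ r) / 2) * U (φ r) +
          (η (φ r) - a) * (a / 4) * B) atTop (𝓝 0) := by
        have h1 := ((hlim.div_const 2).const_sub a).mul (hU.comp hφ.tendsto_atTop)
        have h2 := ((hlim.sub_const a).mul_const (a / 4)).mul_const B
        simpa using h1.add h2
      refine squeeze_zero (fun r => hX _) (fun r => (hle _).trans ?_) hlim'
      have h1 := mul_le_mul_of_nonneg_left (hB ⟨r, rfl⟩)
        (mul_nonneg (sub_nonneg.2 (h r).le) (by linarith : 0 ≤ a / 4))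
      linarith
  -- If `X` fails to tend to 0, then `X ≥ ε` frequently, and frequently on one fixed side of the
  -- threshold; a subsequence staying on that side contradicts `key`.
  have key' (ε : ℝ) (hε : 0 < ε) (P : ℕ → Prop) (hP : ∃ᶠ k in atTop, ε ≤ X k ∧ P k)
      (h : ∀ φ : ℕ → ℕ, (∀ r, P (φ r)) → (∀ r, η (φ r) ≤ a) ∨ (∀ r, a < η (φ r))) : False := by
    obtain ⟨φ, hφ, h1⟩ := extraction_of_frequently_atTop hP
    obtain ⟨r, hr⟩ := ((key φ hφ (h φ fun r => (h1 r).2)).eventually_lt_const hε).exists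
    exact hr.not_ge (h1 r).1
  refine (tendsto_order.2 ⟨fun ε hε => .of_forall fun k => hε.trans_le (hX k), fun ε hε => ?_⟩)
  by_contra hne
  have hfr : ∃ᶠ k in atTop, (ε ≤ X k ∧ η k ≤ a) ∨ (ε ≤ X k ∧ a < η k) := by
    refine (not_eventually.1 hne).mono fun k hk => ?_
    rcases le_or_gt (η k) a with h | h
    · exact Or.inl ⟨not_lt.1 hk, h⟩
    · exact Or.inr ⟨not_lt.1 hk, h⟩
  rcases frequently_or_distrib.1 hfr with h | h
  · exact key' ε hε _ h fun φ h => Or.inl h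
  · exact key' ε hε _ h fun φ h => Or.inr h

lemma FullMarkovTriple.exists_isSteinKernel_le {E : Type*} [MeasurableSpace E] {μ : Measure E}
    [IsProbabilityMeasure μ] (T : FullMarkovTriple μ) {F : Lp ℝ 2 μ} {η : ℝ}
    (hF : T.IsChaoticEigenfunction F η) {m b₀ b₁ b₂ : ℝ} (hb : b₂ < 1 / 2) :
    1 < η ∧ ∃ τ : E → ℝ, IsSteinKernel μ F τ ∧
      ∫ x, (τ x - (b₂ * (F x + m) ^ 2 + b₁ * (F x + m) + b₀)) ^ 2 ∂μ ≤
        2 * (1 - b₂ - η / 4) * ∫ x, (pearsonU m b₀ b₁ b₂).eval (F x + m) ∂μ +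
          (η - 2 * (1 - b₂)) * (1 - b₂) / 2 *
            ∫ x, (pearsonQ m b₀ b₁ b₂).eval (F x + m) ^ 2 ∂μ := by
  obtain ⟨hη, τ, hτ, hspec⟩ := DiffusionTriple.IsChaoticEigenfunction.exists_isSteinKernel T hF
    (shiftedCoeffOne m b₁ b₂) (shiftedCoeffZero m b₀ b₁ b₂)
  exact ⟨hη, τ, hτ, hτ.integral_sub_pearson_sq_le hb.ne (by linarith) hspec⟩

/-- The factor `√2` arises because the quantity under the root in the theorem is compared with half
of the squared discrepancy. -/
lemma probDist_le_of_abs_integral_sub_le {H : Set (ℝ → ℝ)} {K C a X : ℝ} (hC : 0 ≤ C)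
    {ν : Measure ℝ} {E Ω : Type*} [MeasurableSpace E] [MeasurableSpace Ω] {μ : Measure E}
    {P : Measure Ω} {G : E → ℝ} {Z : Ω → ℝ} (hZ : HasLaw Z ν P)
    (hH : ∀ h ∈ H, ∀ x y, |h x - h y| ≤ K * |x - y|)
    (hbd : ∀ h : ℝ → ℝ, (∀ x y, |h x - h y| ≤ K * |x - y|) →
      |∫ x, h (G x) ∂μ - ∫ x, h x ∂ν| ≤ C * √X) (hX : X ≤ 2 * a) :
    probDist H G μ Z P ≤ ENNReal.ofReal (C * √2 * √a) := by
  refine iSup₂_le fun h hh => ENNReal.ofReal_le_ofReal ?_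
  have h1 : ∫ ω, h (Z ω) ∂P = ∫ x, h x ∂ν :=
    hZ.integral_comp (continuous_of_abs_sub_le (hH h hh)).aestronglyMeasurable
  rw [h1, mul_assoc, ← Real.sqrt_mul zero_le_two]
  exact (hbd h (hH h hh)).trans (mul_le_mul_of_nonneg_left (Real.sqrt_le_sqrt hX) hC)

theorem theorem3p6 (m b₀ b₁ b₂ : ℝ) (ν : Measure ℝ)
    (hν : IsPearsonLaw m b₀ b₁ b₂ ν) (hmom : Integrable (fun x : ℝ => x ^ 4) ν) :
    (∀ H : Set (ℝ → ℝ), IsSeparating H →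
      (∀ h ∈ H, ∀ a b : ℝ, AbsolutelyContinuousOnInterval h a b) →
      (∃ K : ℝ, ∀ h ∈ H, ∀ᵐ x : ℝ, |deriv h x| ≤ K) →
      ∃ c : ℝ, 0 < c ∧
        ∀ (E : ℕ → Type*) [∀ k, MeasurableSpace (E k)] (μ : ∀ k, Measure (E k))
          [∀ k, IsProbabilityMeasure (μ k)] (T : ∀ k, FullMarkovTriple (μ k))
          (F : ∀ k, Lp ℝ 2 (μ k)) (η : ℕ → ℝ)
          (_ : ∀ k, (T k).IsChaoticEigenfunction (F k) (η k))
          (Ω : Type*) [MeasurableSpace Ω] (P : Measure Ω) [IsProbabilityMeasure P]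
          (Z : Ω → ℝ) (_ : HasLaw Z ν P)
          (_ : ∀ h ∈ H, Integrable (fun ω => h (Z ω)) P ∧
            ∀ k, Integrable (fun x => h (F k x + m)) (μ k)) (k : ℕ),
          Integrable (fun x => (pearsonU m b₀ b₁ b₂).eval (F k x + m)) (μ k) ∧
          Integrable (fun x => (pearsonQ m b₀ b₁ b₂).eval (F k x + m) ^ 2) (μ k) ∧
          (η k ≤ 2 * (1 - b₂) →
            0 ≤ (1 - b₂ - η k / 4) *
                ∫ x, (pearsonU m b₀ b₁ b₂).eval (F k x + m) ∂(μ k) ∧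
            probDist H (fun x => F k x + m) (μ k) Z P ≤ ENNReal.ofReal (c *
              √((1 - b₂ - η k / 4) *
                ∫ x, (pearsonU m b₀ b₁ b₂).eval (F k x + m) ∂(μ k)))) ∧
          (2 * (1 - b₂) < η k →
            0 ≤ (1 - b₂ - η k / 4) *
                ∫ x, (pearsonU m b₀ b₁ b₂).eval (F k x + m) ∂(μ k) +
              (η k - 2 * (1 - b₂)) * (1 - b₂) / 2 *
                ∫ x, (pearsonQ m b₀ b₁ b₂).eval (F k x + m) ^ 2 ∂(μ k) ∧
            probDist H (fun x => F k x + m) (μ k) Z P ≤ ENNReal.ofReal (c *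
              √((1 - b₂ - η k / 4) *
                  ∫ x, (pearsonU m b₀ b₁ b₂).eval (F k x + m) ∂(μ k) +
                (η k - 2 * (1 - b₂)) * (1 - b₂) / 2 *
                  ∫ x, (pearsonQ m b₀ b₁ b₂).eval (F k x + m) ^ 2 ∂(μ k))))) ∧
    (∀ (E : ℕ → Type*) [∀ k, MeasurableSpace (E k)] (μ : ∀ k, Measure (E k))
        [∀ k, IsProbabilityMeasure (μ k)] (T : ∀ k, FullMarkovTriple (μ k))
        (F : ∀ k, Lp ℝ 2 (μ k)) (η : ℕ → ℝ)
        (_ : ∀ k, (T k).IsChaoticEigenfunction (F k) (η k))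
        (Ω : Type*) [MeasurableSpace Ω] (P : Measure Ω) [IsProbabilityMeasure P]
        (Z : Ω → ℝ) (_ : HasLaw Z ν P),
        Tendsto (fun k => ∫ x, (pearsonU m b₀ b₁ b₂).eval (F k x + m) ∂(μ k)) atTop (𝓝 0) →
        (∀ φ : ℕ → ℕ, StrictMono φ → (∀ r, 2 * (1 - b₂) < η (φ r)) →
          BddAbove (Set.range fun r =>
            ∫ x, (pearsonQ m b₀ b₁ b₂).eval (F (φ r) x + m) ^ 2 ∂(μ (φ r))) ∧
          Tendsto (fun r => η (φ r)) atTop (𝓝 (2 * (1 - b₂)))) →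
        TendstoInDistribution (fun k x => F k x + m) atTop Z μ P) := by
  obtain ⟨l, u, p, H⟩ := hν.exists_pearsonDensity hmom
  have hb : b₂ < 1 / 2 := H.lt_half hmom
  refine ⟨fun 𝓗 _ hac ⟨K, hK⟩ => ?_, ?_⟩
  · obtain ⟨C, hC, hbd⟩ := H.exists_bound_sqrt hb K
    refine ⟨C * √2, by positivity, ?_⟩
    intro E _ μ _ T F η hF Ω _ P _ Z hZ _ k
    obtain ⟨hη, τ, hτ, hle⟩ := (T k).exists_isSteinKernel_le (hF k) (m := m) (b₀ := b₀)
      (b₁ := b₁) hb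
    have hX : 0 ≤ ∫ x, (τ x - (b₂ * (F k x + m) ^ 2 + b₁ * (F k x + m) + b₀)) ^ 2 ∂(μ k) :=
      integral_nonneg fun x => sq_nonneg _
    have hQ : 0 ≤ ∫ x, (pearsonQ m b₀ b₁ b₂).eval (F k x + m) ^ 2 ∂(μ k) :=
      integral_nonneg fun x => sq_nonneg _
    have hlip := fun h (hh : h ∈ 𝓗) => abs_sub_le_of_abs_deriv_le (hac h hh) (hK h hh)
    have hbd' := fun h hh => hbd h hh (μ k) (F k) τ hτ
    refine ⟨hτ.integrable_pearsonU, hτ.integrable_pearsonQ_sq, fun hηb => ?_, fun hηb => ?_⟩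
    -- Below the threshold the `Q` term of the estimate is non-positive and may be dropped.
    · have h1 := mul_nonpos_of_nonpos_of_nonneg
        (mul_nonpos_of_nonpos_of_nonneg (sub_nonpos.2 hηb) (by linarith : 0 ≤ (1 - b₂) / 2)) hQ
      refine ⟨by linarith, probDist_le_of_abs_integral_sub_le hC.le hZ hlip hbd' (by linarith)⟩
    -- Above it the `Q` term is non-negative, so it may be doubled to fit the common factor 2.
    · have h1 := mul_nonneg (mul_nonneg (sub_nonneg.2 hηb.le) (by linarith : 0 ≤ (1 - b₂) / 2)) hQ
      refine ⟨by linarith, probDist_le_of_abs_integral_sub_le hC.le hZ hlip hbd' (by linarith)⟩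
  · intro E _ μ _ T F η hF Ω _ P _ Z hZ hU hsub
    choose hη τ hτ hle using fun k => (T k).exists_isSteinKernel_le (hF k) (m := m) (b₀ := b₀)
      (b₁ := b₁) hb
    have hX : Tendsto (fun k => ∫ x, (τ k x - (b₂ * (F k x + m) ^ 2 + b₁ * (F k x + m) + b₀)) ^ 2
        ∂(μ k)) atTop (𝓝 0) := by
      refine tendsto_zero_of_le_of_threshold (a := 2 * (1 - b₂))
        (Q := fun k => ∫ x, (pearsonQ m b₀ b₁ b₂).eval (F k x + m) ^ 2 ∂(μ k)) (by linarith)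
        (fun k => integral_nonneg fun x => sq_nonneg _)
        (fun k => integral_nonneg fun x => sq_nonneg _) (fun k => (one_pos.trans (hη k)).le)
        (fun k => (hle k).trans_eq ?_) hU hsub
      ring
    have hF' (k : ℕ) : AEMeasurable (fun x => F k x + m) (μ k) :=
      (hτ k).aestronglyMeasurable.aemeasurable.add_const m
    -- Bounded Lipschitz functions determine convergence in distribution; for each of them the Stein
    -- bound applies with a constant independent of `k`.
    refine ⟨hF', hZ.aemeasurable, tendsto_iff_forall_lipschitz_integral_tendsto.2 ?_⟩
    rintro f - ⟨K, hf⟩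
    have hf' (x y : ℝ) : |f x - f y| ≤ K * |x - y| := hf.dist_le_mul x y
    obtain ⟨C, hC, hbd⟩ := H.exists_bound_sqrt hb K
    simp only [ProbabilityMeasure.coe_mk]
    rw [hZ.map_eq]
    simp_rw [fun k => integral_map (hF' k) (f := f) hf.continuous.aestronglyMeasurable]
    rw [tendsto_iff_norm_sub_tendsto_zero]
    refine squeeze_zero (fun k => norm_nonneg _)
      (fun k => hbd f hf' (μ k) (F k) (τ k) (hτ k)) ?_
    simpa using (hX.sqrt).const_mul C
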